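/- Fix $M\ge 1$, service rates $\mu_1>\mu_2>\dots>\mu_M>0$, fractions $\gamma_1,\dots,\gamma_M>0$ with $\sum_{j=1}^M\mu_j\gamma_j=1$, and $\beta>0$. For each $n$ consider a system of $n$ parallel servers, each with its own infinite-buffer FCFS queue, of which $N_j^{(n)}$ are of type $j$ (so $\sum_j N_j^{(n)}=n$); a type-$j$ server serves at exponential rate $\mu_j$. Jobs arrive according to a Poisson process of rate $n\lambda^{(n)}$, $0<\lambda^{(n)}<1$, and are routed by Speed-Aware JSQ: each arrival joins a server with the minimum queue length in the system, ties between types being broken in favour of the fastest type and ties within a type uniformly at random. Let $Q_{j,i}^{(n)}(t)$ be the number of type-$j$ servers with at least $i$ jobs at time $t$; $\mathbf Q^{(n)}=(Q_{j,i}^{(n)})_{1\le j\le M,\,i\ge1}$ is a continuous-time Markov chain on the countable set of arrays $\mathbf s$ of integers with $N_j^{(n)}\ge s_{j,1}\ge s_{j,2}\ge\dots\ge0$ for every $j$ and $s_{j,i}=0$ for all large $i$ (all queues are finite). Put $$Y_{j,1}^{(n)}=\frac{Q_{j,1}^{(n)}-N_j^{(n)}}{\sqrt n},\qquad Y_{j,i}^{(n)}=\frac{Q_{j,i}^{(n)}}{\sqrt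 n}\quad(i\ge2).$$ Suppose that $$\text{(A1)}\ \lim_{n\to\infty}\sqrt n\,(1-\lambda^{(n)})=\beta,\qquad \text{(A2)}\ \lim_{n\to\infty}\sqrt n\,\Bigl|\frac{N_j^{(n)}}{n}-\gamma_j\Bigr|=0\ \text{ for every } j .$$ Then there is $n_0$ such that for all $n\ge n_0$ the chain $\mathbf Q^{(n)}$ has a unique stationary distribution. Let $\mathbf Q^{(n)}(\infty)$ have this distribution and let $\mathbf Y^{(n)}(\infty)$ be the corresponding scaled array. There exist constants $C_1,C_2,C_3>0$ such that for all sufficiently large $n$ $$\mathbb E|Y_{j,1}^{(n)}(\infty)|<C_1n^{-1/2}\ (1\le j\le M-1),\qquad \mathbb E|Y_{M,1}^{(n)}(\infty)|\le C_2,\qquad \mathbb E|Y_{1,2}^{(n)}(\infty)|\le C_3 .$$ Moreover, for every $a\in(1/2,1)$ there is a constant $C_4(a)>0$ such that for all sufficiently large $n$ $$\mathbb E|Y_{j,i}^{(n)}(\infty)|\le C_4(a)\,n^{-(a-1/2)}\quad\text{for all } 2\le j\le M,\ i=2,\ \text{and for all } 1\le j\le M,\ i\ge3 .$$ Consequently,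 for every $\rho>1$ the laws of $\mathbf Y^{(n)}(\infty)$, $n\ge n_0$, form a tight family on the space of real arrays $(b_{j,i})_{1\le j\le M,\,i\ge1}$ with norm $\sum_{j,i}\rho^{-i}|b_{j,i}|<\infty$. -/

import Mathlib

open Filter Topology MeasureTheory
open scoped BoundedContinuousFunction ENNReal

namespace SAJSQ

/-- Occupancy states of a system with `m + 1` server pools, pool `j` having `N j` servers:
`occ j i` is the number of type-`j` servers with at least `i` jobs. Every queue is finite, so
`occ j i = 0` for all large `i`. Pools are indexed by `Fin (m + 1)`: pool `0` is the fastest and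
pool `Fin.last m` the slowest. -/
@[ext]
structure State {m : ℕ} (N : Fin (m + 1) → ℕ) where
  occ : Fin (m + 1) → ℕ → ℕ
  occ_zero : ∀ j, occ j 0 = N j
  anti : ∀ j, Antitone (occ j)
  finite : ∃ L, ∀ j i, L ≤ i → occ j i = 0

variable {m : ℕ} {N : Fin (m + 1) → ℕ}

namespace State

/-- The state space is discrete. -/
instance : TopologicalSpace (State N) := ⊥

instance : DiscreteTopology (State N) := ⟨rfl⟩

instance : MeasurableSpace (State N) := ⊤

instance : DiscreteMeasurableSpace (State N) := ⟨fun _ => trivial⟩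

theorem occ_le (q : State N) (j : Fin (m + 1)) (i : ℕ) : q.occ j i ≤ N j :=
  (q.anti j (Nat.zero_le i)).trans (q.occ_zero j).le

/-- Replace the single entry `(k, i + 1)` by `v`, where `v` keeps row `k` non-increasing. -/
def set (q : State N) (k : Fin (m + 1)) (i v : ℕ) (h₁ : v ≤ q.occ k i)
    (h₂ : q.occ k (i + 2) ≤ v) : State N where
  occ := Function.update q.occ k (Function.update (q.occ k) (i + 1) v)
  occ_zero := by
    intro j
    by_cases hj : j = k
    · subst hj
      simp [q.occ_zero]
    · simp [hj, q.occ_zero]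
  anti := by
    intro j
    by_cases hj : j = k
    · subst hj
      simp only [Function.update_self]
      refine antitone_nat_of_succ_le fun l => ?_
      have hl : q.occ j (l + 1) ≤ q.occ j l := q.anti j (Nat.le_succ l)
      by_cases ha : l = i
      · subst ha
        simpa [Function.update_apply] using h₁
      · by_cases hb : l = i + 1
        · subst hb
          simpa [Function.update_apply] using h₂
        · simpa [Function.update_apply, ha, hb] using hl
    · simpa [hj] using q.anti j
  finite := by
    obtain ⟨L, hL⟩ := q.finite
    refine ⟨max L (i + 2), fun j l hl => ?_⟩
    have h3 : L ≤ l := (le_max_left _ _).trans hl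
    have h4 : i + 2 ≤ l := (le_max_right _ _).trans hl
    by_cases hj : j = k
    · subst hj
      have h5 : l ≠ i + 1 := by omega
      simpa [Function.update_apply, h5] using hL j l h3
    · simpa [hj] using hL j l h3

/-- The state `q + e_{k,i+1}`: a type-`k` server with exactly `i` jobs receives a job. (If there is
no such server, the value is `q`; the generator never uses this case.) -/
def add (q : State N) (k : Fin (m + 1)) (i : ℕ) : State N :=
  if h : q.occ k (i + 1) < q.occ k i then
    q.set k i (q.occ k (i + 1) + 1) h
      ((q.anti k (Nat.le_succ (i + 1))).trans (Nat.le_succ _))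
  else q

/-- The state `q - e_{k,i+1}`: a type-`k` server with exactly `i + 1` jobs completes a job. (If
there is no such server, the value is `q`; this transition has rate `0`.) -/
def remove (q : State N) (k : Fin (m + 1)) (i : ℕ) : State N :=
  if h : q.occ k (i + 2) < q.occ k (i + 1) then
    q.set k i (q.occ k (i + 1) - 1)
      ((Nat.sub_le _ _).trans (q.anti k (Nat.le_succ i))) (Nat.le_sub_one_of_lt h)
  else q

/-- The Speed-Aware JSQ rule. In state `q` an arriving job is sent to a type-`k` server which has
`i - 1` jobs (`1 ≤ i`): some type-`k` server has fewer than `i` jobs, no server of any type has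
fewer than `i - 1` jobs, and no server of a faster type has fewer than `i` jobs. -/
def IsTarget (q : State N) (k : Fin (m + 1)) (i : ℕ) : Prop :=
  q.occ k i < N k ∧
    ∀ l j, 1 ≤ j → (j < i ∨ (j = i ∧ l < k)) → q.occ l j = N l

theorem IsTarget.unique {q : State N} {k k' : Fin (m + 1)} {i i' : ℕ}
    (h : q.IsTarget k i) (h' : q.IsTarget k' i') : k = k' ∧ i = i' := by
  have pos : ∀ {k : Fin (m + 1)} {i : ℕ}, q.IsTarget k i → 1 ≤ i := by
    intro k i h
    rcases Nat.eq_zero_or_pos i with rfl | h0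
    · exact absurd h.1 (by simp [q.occ_zero])
    · exact h0
  have h1 := pos h
  have h2 := pos h'
  have a : ¬ (i < i' ∨ (i = i' ∧ k < k')) := fun hh => h.1.ne (h'.2 k i h1 hh)
  have b : ¬ (i' < i ∨ (i' = i ∧ k' < k)) := fun hh => h'.1.ne (h.2 k' i' h2 hh)
  have e : i = i' := by omega
  refine ⟨?_, e⟩
  subst e
  simp only [lt_irrefl, true_and, false_or, not_lt] at a b
  exact le_antisymm b a

end State

open Classical in
/-- Arrival part of the generator, for unit arrival rate. -/
noncomputable def arrivalPart (f : State N → ℝ) (q : State N) : ℝ :=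
  ∑' p : Fin (m + 1) × ℕ,
    if q.IsTarget p.1 (p.2 + 1) then f (q.add p.1 p.2) - f q else 0

/-- Departure part of the generator: a type-`k` server with exactly `i + 1` jobs (there are
`occ k (i + 1) - occ k (i + 2)` of them) completes a job at rate `μ k`. -/
noncomputable def departurePart (μ : Fin (m + 1) → ℝ) (f : State N → ℝ) (q : State N) : ℝ :=
  ∑ k, ∑' i : ℕ, μ k * ((q.occ k (i + 1) : ℝ) - (q.occ k (i + 2) : ℝ)) *
    (f (q.remove k i) - f q)

theorem arrival_finite (f : State N → ℝ) (q : State N) [∀ k i, Decidable (q.IsTarget k i)] :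
    (Function.support fun p : Fin (m + 1) × ℕ =>
      if q.IsTarget p.1 (p.2 + 1) then f (q.add p.1 p.2) - f q else 0).Finite := by
  refine Set.Subsingleton.finite fun p hp p' hp' => ?_
  have h : q.IsTarget p.1 (p.2 + 1) := by
    by_contra h
    simp [h] at hp
  have h' : q.IsTarget p'.1 (p'.2 + 1) := by
    by_contra h
    simp [h] at hp'
  have := h.unique h'
  exact Prod.ext this.1 (by omega)

theorem departure_finite (c : ℝ) (g : ℕ → ℝ) (q : State N) (k : Fin (m + 1)) :
    (Function.support fun i : ℕ =>
      c * ((q.occ k (i + 1) : ℝ) - (q.occ k (i + 2) : ℝ)) * g i).Finite := by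
  obtain ⟨L, hL⟩ := q.finite
  refine (Set.finite_lt_nat L).subset fun i hi => ?_
  by_contra h
  have h : L ≤ i := not_lt.1 h
  simp [hL k (i + 1) (by omega), hL k (i + 2) (by omega)] at hi

theorem arrivalPart_add (f g : State N → ℝ) (q : State N) :
    arrivalPart (f + g) q = arrivalPart f q + arrivalPart g q := by
  classical
  unfold arrivalPart
  rw [← Summable.tsum_add (summable_of_hasFiniteSupport (arrival_finite f q))
    (summable_of_hasFiniteSupport (arrival_finite g q))]
  refine tsum_congr fun p => ?_
  split_ifs
  · simp only [Pi.add_apply]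
    ring
  · simp

theorem arrivalPart_smul (c : ℝ) (f : State N → ℝ) (q : State N) :
    arrivalPart (c • f) q = c * arrivalPart f q := by
  classical
  unfold arrivalPart
  rw [← tsum_mul_left]
  refine tsum_congr fun p => ?_
  split_ifs
  · simp only [Pi.smul_apply, smul_eq_mul]
    ring
  · simp

theorem departurePart_add (μ : Fin (m + 1) → ℝ) (f g : State N → ℝ) (q : State N) :
    departurePart μ (f + g) q = departurePart μ f q + departurePart μ g q := by
  unfold departurePart
  rw [← Finset.sum_add_distrib]
  refine Finset.sum_congr rfl fun k _ => ?_
  rw [← Summable.tsum_add (summable_of_hasFiniteSupport (departure_finite _ _ q k))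
    (summable_of_hasFiniteSupport (departure_finite _ _ q k))]
  refine tsum_congr fun i => ?_
  simp only [Pi.add_apply]
  ring

theorem departurePart_smul (μ : Fin (m + 1) → ℝ) (c : ℝ) (f : State N → ℝ) (q : State N) :
    departurePart μ (c • f) q = c * departurePart μ f q := by
  unfold departurePart
  rw [Finset.mul_sum]
  refine Finset.sum_congr rfl fun k _ => ?_
  rw [← tsum_mul_left]
  refine tsum_congr fun i => ?_
  simp only [Pi.smul_apply, smul_eq_mul]
  ring

theorem abs_arrivalPart_le (f : State N → ℝ) (B : ℝ) (hB : ∀ q, |f q| ≤ B) (q : State N) :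
    |arrivalPart f q| ≤ 2 * B := by
  classical
  have hB0 : 0 ≤ B := (abs_nonneg _).trans (hB q)
  unfold arrivalPart
  by_cases h : ∃ p : Fin (m + 1) × ℕ, q.IsTarget p.1 (p.2 + 1)
  · obtain ⟨p, hp⟩ := h
    rw [tsum_eq_single p]
    · rw [if_pos hp]
      have := abs_sub (f (q.add p.1 p.2)) (f q)
      linarith [hB (q.add p.1 p.2), hB q]
    · intro p' hne
      rw [if_neg]
      intro hp'
      have := hp'.unique hp
      exact hne (Prod.ext this.1 (by omega))
  · push Not at h
    simp [h, hB0]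

theorem abs_departurePart_le (μ : Fin (m + 1) → ℝ) (f : State N → ℝ) (B : ℝ)
    (hB : ∀ q, |f q| ≤ B) (q : State N) :
    |departurePart μ f q| ≤ (∑ k, |μ k| * N k) * (2 * B) := by
  have hB0 : 0 ≤ B := (abs_nonneg _).trans (hB q)
  obtain ⟨L, hL⟩ := q.finite
  unfold departurePart
  refine (Finset.abs_sum_le_sum_abs _ _).trans ?_
  rw [Finset.sum_mul]
  refine Finset.sum_le_sum fun k _ => ?_
  rw [tsum_eq_sum (s := Finset.range L)]
  · refine (Finset.abs_sum_le_sum_abs _ _).trans ?_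
    have hd : ∀ i, (0 : ℝ) ≤ (q.occ k (i + 1) : ℝ) - (q.occ k (i + 2) : ℝ) := fun i =>
      sub_nonneg.2 (Nat.cast_le.2 (q.anti k (Nat.le_succ (i + 1))))
    calc ∑ i ∈ Finset.range L, |μ k * ((q.occ k (i + 1) : ℝ) - (q.occ k (i + 2) : ℝ)) *
            (f (q.remove k i) - f q)|
        ≤ ∑ i ∈ Finset.range L,
            (|μ k| * (2 * B)) * ((q.occ k (i + 1) : ℝ) - (q.occ k (i + 2) : ℝ)) := by
          refine Finset.sum_le_sum fun i _ => ?_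
          rw [abs_mul, abs_mul, abs_of_nonneg (hd i)]
          have h1 : |f (q.remove k i) - f q| ≤ 2 * B := by
            have := abs_sub (f (q.remove k i)) (f q)
            linarith [hB (q.remove k i), hB q]
          calc |μ k| * ((q.occ k (i + 1) : ℝ) - (q.occ k (i + 2) : ℝ)) *
                |f (q.remove k i) - f q|
              ≤ |μ k| * ((q.occ k (i + 1) : ℝ) - (q.occ k (i + 2) : ℝ)) * (2 * B) :=
                mul_le_mul_of_nonneg_left h1 (mul_nonneg (abs_nonneg _) (hd i))
            _ = _ := by ring
      _ = (|μ k| * (2 * B)) * ((q.occ k 1 : ℝ) - (q.occ k (L + 1) : ℝ)) := by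
          rw [← Finset.mul_sum]
          congr 1
          exact Finset.sum_range_sub' (fun i => (q.occ k (i + 1) : ℝ)) L
      _ ≤ (|μ k| * (2 * B)) * N k := by
          refine mul_le_mul_of_nonneg_left ?_ (by positivity)
          have h1 : (q.occ k 1 : ℝ) ≤ N k := Nat.cast_le.2 (q.occ_le k 1)
          have h2 : (0 : ℝ) ≤ q.occ k (L + 1) := Nat.cast_nonneg _
          linarith
      _ = _ := by ring
  · intro i hi
    have : L ≤ i := by simpa using hi
    simp [hL k (i + 1) (by omega), hL k (i + 2) (by omega)]

/-- The infinitesimal generator of the occupancy process under Speed-Aware JSQ with total arrival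
rate `Λ`, service rates `μ` and pool sizes `N`. The jump rates are bounded, so it is a bounded
operator on the bounded functions on the state space. -/
noncomputable def generator (Λ : ℝ) (μ : Fin (m + 1) → ℝ) (N : Fin (m + 1) → ℕ) :
    (State N →ᵇ ℝ) →L[ℝ] (State N →ᵇ ℝ) :=
  LinearMap.mkContinuous
    { toFun := fun f => BoundedContinuousFunction.ofNormedAddCommGroupDiscrete
        (fun q => Λ * arrivalPart f q + departurePart μ f q)
        ((|Λ| + ∑ k, |μ k| * N k) * (2 * ‖f‖)) (by
          intro q
          have h : ∀ q, |f q| ≤ ‖f‖ := fun q => f.norm_coe_le_norm q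
          rw [Real.norm_eq_abs, add_mul]
          refine (abs_add_le _ _).trans (add_le_add ?_ (abs_departurePart_le μ f _ h q))
          rw [abs_mul]
          exact mul_le_mul_of_nonneg_left (abs_arrivalPart_le f _ h q) (abs_nonneg _))
      map_add' := by
        intro f g
        ext q
        have h1 := arrivalPart_add (⇑f) (⇑g) q
        have h2 := departurePart_add μ (⇑f) (⇑g) q
        simp only [BoundedContinuousFunction.coe_ofNormedAddCommGroupDiscrete,
          BoundedContinuousFunction.coe_add, h1, h2, Pi.add_apply]
        ring
      map_smul' := by
        intro c f
        ext q
        have h1 := arrivalPart_smul c (⇑f) q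
        have h2 := departurePart_smul μ c (⇑f) q
        simp only [BoundedContinuousFunction.coe_ofNormedAddCommGroupDiscrete,
          BoundedContinuousFunction.coe_smul, RingHom.id_apply, smul_eq_mul]
        rw [show (fun q => c * f q) = c • ⇑f from rfl, h1, h2]
        ring }
    ((|Λ| + ∑ k, |μ k| * N k) * 2) (by
      intro f
      rw [BoundedContinuousFunction.norm_le (by positivity)]
      intro q
      have h : ∀ q, |f q| ≤ ‖f‖ := fun q => f.norm_coe_le_norm q
      simp only [LinearMap.coe_mk, AddHom.coe_mk,
        BoundedContinuousFunction.coe_ofNormedAddCommGroupDiscrete, Real.norm_eq_abs]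
      rw [mul_assoc, add_mul]
      refine (abs_add_le _ _).trans (add_le_add ?_ (abs_departurePart_le μ f _ h q))
      rw [abs_mul]
      exact mul_le_mul_of_nonneg_left (abs_arrivalPart_le f _ h q) (abs_nonneg _))

theorem generator_apply (Λ : ℝ) (μ : Fin (m + 1) → ℝ) (f : State N →ᵇ ℝ) (q : State N) :
    generator Λ μ N f q = Λ * arrivalPart f q + departurePart μ f q := rfl

/-- The exponential of a bounded operator on a real normed space. -/
noncomputable def expOp {E : Type*} [NormedAddCommGroup E] [NormedSpace ℝ E] (A : E →L[ℝ] E) :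
    E →L[ℝ] E :=
  NormedSpace.exp A

/-- The transition semigroup `P_t = exp (t 𝒢)` of the occupancy process: `(P_t f) q` is the
expectation of `f` at time `t` for the process started in `q`. -/
noncomputable def semigroup (Λ : ℝ) (μ : Fin (m + 1) → ℝ) (N : Fin (m + 1) → ℕ) (t : ℝ) :
    (State N →ᵇ ℝ) →L[ℝ] (State N →ᵇ ℝ) :=
  expOp (t • generator Λ μ N)

/-- `π` is a stationary distribution of the occupancy process: `π P_t = π` for all `t ≥ 0`. -/
def IsStationary (Λ : ℝ) (μ : Fin (m + 1) → ℝ) (π : PMF (State N)) : Prop :=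
  ∀ t : ℝ, 0 ≤ t → ∀ f : State N →ᵇ ℝ,
    ∫ q, semigroup Λ μ N t f q ∂π.toMeasure = ∫ q, f q ∂π.toMeasure

/-- The diffusion-scaled components `Y_{j,i}`, `i ≥ 1`, in the system with `n` servers:
`(Q_{j,1} - N_j) / √n` for `i = 1` and `Q_{j,i} / √n` for `i ≥ 2`. -/
noncomputable def scaled (n : ℕ) (q : State N) (j : Fin (m + 1)) (i : ℕ) : ℝ :=
  if i = 1 then ((q.occ j 1 : ℝ) - (N j : ℝ)) / √(n : ℝ) else (q.occ j i : ℝ) / √(n : ℝ)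

theorem memℓp_scaled (ρ : ℝ) (n : ℕ) (q : State N) :
    Memℓp (E := fun _ : Fin (m + 1) × ℕ => ℝ)
      (fun p => (ρ ^ (p.2 + 1))⁻¹ * scaled n q p.1 (p.2 + 1)) 1 := by
  refine (memℓp_zero ?_).of_exponent_ge zero_le_one
  obtain ⟨L, hL⟩ := q.finite
  refine ((Set.finite_univ (α := Fin (m + 1))).prod (Set.finite_lt_nat (L + 1))).subset ?_
  rintro ⟨j, i⟩ hp
  refine ⟨Set.mem_univ _, ?_⟩
  by_contra h
  have h : L + 1 ≤ i := not_lt.1 h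
  have h1 : i ≠ 0 := by omega
  simp [scaled, hL j (i + 1) (by omega), h1] at hp

/-- The scaled state `Y = (Y_{j,i})_{j, i ≥ 1}` as an element of the weighted sequence space with
norm `∑_{j,i} ρ^{-i} |Y_{j,i}|`, identified with `ℓ¹` through `b_{j,i} ↦ ρ^{-i} b_{j,i}`; the
coordinate `(j, i)` of `ℓ¹` holds `ρ^{-(i+1)} Y_{j,i+1}`. -/
noncomputable def scaledSeq (ρ : ℝ) (n : ℕ) (q : State N) :
    lp (fun _ : Fin (m + 1) × ℕ => ℝ) 1 :=
  ⟨fun p => (ρ ^ (p.2 + 1))⁻¹ * scaled n q p.1 (p.2 + 1), memℓp_scaled ρ n q⟩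

/-- The sequence space carries its Borel σ-algebra. -/
noncomputable instance : MeasurableSpace (lp (fun _ : Fin (m + 1) × ℕ => ℝ) 1) := borel _

instance : BorelSpace (lp (fun _ : Fin (m + 1) × ℕ => ℝ) 1) := ⟨rfl⟩

end SAJSQ

/-! Everything is derived from drift inequalities for one invariant law: if `f ≥ 0` satisfies `gen f
≤ -g` with `g` bounded, then `g` has non-positive mean (`DriftBound`). Allowing unbounded `f` is
essential, since the test functions count jobs. Such a law is built in `exists_pmf_of_lyapunov` as a
limit of Cesàro averages of the uniformized chain, with an exponentially weighted job count as
Lyapunov function. Bounded test functions of both signs give stationarity. Uniqueness holds because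
every state can be emptied by departures.

Write `I` for the number of idle servers, `B` for the number of servers with at least two jobs, `X`
for the number of waiting jobs, `C` for the total capacity and `Λ` for the arrival rate, so that `C
- Λ` is of order `√n`. All pools except the slowest have together less capacity than `Λ`, by a
margin of order `n`. While one of them has an idle server the arrivals go there, so the square of
their idle count has drift at most `O(n) - c n I`, and that count has bounded mean (`mean_idle_le`).

The difficulty is the tail of `X`. On `{X ≥ z}` the drift of `I²` bounds the mean of `I² + 2 I B` by
`O(n) P(X ≥ z)` (`mean_idle_sq_le`); hence `I` is small compared with `√n` on average when `B` is a
large multiple of `√n`. The quantity `X - I` is the total number of jobs minus `n`. It moves by one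
at each event, with downward drift at least `C - Λ - c₁ I`, so a ramp function of it
(`mean_ramp_le`) yields, for a step `d` of order `√n`, `P(X ≥ z + d) ≤ P(X ≥ z) / 2 + error`
(`excessProb_add_le`). The error comes from states with small `B`, where some queue must exceed `u +
1`. Under JSQ a job can take such a position only if all shorter positions are full, so by flow
balance the error is at most polynomial in `n` times `P(X ≥ u n)`.

The recursion improves itself (`exists_tail_bound`): a crude exponential bound at level `n²` gives
negligible tails at level `n^(3/2)`, then `n`, and finally geometric tails on the scale `√n`. This
bounds the mean of `Q_{1,2}` by `O(√n)`, and `P(X ≥ N 0)` decays faster than any power of `n`. Every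
remaining occupancy is fed only when all fastest servers have two jobs, hence only when `X ≥ N 0`,
so its mean is bounded. Tightness follows from these first moments, as boxes with summable sides are
compact in `ℓ¹`. -/

namespace SAJSQ

variable {m : ℕ} {N : Fin (m + 1) → ℕ}

/-! ### Effect of single transitions on occupancies, idle servers and waiting jobs. -/

namespace State

theorem occ_add (q : State N) {k : Fin (m + 1)} {i : ℕ} (h : q.occ k (i + 1) < q.occ k i)
    (j : Fin (m + 1)) (l : ℕ) :
    (q.add k i).occ j l = q.occ j l + if j = k ∧ l = i + 1 then 1 else 0 := by
  rw [add, dif_pos h]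
  by_cases hj : j = k
  · subst hj
    by_cases hl : l = i + 1
    · subst hl
      simp [set]
    · simp [set, hl]
  · simp [set, hj]

theorem occ_remove (q : State N) {k : Fin (m + 1)} {i : ℕ}
    (h : q.occ k (i + 2) < q.occ k (i + 1)) (j : Fin (m + 1)) (l : ℕ) :
    (q.remove k i).occ j l + (if j = k ∧ l = i + 1 then 1 else 0) = q.occ j l := by
  rw [remove, dif_pos h]
  by_cases hj : j = k
  · subst hj
    by_cases hl : l = i + 1
    · subst hl
      simp only [set, Function.update_self, and_self, if_true]
      omega
    · simp [set, hl]
  · simp [set, hj]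

theorem IsTarget.occ_eq {q : State N} {k : Fin (m + 1)} {i : ℕ} (h : q.IsTarget k i)
    (j : Fin (m + 1)) {l : ℕ} (hl : l < i) : q.occ j l = N j := by
  rcases Nat.eq_zero_or_pos l with rfl | h0
  · exact q.occ_zero j
  · exact h.2 j l h0 (Or.inl hl)

theorem IsTarget.occ_lt {q : State N} {k : Fin (m + 1)} {i : ℕ} (h : q.IsTarget k (i + 1)) :
    q.occ k (i + 1) < q.occ k i := by
  rw [h.occ_eq k (Nat.lt_succ_self i)]
  exact h.1

/-- The target is the fastest pool among those not full at the least level where some pool is not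
full. Such a level exists because queues are finite and `k₀` is nonempty. -/
theorem exists_isTarget (q : State N) {k₀ : Fin (m + 1)} (h₀ : 0 < N k₀) :
    ∃ k i, q.IsTarget k (i + 1) := by
  classical
  have hex : ∃ i, ∃ k, q.occ k i < N k := by
    obtain ⟨L, hL⟩ := q.finite
    exact ⟨L, k₀, by rw [hL k₀ L le_rfl]; exact h₀⟩
  have h1 := Nat.find_spec hex
  have h2 : ∀ j, j < Nat.find hex → ∀ k, q.occ k j = N k := fun j hj k =>
    le_antisymm (q.occ_le k j) (not_lt.1 fun h => Nat.find_min hex hj ⟨k, h⟩)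
  generalize Nat.find hex = i at h1 h2
  have hne : (Finset.univ.filter fun k => q.occ k i < N k).Nonempty := by
    obtain ⟨k, hk⟩ := h1
    exact ⟨k, by simpa using hk⟩
  obtain ⟨k, hk, hmin⟩ := Finset.exists_min_image _ id hne
  simp only [Finset.mem_filter, Finset.mem_univ, true_and, id] at hk hmin
  have hpos : i ≠ 0 := by
    intro h0
    rw [h0, q.occ_zero] at hk
    exact lt_irrefl _ hk
  obtain ⟨i', rfl⟩ : ∃ i', i = i' + 1 := ⟨i - 1, by omega⟩
  refine ⟨k, i', hk, fun l j _ hj => ?_⟩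
  rcases hj with hj | ⟨rfl, hl⟩
  · exact h2 j hj l
  · exact le_antisymm (q.occ_le l _) (not_lt.1 fun h => absurd (hmin l h) (not_le.2 hl))

/-- Number of idle servers in the pools of `s`. -/
def idle (s : Finset (Fin (m + 1))) (q : State N) : ℕ := ∑ k ∈ s, (N k - q.occ k 1)

/-- Number of jobs of pool `k` at positions `≥ r` of their queues. -/
noncomputable def tail (q : State N) (k : Fin (m + 1)) (r : ℕ) : ℕ := ∑' i, q.occ k (i + r)

/-- Number of waiting jobs. -/
noncomputable def excess (q : State N) : ℕ := ∑ k, q.tail k 2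

theorem finite_support_occ (q : State N) (k : Fin (m + 1)) (r : ℕ) :
    (Function.support fun i => q.occ k (i + r)).Finite := by
  obtain ⟨L, hL⟩ := q.finite
  refine (Set.finite_lt_nat L).subset fun i hi => ?_
  by_contra h
  exact hi (hL k (i + r) (by have : L ≤ i := not_lt.1 h; omega))

theorem summable_occ (q : State N) (k : Fin (m + 1)) (r : ℕ) :
    Summable fun i => q.occ k (i + r) :=
  summable_of_hasFiniteSupport (q.finite_support_occ k r)

theorem tail_eq (q : State N) (k : Fin (m + 1)) (r : ℕ) :
    q.tail k r = q.occ k r + q.tail k (r + 1) := by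
  unfold tail
  have e : ∀ i, i + 1 + r = i + (r + 1) := fun i => by omega
  rw [tsum_eq_zero_add' (by simpa only [e] using q.summable_occ k (r + 1)), Nat.zero_add]
  simp only [e]

theorem occ_le_tail (q : State N) (k : Fin (m + 1)) (r : ℕ) : q.occ k r ≤ q.tail k r := by
  rw [tail_eq]; omega

/-- Formulated as a relation between two states, so that it serves arrivals and, read backwards,
departures. -/
theorem tail_eq_of_occ_eq {q q' : State N} {k k' : Fin (m + 1)} {i : ℕ}
    (h : ∀ j l, q'.occ j l = q.occ j l + if j = k ∧ l = i + 1 then 1 else 0) (r : ℕ) :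
    q'.tail k' r = q.tail k' r + if k' = k ∧ r ≤ i + 1 then 1 else 0 := by
  classical
  unfold tail
  simp_rw [h]
  have hs : Function.support (fun l => if k' = k ∧ l + r = i + 1 then 1 else 0) ⊆
      ({i + 1 - r} : Set ℕ) := by
    intro l hl
    simp only [Function.mem_support, ne_eq, ite_eq_right_iff, Classical.not_imp] at hl
    simp only [Set.mem_singleton_iff]
    omega
  rw [Summable.tsum_add (q.summable_occ k' r)
    (summable_of_hasFiniteSupport ((Set.finite_singleton _).subset hs))]
  congr 1
  rw [tsum_eq_single (i + 1 - r) (fun l hl => by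
    by_contra h0
    exact hl (hs h0))]
  refine if_congr ?_ rfl rfl
  refine and_congr_right fun _ => ?_
  omega

theorem tail_add (q : State N) {k : Fin (m + 1)} {i : ℕ} (h : q.occ k (i + 1) < q.occ k i)
    (j : Fin (m + 1)) (r : ℕ) :
    (q.add k i).tail j r = q.tail j r + if j = k ∧ r ≤ i + 1 then 1 else 0 :=
  tail_eq_of_occ_eq (q.occ_add h) r

theorem tail_remove (q : State N) {k : Fin (m + 1)} {i : ℕ}
    (h : q.occ k (i + 2) < q.occ k (i + 1)) (j : Fin (m + 1)) (r : ℕ) :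
    (q.remove k i).tail j r + (if j = k ∧ r ≤ i + 1 then 1 else 0) = q.tail j r :=
  (tail_eq_of_occ_eq (fun j l => (q.occ_remove h j l).symm) r).symm

theorem excess_add (q : State N) {k : Fin (m + 1)} {i : ℕ} (h : q.occ k (i + 1) < q.occ k i) :
    (q.add k i).excess = q.excess + if 1 ≤ i then 1 else 0 := by
  unfold excess
  simp_rw [q.tail_add h, Finset.sum_add_distrib]
  congr 1
  by_cases hi : 1 ≤ i
  · simp [hi]
  · simp [hi]

theorem excess_remove (q : State N) {k : Fin (m + 1)} {i : ℕ}
    (h : q.occ k (i + 2) < q.occ k (i + 1)) :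
    (q.remove k i).excess + (if 1 ≤ i then 1 else 0) = q.excess := by
  unfold excess
  simp_rw [← q.tail_remove h, Finset.sum_add_distrib]
  congr 1
  by_cases hi : 1 ≤ i
  · simp [hi]
  · simp [hi]

theorem idle_add (s : Finset (Fin (m + 1))) (q : State N) {k : Fin (m + 1)} {i : ℕ}
    (h : q.occ k (i + 1) < q.occ k i) :
    (q.add k i).idle s + (if k ∈ s ∧ i = 0 then 1 else 0) = q.idle s := by
  classical
  unfold idle
  have key : ∀ j, (N j - (q.add k i).occ j 1) + (if j = k then if i = 0 then 1 else 0 else 0) =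
      N j - q.occ j 1 := by
    intro j
    rw [q.occ_add h]
    by_cases hj : j = k
    · subst hj
      by_cases hi : i = 0
      · subst hi
        have := q.occ_zero j
        simp only [zero_add] at h ⊢
        simp only [and_self, if_true]
        omega
      · have h1 : ¬ (1 = i + 1) := by omega
        simp [hi]
    · simp [hj]
  rw [← Finset.sum_congr rfl fun j _ => key j, Finset.sum_add_distrib, Finset.sum_ite_eq']
  congr 1
  by_cases hk : k ∈ s <;> simp [hk]

theorem idle_remove (s : Finset (Fin (m + 1))) (q : State N) {k : Fin (m + 1)} {i : ℕ}
    (h : q.occ k (i + 2) < q.occ k (i + 1)) :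
    (q.remove k i).idle s = q.idle s + (if k ∈ s ∧ i = 0 then 1 else 0) := by
  classical
  unfold idle
  have key : ∀ j, (N j - (q.remove k i).occ j 1) =
      N j - q.occ j 1 + (if j = k then if i = 0 then 1 else 0 else 0) := by
    intro j
    have h1 := q.occ_remove h j 1
    have h2 := q.occ_le j 1
    by_cases hj : j = k
    · subst hj
      by_cases hi : i = 0
      · subst hi
        simp only [zero_add, and_self, if_true] at h1 ⊢
        omega
      · have h3 : ¬ (1 = i + 1) := by omega
        simp only [h3, and_false, if_false, add_zero] at h1
        simp [hi, h1]
    · simp only [hj, false_and, if_false, add_zero] at h1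
      simp [hj, h1]
  rw [Finset.sum_congr rfl fun j _ => key j, Finset.sum_add_distrib, Finset.sum_ite_eq']
  congr 1
  by_cases hk : k ∈ s <;> simp [hk]

theorem idle_le (s : Finset (Fin (m + 1))) (q : State N) : q.idle s ≤ ∑ k, N k :=
  (Finset.sum_le_sum fun _ _ => Nat.sub_le _ _).trans
    (Finset.sum_le_sum_of_subset (Finset.subset_univ s))

theorem cast_idle (s : Finset (Fin (m + 1))) (q : State N) :
    (q.idle s : ℝ) = ∑ k ∈ s, ((N k : ℝ) - q.occ k 1) := by
  unfold idle
  push_cast [Nat.cast_sub (q.occ_le _ 1)]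
  rfl

/-- The number of servers with exactly `i + 1` jobs in pool `k`. -/
noncomputable def dep (q : State N) (k : Fin (m + 1)) (i : ℕ) : ℝ :=
  (q.occ k (i + 1) : ℝ) - q.occ k (i + 2)

theorem dep_nonneg (q : State N) (k : Fin (m + 1)) (i : ℕ) : 0 ≤ q.dep k i :=
  sub_nonneg.2 (Nat.cast_le.2 (q.anti k (Nat.le_succ (i + 1))))

theorem dep_pos_iff (q : State N) (k : Fin (m + 1)) (i : ℕ) :
    0 < q.dep k i ↔ q.occ k (i + 2) < q.occ k (i + 1) := by
  simp [dep]

theorem summable_dep_mul (q : State N) (k : Fin (m + 1)) (g : ℕ → ℝ) :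
    Summable fun i => q.dep k i * g i := by
  have h := departure_finite 1 g q k
  simp only [one_mul] at h
  exact summable_of_hasFiniteSupport h

theorem summable_mul_occ (q : State N) (k : Fin (m + 1)) (r : ℕ) (g : ℕ → ℝ) :
    Summable fun i => g i * (q.occ k (i + r) : ℝ) := by
  refine summable_of_hasFiniteSupport ((q.finite_support_occ k r).subset fun i hi h => hi ?_)
  simp [show q.occ k (i + r) = 0 from h]

/-- Telescoping; the sum is finite since occupancies vanish at high levels. -/
theorem tsum_dep_ge (q : State N) (k : Fin (m + 1)) (r : ℕ) :
    ∑' i, q.dep k i * (if r ≤ i then 1 else 0) = q.occ k (r + 1) := by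
  obtain ⟨L, hL⟩ := q.finite
  rw [tsum_eq_sum (s := Finset.range (L + r)) (fun i hi => by
    have h : L + r ≤ i := by simpa using hi
    simp [dep, hL k (i + 1) (by omega), hL k (i + 2) (by omega)])]
  simp_rw [mul_ite, mul_one, mul_zero]
  rw [← Finset.sum_filter]
  have e : (Finset.range (L + r)).filter (fun i => r ≤ i) = Finset.Ico r (L + r) := by
    ext i; simp; omega
  rw [e, Finset.sum_Ico_eq_sum_range, Nat.add_sub_cancel]
  have := Finset.sum_range_sub' (fun i => (q.occ k (r + i + 1) : ℝ)) L
  simp only [add_zero] at this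
  rw [hL k (r + L + 1) (by omega), Nat.cast_zero, sub_zero] at this
  rw [← this]
  rfl

end State

/-! ### The generator on unbounded functions. -/

/-- The generator on arbitrary (possibly unbounded) functions. -/
noncomputable def gen (Λ : ℝ) (μ : Fin (m + 1) → ℝ) (f : State N → ℝ) (q : State N) : ℝ :=
  Λ * arrivalPart f q + departurePart μ f q

theorem arrivalPart_eq (f : State N → ℝ) {q : State N} {k : Fin (m + 1)} {i : ℕ}
    (h : q.IsTarget k (i + 1)) : arrivalPart f q = f (q.add k i) - f q := by
  classical
  unfold arrivalPart
  rw [tsum_eq_single (k, i)]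
  · rw [if_pos h]
  · intro p hp
    rw [if_neg]
    intro h'
    have := h'.unique h
    exact hp (Prod.ext this.1 (by omega))

theorem departurePart_eq (μ : Fin (m + 1) → ℝ) (f : State N → ℝ) (q : State N) :
    departurePart μ f q =
      ∑ k, μ k * ∑' i, q.dep k i * (f (q.remove k i) - f q) := by
  unfold departurePart
  refine Finset.sum_congr rfl fun k _ => ?_
  rw [← tsum_mul_left]
  exact tsum_congr fun i => by rw [State.dep, mul_assoc]

/-- An upper bound for the generator from upper bounds for the increments. -/
theorem gen_le {Λ : ℝ} (hΛ : 0 ≤ Λ) {μ : Fin (m + 1) → ℝ} (hμ : ∀ k, 0 ≤ μ k) (f : State N → ℝ)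
    {q : State N} {k₀ : Fin (m + 1)} {i₀ : ℕ} (h₀ : q.IsTarget k₀ (i₀ + 1)) {a : ℝ}
    (ha : f (q.add k₀ i₀) - f q ≤ a) (δ : Fin (m + 1) → ℕ → ℝ)
    (hδ : ∀ k i, q.occ k (i + 2) < q.occ k (i + 1) → f (q.remove k i) - f q ≤ δ k i) :
    gen Λ μ f q ≤ Λ * a + ∑ k, μ k * ∑' i, q.dep k i * δ k i := by
  unfold gen
  rw [arrivalPart_eq f h₀, departurePart_eq]
  refine add_le_add (mul_le_mul_of_nonneg_left ha hΛ) (Finset.sum_le_sum fun k _ => ?_)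
  refine mul_le_mul_of_nonneg_left ?_ (hμ k)
  refine Summable.tsum_le_tsum (fun i => ?_) (q.summable_dep_mul k _) (q.summable_dep_mul k _)
  rcases (q.dep_nonneg k i).eq_or_lt with h | h
  · simp [← h]
  · exact mul_le_mul_of_nonneg_left (hδ k i ((q.dep_pos_iff k i).1 h)) h.le

theorem gen_add (Λ : ℝ) (μ : Fin (m + 1) → ℝ) (f g : State N → ℝ) :
    gen Λ μ (f + g) = gen Λ μ f + gen Λ μ g := by
  funext q
  simp only [gen, arrivalPart_add, departurePart_add, Pi.add_apply]
  ring

theorem gen_smul (Λ : ℝ) (μ : Fin (m + 1) → ℝ) (c : ℝ) (f : State N → ℝ) :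
    gen Λ μ (c • f) = c • gen Λ μ f := by
  funext q
  simp only [gen, arrivalPart_smul, departurePart_smul, Pi.smul_apply, smul_eq_mul]
  ring

theorem gen_const (Λ : ℝ) (μ : Fin (m + 1) → ℝ) (c : ℝ) :
    gen Λ μ (fun _ : State N => c) = 0 := by
  funext q
  simp [gen, arrivalPart, departurePart]

theorem abs_gen_le (Λ : ℝ) (μ : Fin (m + 1) → ℝ) (f : State N → ℝ) (B : ℝ)
    (hB : ∀ q, |f q| ≤ B) (q : State N) :
    |gen Λ μ f q| ≤ (|Λ| + ∑ k, |μ k| * N k) * (2 * B) := by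
  unfold gen
  rw [add_mul]
  refine (abs_add_le _ _).trans (add_le_add ?_ (abs_departurePart_le μ f B hB q))
  rw [abs_mul]
  exact mul_le_mul_of_nonneg_left (abs_arrivalPart_le f B hB q) (abs_nonneg _)

/-- Positivity of the uniformized transition operator. -/
theorem neg_le_gen {Λ : ℝ} (hΛ : 0 ≤ Λ) {μ : Fin (m + 1) → ℝ} (hμ : ∀ k, 0 ≤ μ k)
    {k₀ : Fin (m + 1)} (hN : 0 < N k₀)
    {f : State N → ℝ} (hf : ∀ q, 0 ≤ f q) (q : State N) :
    -((Λ + ∑ k, μ k * N k) * f q) ≤ gen Λ μ f q := by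
  obtain ⟨k, i, h⟩ := q.exists_isTarget hN
  unfold gen
  rw [arrivalPart_eq f h, departurePart_eq, add_mul, neg_add]
  refine add_le_add ?_ ?_
  · nlinarith [hf (q.add k i)]
  · rw [Finset.sum_mul, ← Finset.sum_neg_distrib]
    refine Finset.sum_le_sum fun k _ => ?_
    rw [mul_assoc, ← mul_neg]
    refine mul_le_mul_of_nonneg_left ?_ (hμ k)
    have h1 : ∑' i, q.dep k i * (-f q) ≤ ∑' i, q.dep k i * (f (q.remove k i) - f q) :=
      Summable.tsum_le_tsum (fun i => mul_le_mul_of_nonneg_left (by linarith [hf (q.remove k i)])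
        (q.dep_nonneg k i)) (q.summable_dep_mul k _) (q.summable_dep_mul k _)
    refine le_trans ?_ h1
    have h2 := q.tsum_dep_ge k 0
    simp only [Nat.zero_le, if_true, mul_one, zero_add] at h2
    rw [tsum_mul_right, h2, mul_neg, neg_le_neg_iff]
    exact mul_le_mul_of_nonneg_right (Nat.cast_le.2 (q.occ_le k 1)) (hf q)

end SAJSQ

/-! ### Invariant laws from a Lyapunov function. -/

namespace SAJSQ

/-- A positive averaging operator on a discrete space with a Lyapunov function admits an invariant
probability law that satisfies every one-sided drift inequality. -/
theorem exists_pmf_of_lyapunov {X : Type*} [Nonempty X] (U : (X → ℝ) →ₗ[ℝ] (X → ℝ))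
    (hpos : ∀ f, 0 ≤ f → 0 ≤ U f) (hone : U 1 = 1) (V : X → ℝ) (hV : 0 ≤ V)
    (hfin : ∀ B : ℝ, {q | V q ≤ B}.Finite) (c K : ℝ) (hc : 0 < c)
    (hdrift : ∀ q, U V q ≤ V q - (c * V q - K)) :
    ∃ p : PMF X, ∀ f g : X → ℝ, 0 ≤ f → (∃ B, ∀ q, |g q| ≤ B) → (∀ q, U f q ≤ f q - g q) →
      ∑' q, (p q).toReal * g q ≤ 0 := by
  classical
  obtain ⟨q₀⟩ := ‹Nonempty X›
  have mono : ∀ f g : X → ℝ, f ≤ g → ∀ t, (U ^ t) f ≤ (U ^ t) g := by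
    intro f g hfg t
    induction t with
    | zero => simpa using hfg
    | succ t ih =>
      rw [pow_succ', Module.End.mul_apply, Module.End.mul_apply]
      have := hpos ((U ^ t) g - (U ^ t) f) (sub_nonneg.2 ih)
      rw [map_sub] at this
      exact sub_nonneg.1 this
  have pow_one' : ∀ t, (U ^ t) (1 : X → ℝ) = 1 := by
    intro t
    induction t with
    | zero => simp
    | succ t ih => rw [pow_succ', Module.End.mul_apply, ih, hone]
  -- Cesàro averages along the chain started at `q₀`; their limit points are invariant.
  set avg : ℕ → (X → ℝ) → ℝ := fun T f =>
    ((T : ℝ) + 1)⁻¹ * ∑ t ∈ Finset.range (T + 1), (U ^ t) f q₀ with havg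
  have avg_add : ∀ T f g, avg T (f + g) = avg T f + avg T g := by
    intro T f g
    simp [havg, Finset.sum_add_distrib, mul_add]
  have avg_smul : ∀ T (a : ℝ) f, avg T (a • f) = a * avg T f := by
    intro T a f
    simp only [havg, map_smul, Pi.smul_apply, smul_eq_mul, ← Finset.mul_sum]
    ring
  have avg_mono : ∀ T f g, f ≤ g → avg T f ≤ avg T g := fun T f g h =>
    mul_le_mul_of_nonneg_left (Finset.sum_le_sum fun t _ => mono f g h t q₀) (by positivity)
  have avg_one : ∀ T, avg T 1 = 1 := by
    intro T
    simp only [havg, pow_one', Pi.one_apply, Finset.sum_const, Finset.card_range, nsmul_eq_mul,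
      mul_one]
    push_cast
    exact inv_mul_cancel₀ (by positivity)
  have avg_const : ∀ T (a : ℝ), avg T (fun _ => a) = a := by
    intro T a
    have : (fun _ : X => a) = a • (1 : X → ℝ) := by ext; simp
    rw [this, avg_smul, avg_one, mul_one]
  -- Summing the drift inequality telescopes. Only `0 ≤ f` is used at the far end, so `f` may be
  -- unbounded.
  have avg_drift : ∀ T f g, 0 ≤ f → (∀ q, U f q ≤ f q - g q) →
      avg T g ≤ ((T : ℝ) + 1)⁻¹ * f q₀ := by
    intro T f g hf hfg
    refine mul_le_mul_of_nonneg_left ?_ (by positivity)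
    have h1 : ∀ T : ℕ, ∑ t ∈ Finset.range T, (U ^ t) g q₀ ≤ f q₀ - (U ^ T) f q₀ := by
      intro T
      induction T with
      | zero => simp
      | succ T ih =>
        rw [Finset.sum_range_succ]
        have h2 := mono (U f) (f - g) (fun q => hfg q) T q₀
        rw [map_sub, ← Module.End.mul_apply, ← pow_succ, Pi.sub_apply] at h2
        linarith
    have h3 := mono 0 f hf (T + 1) q₀
    rw [map_zero] at h3
    have h4 := h1 (T + 1)
    simp only [Pi.zero_apply] at h3
    linarith
  have hL : ∀ g : X → ℝ, ∃ l : ℝ, (∃ B, ∀ q, |g q| ≤ B) →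
      Tendsto (fun T => avg T g) (hyperfilter ℕ : Filter ℕ) (𝓝 l) := by
    intro g
    by_cases hg : ∃ B, ∀ q, |g q| ≤ B
    · obtain ⟨B, hB⟩ := hg
      have h1 : ∀ T, avg T g ∈ Set.Icc (-B) B := fun T => by
        constructor
        · rw [← avg_const T (-B)]
          exact avg_mono T _ _ fun q => (abs_le.1 (hB q)).1
        · rw [← avg_const T B]
          exact avg_mono T _ _ fun q => (abs_le.1 (hB q)).2
      obtain ⟨l, -, hl⟩ := (isCompact_Icc (a := -B) (b := B)).ultrafilter_le_nhds
        ((hyperfilter ℕ).map fun T => avg T g)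
        (by
          rw [le_principal_iff, Ultrafilter.coe_map, Filter.mem_map]
          exact Filter.univ_mem' h1)
      exact ⟨l, fun _ => hl⟩
    · exact ⟨0, fun h => absurd h hg⟩
  choose L hL using hL
  have L_add : ∀ f g : X → ℝ, (∃ B, ∀ q, |f q| ≤ B) → (∃ B, ∀ q, |g q| ≤ B) →
      L (f + g) = L f + L g := by
    rintro f g ⟨B, hB⟩ ⟨B', hB'⟩
    refine tendsto_nhds_unique (hL _ ⟨B + B', fun q => ?_⟩)
      (((hL f ⟨B, hB⟩).add (hL g ⟨B', hB'⟩)).congr fun T => (avg_add T f g).symm)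
    exact (abs_add_le _ _).trans (add_le_add (hB q) (hB' q))
  have L_smul : ∀ (a : ℝ) (f : X → ℝ), (∃ B, ∀ q, |f q| ≤ B) → L (a • f) = a * L f := by
    rintro a f ⟨B, hB⟩
    refine tendsto_nhds_unique (hL _ ⟨|a| * B, fun q => ?_⟩)
      (((hL f ⟨B, hB⟩).const_mul a).congr fun T => (avg_smul T a f).symm)
    rw [Pi.smul_apply, smul_eq_mul, abs_mul]
    exact mul_le_mul_of_nonneg_left (hB q) (abs_nonneg a)
  have L_mono : ∀ f g : X → ℝ, (∃ B, ∀ q, |f q| ≤ B) → (∃ B, ∀ q, |g q| ≤ B) → f ≤ g →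
      L f ≤ L g := fun f g hf hg h =>
    le_of_tendsto_of_tendsto' (hL f hf) (hL g hg) fun T => avg_mono T f g h
  have L_const : ∀ a : ℝ, L (fun _ => a) = a := fun a =>
    tendsto_nhds_unique (hL _ ⟨|a|, fun _ => le_rfl⟩)
      (tendsto_const_nhds.congr fun T => (avg_const T a).symm)
  have L_drift : ∀ f g : X → ℝ, 0 ≤ f → (∃ B, ∀ q, |g q| ≤ B) → (∀ q, U f q ≤ f q - g q) →
      L g ≤ 0 := by
    intro f g hf hg hfg
    have h1 : Tendsto (fun T : ℕ => ((T : ℝ) + 1)⁻¹ * f q₀) (hyperfilter ℕ : Filter ℕ) (𝓝 0) := by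
      have := (tendsto_one_div_add_atTop_nhds_zero_nat (𝕜 := ℝ)).mul_const (f q₀)
      simp only [one_div, zero_mul] at this
      exact this.mono_left (Nat.hyperfilter_le_atTop)
    exact le_of_tendsto_of_tendsto' (hL g hg) h1 fun T => avg_drift T f g hf hfg
  set e : X → X → ℝ := fun q q' => if q' = q then 1 else 0 with he
  have he01 : ∀ q q', |e q q'| ≤ 1 := fun q q' => by
    by_cases h : q' = q <;> simp [he, h]
  set p : X → ℝ := fun q => L (e q) with hp
  have hp0 : ∀ q, 0 ≤ p q := fun q => by
    rw [← L_const 0]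
    refine L_mono _ _ ⟨0, by simp⟩ ⟨1, he01 q⟩ fun q' => ?_
    by_cases h : q' = q <;> simp [he, h]
  have L_sum : ∀ (s : Finset X) (g : X → ℝ), L (fun q => if q ∈ s then g q else 0) =
      ∑ q ∈ s, p q * g q := by
    intro s g
    induction s using Finset.induction_on with
    | empty => simpa using L_const 0
    | insert a s ha ih =>
      have h1 : (fun q => if q ∈ insert a s then g q else 0) =
          g a • e a + fun q => if q ∈ s then g q else 0 := by
        funext q
        by_cases h : q = a
        · subst h; simp [he, ha]
        · simp [he, h]
      rw [h1, L_add _ _ ⟨|g a| * 1, fun q => ?_⟩ ⟨∑ q ∈ s, |g q|, fun q => ?_⟩,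
        L_smul _ _ ⟨1, he01 a⟩, ih, Finset.sum_insert ha, mul_comm]
      · rw [Pi.smul_apply, smul_eq_mul, abs_mul]
        exact mul_le_mul_of_nonneg_left (he01 a q) (abs_nonneg _)
      · by_cases h : q ∈ s
        · simpa [h] using Finset.single_le_sum (f := fun q => |g q|)
            (fun q _ => abs_nonneg (g q)) h
        · simpa [h] using Finset.sum_nonneg fun q _ => abs_nonneg (g q)
  have sum_le : ∀ g : X → ℝ, 0 ≤ g → (∃ B, ∀ q, |g q| ≤ B) → ∀ s : Finset X,
      ∑ q ∈ s, p q * g q ≤ L g := by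
    intro g hg hB s
    rw [← L_sum]
    obtain ⟨B, hB⟩ := hB
    refine L_mono _ _ ⟨B, fun q => ?_⟩ ⟨B, hB⟩ fun q => ?_
    · by_cases h : q ∈ s
      · simpa [h] using hB q
      · simpa [h] using (abs_nonneg _).trans (hB q)
    · by_cases h : q ∈ s
      · simp [h]
      · simpa [h] using hg q
  have bdd_one : ∃ B, ∀ q : X, |(fun _ => (1 : ℝ)) q| ≤ B := ⟨1, by simp⟩
  have sum_le_one : ∀ s : Finset X, ∑ q ∈ s, p q ≤ 1 := fun s => by
    have := sum_le (fun _ => 1) (fun _ => zero_le_one) bdd_one s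
    simpa [L_const] using this
  have hps : Summable p := summable_of_sum_le hp0 sum_le_one
  -- Markov's inequality for `V`, truncated at `B` to stay within bounded functions. As sublevel
  -- sets are finite, no mass escapes to infinity, and the point masses sum to one.
  have hcut : ∀ B : ℝ, 0 < B → 1 - |K| / (c * B) ≤ ∑ q ∈ (hfin B).toFinset, p q := by
    intro B hB
    have h1 : L (fun q => c * min (V q) B - K) ≤ 0 := by
      refine L_drift V _ hV ⟨c * B + |K|, fun q => ?_⟩ fun q => ?_
      · refine (abs_sub _ _).trans (add_le_add ?_ le_rfl)
        rw [abs_of_nonneg (mul_nonneg hc.le (le_min (hV q) hB.le))]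
        exact mul_le_mul_of_nonneg_left (min_le_right _ _) hc.le
      · have := mul_le_mul_of_nonneg_left (min_le_left (V q) B) hc.le
        linarith [hdrift q]
    have bm : ∃ B', ∀ q, |c * B - (c * B) * (if q ∈ (hfin B).toFinset then 1 else 0) - K| ≤ B' := by
      refine ⟨c * B + |K|, fun q => ?_⟩
      refine (abs_sub _ _).trans (add_le_add ?_ le_rfl)
      by_cases h : q ∈ (hfin B).toFinset
      · simp only [h, if_true]
        rw [mul_one, sub_self, abs_zero]
        positivity
      · simp only [h, if_false]
        rw [mul_zero, sub_zero, abs_of_pos (by positivity)]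
    have h2 : L (fun q => c * B - (c * B) * (if q ∈ (hfin B).toFinset then 1 else 0) - K) ≤ 0 := by
      refine le_trans (L_mono _ _ bm ⟨c * B + |K|, fun q => ?_⟩ fun q => ?_) h1
      · refine (abs_sub _ _).trans (add_le_add ?_ le_rfl)
        rw [abs_of_nonneg (mul_nonneg hc.le (le_min (hV q) hB.le))]
        exact mul_le_mul_of_nonneg_left (min_le_right _ _) hc.le
      · have h3 : 0 ≤ min (V q) B := le_min (hV q) hB.le
        by_cases h : q ∈ (hfin B).toFinset
        · simp only [h, if_true]
          have := mul_nonneg hc.le h3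
          linarith
        · simp only [h, if_false]
          have h4 : ¬ V q ≤ B := by simpa using h
          rw [min_eq_right (not_le.1 h4).le]
          linarith
    have h3 : (fun q => c * B - (c * B) * (if q ∈ (hfin B).toFinset then (1 : ℝ) else 0) - K) =
        (fun _ => c * B - K) + (-(c * B)) • fun q => if q ∈ (hfin B).toFinset then (1 : ℝ) else 0 := by
      funext q
      simp only [Pi.add_apply, Pi.smul_apply, smul_eq_mul]
      ring
    have b1 : ∃ B', ∀ q, |(if q ∈ (hfin B).toFinset then (1 : ℝ) else 0)| ≤ B' :=
      ⟨1, fun q => by by_cases h : q ∈ (hfin B).toFinset <;> simp only [h, if_true, if_false] <;> simp⟩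
    have b2 : ∃ B', ∀ q, |((-(c * B)) • fun q => if q ∈ (hfin B).toFinset then (1 : ℝ) else 0) q|
        ≤ B' := by
      obtain ⟨B', h⟩ := b1
      refine ⟨|-(c * B)| * B', fun q => ?_⟩
      rw [Pi.smul_apply, smul_eq_mul, abs_mul]
      exact mul_le_mul_of_nonneg_left (h q) (abs_nonneg _)
    rw [h3, L_add _ _ ⟨|c * B - K|, fun _ => le_rfl⟩ b2, L_const, L_smul _ _ b1,
      L_sum _ fun _ => 1] at h2
    simp only [mul_one] at h2
    have hcB : 0 < c * B := mul_pos hc hB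
    rw [sub_le_iff_le_add, ← sub_le_iff_le_add', le_div_iff₀ hcB]
    have := le_abs_self K
    nlinarith
  have hp1 : ∑' q, p q = 1 := by
    refine le_antisymm (hps.tsum_le_of_sum_le sum_le_one) ?_
    have h1 : Tendsto (fun B : ℕ => 1 - |K| / (c * ((B : ℝ) + 1))) atTop (𝓝 (1 - |K| / c * 0)) := by
      refine tendsto_const_nhds.sub ?_
      refine ((tendsto_one_div_add_atTop_nhds_zero_nat (𝕜 := ℝ)).const_mul (|K| / c)).congr
        fun B => ?_
      rw [div_mul_div_comm, mul_one]
    rw [mul_zero, sub_zero] at h1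
    refine le_of_tendsto' h1 fun B => (hcut _ (by positivity)).trans ?_
    exact hps.sum_le_tsum _ fun q _ => hp0 q
  have hpg : ∀ g : X → ℝ, (∃ B, ∀ q, |g q| ≤ B) → Summable fun q => p q * g q := by
    rintro g ⟨B, hB⟩
    refine Summable.of_norm_bounded (hps.mul_right B) fun q => ?_
    rw [Real.norm_eq_abs, abs_mul, abs_of_nonneg (hp0 q)]
    exact mul_le_mul_of_nonneg_left (hB q) (hp0 q)
  -- Finite sums are dominated by `L` for nonnegative functions; adding the constant `B` to `g`
  -- reduces to that case because the total mass is one.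
  have key : ∀ g : X → ℝ, (∃ B, ∀ q, |g q| ≤ B) → ∑' q, p q * g q ≤ L g := by
    rintro g ⟨B, hB⟩
    have b1 : ∃ B', ∀ q, |(g + fun _ : X => B) q| ≤ B' := ⟨B + |B|, fun q =>
      (abs_add_le _ _).trans (add_le_add (hB q) le_rfl)⟩
    have h0 : (0 : X → ℝ) ≤ g + fun _ : X => B := fun q => by
      have h := (abs_le.1 (hB q)).1
      change 0 ≤ g q + B
      linarith
    have h1 : ∑' q, p q * (g + fun _ : X => B) q ≤ L (g + fun _ => B) :=
      (hpg _ b1).tsum_le_of_sum_le (sum_le _ h0 b1)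
    rw [L_add _ _ ⟨B, hB⟩ ⟨|B|, fun _ => le_rfl⟩, L_const] at h1
    have h2 : ∑' q, p q * (g + fun _ : X => B) q = ∑' q, p q * g q + B := by
      simp only [Pi.add_apply, mul_add]
      rw [Summable.tsum_add (hpg g ⟨B, hB⟩) (hps.mul_right B), tsum_mul_right, hp1, one_mul]
    linarith
  refine ⟨⟨fun q => ENNReal.ofReal (p q), ?_⟩, fun f g hf hg hfg => ?_⟩
  · rw [ENNReal.summable.hasSum_iff, ← ENNReal.ofReal_tsum_of_nonneg hp0 hps, hp1,
      ENNReal.ofReal_one]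
  · refine le_trans (le_of_eq ?_) ((key g hg).trans (L_drift f g hf hg hfg))
    refine tsum_congr fun q => ?_
    congr 1
    exact ENNReal.toReal_ofReal (hp0 q)

end SAJSQ

/-! ### The exponential Lyapunov function and existence of an invariant law. -/

namespace SAJSQ

variable {m : ℕ} {N : Fin (m + 1) → ℕ}

namespace State

/-- The state without jobs. -/
def empty (N : Fin (m + 1) → ℕ) : State N where
  occ j i := if i = 0 then N j else 0
  occ_zero := by simp
  anti := by
    intro j
    refine antitone_nat_of_succ_le fun i => ?_
    simp
  finite := ⟨1, fun j i hi => by simp; omega⟩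

instance : Nonempty (State N) := ⟨empty N⟩

theorem finite_setOf_occ_eq_zero (L : ℕ) :
    {q : State N | ∀ k i, L ≤ i → q.occ k i = 0}.Finite := by
  refine Set.Finite.of_injOn (f := fun q k (i : Fin L) => q.occ k i)
    (t := Set.Iic fun k _ => N k) ?_ ?_ (Set.finite_Iic _)
  · intro q _ k i
    exact q.occ_le k i
  · intro q hq q' hq' h
    ext k i
    by_cases hi : i < L
    · exact congrFun (congrFun h k) ⟨i, hi⟩
    · rw [hq k i (not_lt.1 hi), hq' k i (not_lt.1 hi)]

/-- The exponentially weighted number of jobs in pool `k`. -/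
noncomputable def expWeight (r : ℝ) (q : State N) (k : Fin (m + 1)) : ℝ :=
  ∑' i, r ^ i * (q.occ k (i + 1) : ℝ)

variable {r : ℝ}

theorem le_expWeight (hr : 0 ≤ r) (q : State N) (k : Fin (m + 1)) (i : ℕ) :
    r ^ i * (q.occ k (i + 1) : ℝ) ≤ q.expWeight r k :=
  (q.summable_mul_occ k 1 _).le_tsum i fun j _ => by positivity

theorem expWeight_nonneg (hr : 0 ≤ r) (q : State N) (k : Fin (m + 1)) : 0 ≤ q.expWeight r k :=
  tsum_nonneg fun i => by positivity

theorem expWeight_eq_of_occ_eq {q q' : State N} {k : Fin (m + 1)} {i : ℕ}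
    (h : ∀ j l, q'.occ j l = q.occ j l + if j = k ∧ l = i + 1 then 1 else 0) (j : Fin (m + 1)) :
    q'.expWeight r j = q.expWeight r j + if j = k then r ^ i else 0 := by
  unfold expWeight
  simp_rw [h]
  push_cast
  simp_rw [mul_add]
  have hs : ∀ l, l ≠ i → r ^ l * (if j = k ∧ l = i then (1 : ℝ) else 0) = 0 := by
    intro l hl
    simp [hl]
  rw [Summable.tsum_add (q.summable_mul_occ j 1 _) (summable_of_ne_finset_zero (s := {i})
    fun l hl => hs l (by simpa using hl)), tsum_eq_single i hs]
  by_cases hj : j = k <;> simp [hj]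

theorem expWeight_add (q : State N) {k : Fin (m + 1)} {i : ℕ} (h : q.occ k (i + 1) < q.occ k i) :
    ∑ j, (q.add k i).expWeight r j = ∑ j, q.expWeight r j + r ^ i := by
  simp_rw [expWeight_eq_of_occ_eq (q.occ_add h), Finset.sum_add_distrib]
  simp

theorem expWeight_remove (q : State N) {k : Fin (m + 1)} {i : ℕ}
    (h : q.occ k (i + 2) < q.occ k (i + 1)) :
    ∑ j, (q.remove k i).expWeight r j = ∑ j, q.expWeight r j - r ^ i := by
  simp_rw [expWeight_eq_of_occ_eq (fun j l => (q.occ_remove h j l).symm), Finset.sum_add_distrib]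
  simp

/-- Summation by parts: shifting the level by one costs a factor `r`, and the boundary term has the
favourable sign. -/
theorem tsum_dep_pow_ge (hr : 1 < r) (q : State N) (k : Fin (m + 1)) :
    (1 - r⁻¹) * q.expWeight r k ≤ ∑' i, q.dep k i * r ^ i := by
  have hr0 : r ≠ 0 := by positivity
  have h1 : ∑' i, q.dep k i * r ^ i =
      q.expWeight r k - ∑' i, r ^ i * (q.occ k (i + 2) : ℝ) := by
    rw [expWeight, ← Summable.tsum_sub (q.summable_mul_occ k 1 _) (q.summable_mul_occ k 2 _)]
    exact tsum_congr fun i => by rw [dep]; ring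
  have h2 : q.expWeight r k = q.occ k 1 + r * ∑' i, r ^ i * (q.occ k (i + 2) : ℝ) := by
    rw [expWeight, (q.summable_mul_occ k 1 _).tsum_eq_zero_add, ← tsum_mul_left]
    simp only [pow_zero, one_mul, zero_add]
    congr 1
    exact tsum_congr fun i => by rw [pow_succ', mul_assoc]
  have h3 : r⁻¹ * q.expWeight r k =
      r⁻¹ * q.occ k 1 + ∑' i, r ^ i * (q.occ k (i + 2) : ℝ) := by
    rw [h2, mul_add, inv_mul_cancel_left₀ hr0]
  have h4 : 0 ≤ r⁻¹ * (q.occ k 1 : ℝ) := by positivity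
  rw [h1, sub_mul, one_mul, h3]
  linarith

/-- Under JSQ an arrival joins a queue of length `i` only if every server has at least `i` jobs, so
the weight of pool `j` contains a full geometric sum. -/
theorem IsTarget.pow_le_expWeight (hr : 1 < r) {q : State N} {k : Fin (m + 1)} {i : ℕ}
    (h : q.IsTarget k (i + 1)) (j : Fin (m + 1)) :
    (N j : ℝ) * (r ^ i - 1) ≤ (r - 1) * q.expWeight r j := by
  have h1 : ∑ l ∈ Finset.range i, r ^ l * (N j : ℝ) ≤ q.expWeight r j := by
    refine le_trans (le_of_eq (Finset.sum_congr rfl fun l hl => ?_))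
      ((q.summable_mul_occ j 1 _).sum_le_tsum (Finset.range i) fun _ _ => by positivity)
    rw [h.occ_eq j (by simpa using hl)]
  rw [← Finset.sum_mul] at h1
  have h2 := geom_sum_mul r i
  have h3 := mul_le_mul_of_nonneg_left h1 (sub_nonneg.2 hr.le)
  calc (N j : ℝ) * (r ^ i - 1) = (r - 1) * ((∑ l ∈ Finset.range i, r ^ l) * N j) := by
        rw [← h2]; ring
    _ ≤ _ := h3

end State

section Lyapunov

variable {Λ r c₀ : ℝ} {μ : Fin (m + 1) → ℝ}

/-- With `W` the weight with service rates included, an arrival adds `r ^ i₀ ≤ 1 + (r - 1) W / C`,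
while departures remove at rate at least `(1 - r⁻¹) W`. The balance is favourable when `Λ r ≤ C`. -/
theorem gen_expWeight_le (hΛ : 0 ≤ Λ) (hc₀ : 0 < c₀) (hμ : ∀ k, c₀ ≤ μ k) (hN : ∀ k, 0 < N k)
    (hr : 1 < r) (hrΛ : Λ * r ≤ ∑ k, μ k * N k) (q : State N) :
    gen Λ μ (fun q => ∑ k, q.expWeight r k) q ≤
      -((r - 1) * (r⁻¹ - Λ / ∑ k, μ k * N k) * c₀ * ∑ k, q.expWeight r k - Λ) := by
  have hμ0 : ∀ k, 0 ≤ μ k := fun k => hc₀.le.trans (hμ k)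
  have hcap : 0 < ∑ k, μ k * (N k : ℝ) := Finset.sum_pos
    (fun k _ => mul_pos (hc₀.trans_le (hμ k)) (Nat.cast_pos.2 (hN k))) Finset.univ_nonempty
  set C := ∑ k, μ k * (N k : ℝ) with hC
  obtain ⟨k₀, i₀, h₀⟩ := q.exists_isTarget (hN 0)
  set W := ∑ k, μ k * q.expWeight r k with hW
  have h1 := gen_le hΛ hμ0 (fun q : State N => ∑ k, q.expWeight r k) h₀ (a := r ^ i₀)
    (by simp only [q.expWeight_add h₀.occ_lt]; linarith) (fun _ i => -r ^ i)
    (fun k i h => by simp only [q.expWeight_remove h]; linarith)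
  refine h1.trans ?_
  have h2 : ∑ k, μ k * ∑' i, q.dep k i * -r ^ i ≤ -((1 - r⁻¹) * W) := by
    rw [hW, Finset.mul_sum, ← Finset.sum_neg_distrib]
    refine Finset.sum_le_sum fun k _ => ?_
    simp_rw [mul_neg]
    rw [tsum_neg, mul_neg, neg_le_neg_iff, mul_left_comm]
    exact mul_le_mul_of_nonneg_left (q.tsum_dep_pow_ge hr k) (hμ0 k)
  have h3 : C * (r ^ i₀ - 1) ≤ (r - 1) * W := by
    rw [hC, hW, Finset.sum_mul, Finset.mul_sum]
    refine Finset.sum_le_sum fun k _ => ?_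
    rw [mul_assoc, mul_left_comm (r - 1)]
    exact mul_le_mul_of_nonneg_left (h₀.pow_le_expWeight hr k) (hμ0 k)
  have h4 : Λ * r ^ i₀ ≤ Λ + Λ / C * ((r - 1) * W) := by
    have h5 := mul_le_mul_of_nonneg_left h3 (div_nonneg hΛ hcap.le)
    have h6 : Λ / C * (C * (r ^ i₀ - 1)) = Λ * (r ^ i₀ - 1) := by field_simp
    rw [h6] at h5
    linarith
  have h5 : c₀ * ∑ k, q.expWeight r k ≤ W := by
    rw [hW, Finset.mul_sum]
    exact Finset.sum_le_sum fun k _ => mul_le_mul_of_nonneg_right (hμ k)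
      (q.expWeight_nonneg (by linarith) k)
  have h6 : 0 ≤ (r - 1) * (r⁻¹ - Λ / C) := by
    refine mul_nonneg (by linarith) (sub_nonneg.2 ?_)
    rw [inv_eq_one_div, div_le_div_iff₀ hcap (by linarith)]
    linarith
  have h7 := mul_le_mul_of_nonneg_left h5 h6
  have h8 : (1 - r⁻¹) * W = (r - 1) * r⁻¹ * W := by
    have : r ≠ 0 := by positivity
    field_simp
  have h9 : (r - 1) * (r⁻¹ - Λ / C) * W = (r - 1) * r⁻¹ * W - Λ / C * ((r - 1) * W) := by ring
  have h10 : (r - 1) * (r⁻¹ - Λ / C) * c₀ * ∑ k, q.expWeight r k =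
    (r - 1) * (r⁻¹ - Λ / C) * (c₀ * ∑ k, q.expWeight r k) := by ring
  linarith

theorem finite_expWeight_le (hr : 1 < r) (B : ℝ) :
    {q : State N | ∑ k, q.expWeight r k ≤ B}.Finite := by
  obtain ⟨L, hL⟩ := pow_unbounded_of_one_lt B hr
  refine (State.finite_setOf_occ_eq_zero (N := N) (L + 1)).subset fun q hq k i hi => ?_
  obtain ⟨i, rfl⟩ : ∃ i', i = i' + 1 := ⟨i - 1, by omega⟩
  by_contra h
  have h1 : (1 : ℝ) ≤ q.occ k (i + 1) := by exact_mod_cast Nat.one_le_iff_ne_zero.2 h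
  have h2 := q.le_expWeight (r := r) (by linarith) k i
  have h3 : q.expWeight r k ≤ ∑ k, q.expWeight r k :=
    Finset.single_le_sum (f := fun k => q.expWeight r k)
      (fun k _ => q.expWeight_nonneg (by linarith) k) (Finset.mem_univ k)
  have h4 : r ^ L ≤ r ^ i := pow_le_pow_right₀ hr.le (by omega)
  have h5 : r ^ i * 1 ≤ r ^ i * (q.occ k (i + 1) : ℝ) :=
    mul_le_mul_of_nonneg_left h1 (by positivity)
  have h6 : ∑ k, q.expWeight r k ≤ B := hq
  linarith

end Lyapunov

/-- The law `π` satisfies all one-sided drift inequalities: if `f ≥ 0` has drift at most `-g` with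
`g` bounded, then `g` has non-positive mean. -/
def DriftBound (Λ : ℝ) (μ : Fin (m + 1) → ℝ) (π : PMF (State N)) : Prop :=
  ∀ f g : State N → ℝ, (∀ q, 0 ≤ f q) → (∃ B, ∀ q, |g q| ≤ B) → (∀ q, gen Λ μ f q ≤ -g q) →
    ∫ q, g q ∂π.toMeasure ≤ 0

theorem integrable_of_bdd (π : PMF (State N)) {g : State N → ℝ} (hg : ∃ B, ∀ q, |g q| ≤ B) :
    Integrable g π.toMeasure := by
  obtain ⟨B, hB⟩ := hg
  refine Integrable.of_bound (C := B) (Measurable.of_discrete).aestronglyMeasurable ?_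
  exact ae_of_all _ hB

theorem exists_driftBound {Λ : ℝ} {μ : Fin (m + 1) → ℝ} (hΛ : 0 < Λ) (hμ : ∀ k, 0 < μ k)
    (hN : ∀ k, 0 < N k) (hlt : Λ < ∑ k, μ k * N k) : ∃ π : PMF (State N), DriftBound Λ μ π := by
  set C := ∑ k, μ k * (N k : ℝ) with hC
  have hcap : 0 < C := hΛ.trans hlt
  obtain ⟨k₁, -, hk₁⟩ := Finset.exists_min_image Finset.univ μ Finset.univ_nonempty
  -- Any `r` strictly between `1` and `C / Λ` makes the drift coefficient positive.
  obtain ⟨r, hr1, hr2⟩ := exists_between ((one_lt_div hΛ).2 hlt)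
  have hrΛ : Λ * r < C := by rwa [lt_div_iff₀ hΛ, mul_comm] at hr2
  have hr0 : 0 < r := by linarith
  set c := (r - 1) * (r⁻¹ - Λ / C) * μ k₁ with hc
  have hc0 : 0 < c := by
    refine mul_pos (mul_pos (by linarith) (sub_pos.2 ?_)) (hμ k₁)
    rw [inv_eq_one_div, div_lt_div_iff₀ hcap hr0]
    linarith
  have hΓ : 0 < Λ + C := by linarith
  -- Uniformization: `Λ + C` dominates every total jump rate, so `U` is a positive operator.
  let U : (State N → ℝ) →ₗ[ℝ] (State N → ℝ) :=
    { toFun := fun f => f + (Λ + C)⁻¹ • gen Λ μ f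
      map_add' := fun f g => by rw [gen_add, smul_add]; abel
      map_smul' := fun a f => by
        rw [gen_smul, RingHom.id_apply, smul_add, smul_comm] }
  have hU : ∀ f q, U f q = f q + (Λ + C)⁻¹ * gen Λ μ f q := fun f q => rfl
  have hpos : ∀ f, 0 ≤ f → 0 ≤ U f := by
    intro f hf q
    change 0 ≤ U f q
    rw [hU]
    have h1 := mul_le_mul_of_nonneg_left (neg_le_gen hΛ.le (fun k => (hμ k).le) (hN 0) hf q)
      (inv_pos.2 hΓ).le
    rw [mul_neg, inv_mul_cancel_left₀ hΓ.ne'] at h1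
    linarith
  have hone : U 1 = 1 := by
    funext q
    have : gen Λ μ (1 : State N → ℝ) = 0 := gen_const Λ μ 1
    rw [hU, this]
    simp
  have hdrift : ∀ q, U (fun q => ∑ k, q.expWeight r k) q ≤ (∑ k, q.expWeight r k) -
      ((Λ + C)⁻¹ * c * (∑ k, q.expWeight r k) - (Λ + C)⁻¹ * Λ) := by
    intro q
    rw [hU]
    have h1 := mul_le_mul_of_nonneg_left (gen_expWeight_le hΛ.le (hμ k₁) (fun k => hk₁ k
      (Finset.mem_univ k)) hN hr1 hrΛ.le q) (inv_pos.2 hΓ).le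
    rw [← hC, ← hc] at h1
    linarith
  obtain ⟨π, hπ⟩ := exists_pmf_of_lyapunov U hpos hone (fun q => ∑ k, q.expWeight r k)
    (fun q => Finset.sum_nonneg fun k _ => q.expWeight_nonneg hr0.le k)
    (finite_expWeight_le hr1) ((Λ + C)⁻¹ * c) ((Λ + C)⁻¹ * Λ) (by positivity) hdrift
  refine ⟨π, fun f g hf hg hfg => ?_⟩
  have h1 := hπ f (fun q => (Λ + C)⁻¹ * g q) hf
    (by
      obtain ⟨B, hB⟩ := hg
      refine ⟨(Λ + C)⁻¹ * B, fun q => ?_⟩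
      rw [abs_mul, abs_of_pos (by positivity)]
      exact mul_le_mul_of_nonneg_left (hB q) (by positivity))
    (fun q => by
      rw [hU]
      have := mul_le_mul_of_nonneg_left (hfg q) (inv_pos.2 hΓ).le
      linarith)
  rw [PMF.integral_eq_tsum π g (integrable_of_bdd π hg)]
  simp_rw [mul_left_comm _ (Λ + C)⁻¹] at h1
  rw [tsum_mul_left] at h1
  have h2 : 0 < (Λ + C)⁻¹ := by positivity
  exact nonpos_of_mul_nonpos_right h1 h2

end SAJSQ

/-! ### Stationarity through the generator, and uniqueness. -/

namespace SAJSQ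

variable {m : ℕ} {N : Fin (m + 1) → ℕ} {Λ : ℝ} {μ : Fin (m + 1) → ℝ}

/-- Integration against `π` as a continuous linear functional. -/
noncomputable def meanCLM (π : PMF (State N)) : (State N →ᵇ ℝ) →L[ℝ] ℝ :=
  LinearMap.mkContinuous
    { toFun := fun f => ∫ q, f q ∂π.toMeasure
      map_add' := fun f g => integral_add (f.integrable _) (g.integrable _)
      map_smul' := fun c f => integral_const_mul c _ } 1 fun f => by
    simpa using f.norm_integral_le_norm (μ := π.toMeasure)

theorem meanCLM_apply (π : PMF (State N)) (f : State N →ᵇ ℝ) :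
    meanCLM π f = ∫ q, f q ∂π.toMeasure := rfl

theorem hasDerivAt_expOp {E : Type*} [NormedAddCommGroup E] [NormedSpace ℝ E] [CompleteSpace E]
    (A : E →L[ℝ] E) (ℓ : E →L[ℝ] ℝ) (f : E) (t : ℝ) :
    HasDerivAt (fun t : ℝ => ℓ (expOp (t • A) f)) (ℓ (A (expOp (t • A) f))) t := by
  have h1 : HasDerivAt (fun t : ℝ => expOp (t • A)) (A * expOp (t • A)) t :=
    hasDerivAt_exp_smul_const' (𝕂 := ℝ) A t
  have h2 : HasDerivAt (fun t : ℝ => expOp (t • A) f) ((A * expOp (t • A)) f) t :=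
    h1.clm_apply (hasDerivAt_const t f) |>.congr_deriv (by simp)
  exact (ℓ.hasFDerivAt.comp_hasDerivAt t h2)

theorem hasDerivAt_mean_semigroup (π : PMF (State N)) (f : State N →ᵇ ℝ) (t : ℝ) :
    HasDerivAt (fun t => meanCLM π (semigroup Λ μ N t f))
      (meanCLM π (generator Λ μ N (semigroup Λ μ N t f))) t :=
  hasDerivAt_expOp (generator Λ μ N) (meanCLM π) f t

theorem semigroup_zero : semigroup Λ μ N 0 = 1 := by
  unfold semigroup expOp
  rw [zero_smul, NormedSpace.exp_zero]

/-- Differentiate the mean of `P_t f` at `0` from the right. Conversely, its derivative at time `t`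
is the mean of the generator applied to `P_t f`, which vanishes. -/
theorem isStationary_iff (π : PMF (State N)) :
    IsStationary Λ μ π ↔ ∀ f : State N →ᵇ ℝ, meanCLM π (generator Λ μ N f) = 0 := by
  constructor
  · intro h f
    have h1 := (hasDerivAt_mean_semigroup (Λ := Λ) (μ := μ) π f 0).hasDerivWithinAt
      (s := Set.Ici 0)
    rw [semigroup_zero] at h1
    have h2 : HasDerivWithinAt (fun t => meanCLM π (semigroup Λ μ N t f)) 0 (Set.Ici 0) 0 :=
      (hasDerivWithinAt_const (0 : ℝ) (Set.Ici 0) (meanCLM π f)).congr (fun t ht => h t ht f)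
        (h 0 le_rfl f)
    exact (uniqueDiffOn_Ici (0 : ℝ) 0 Set.self_mem_Ici).eq_deriv _ h1 h2
  · intro h t _ f
    have h1 : ∀ s, HasDerivAt (fun t => meanCLM π (semigroup Λ μ N t f)) 0 s := fun s => by
      have := hasDerivAt_mean_semigroup (Λ := Λ) (μ := μ) π f s
      rwa [h] at this
    have h2 := is_const_of_deriv_eq_zero (fun s => (h1 s).differentiableAt)
      (fun s => (h1 s).deriv) t 0
    rw [semigroup_zero] at h2
    exact h2

/-- For bounded `f`, shift by `‖f‖` to make it nonnegative, then use `f` and `-f`. -/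
theorem DriftBound.isStationary {π : PMF (State N)} (h : DriftBound Λ μ π) :
    IsStationary Λ μ π := by
  rw [isStationary_iff]
  have key : ∀ f : State N →ᵇ ℝ, -meanCLM π (generator Λ μ N f) ≤ 0 := by
    intro f
    have hb : ∀ q, |f q| ≤ ‖f‖ := fun q => f.norm_coe_le_norm q
    have h1 := h (⇑f + fun _ => ‖f‖) (fun q => -gen Λ μ f q)
      (fun q => by have := (abs_le.1 (hb q)).1; simp only [Pi.add_apply]; linarith)
      ⟨_, fun q => by rw [abs_neg]; exact abs_gen_le Λ μ f _ hb q⟩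
      (fun q => by rw [gen_add, gen_const, add_zero, neg_neg])
    rwa [integral_neg] at h1
  intro f
  refine le_antisymm ?_ (by linarith [key f])
  have := key (-f)
  rw [map_neg, map_neg, neg_neg] at this
  exact this

/-- On `A` the indicator is maximal, so no transition raises it, and the given departure lowers it
at positive rate. -/
theorem gen_indicator_neg {A : Set (State N)} [DecidablePred (· ∈ A)] (hΛ : 0 ≤ Λ)
    (hμ : ∀ k, 0 < μ k)
    (hN : ∀ k, 0 < N k) {q : State N} (hq : q ∈ A) {k : Fin (m + 1)} {i : ℕ}
    (h : q.occ k (i + 2) < q.occ k (i + 1)) (hA : q.remove k i ∉ A) :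
    gen Λ μ (fun q => if q ∈ A then 1 else 0) q < 0 := by
  classical
  obtain ⟨k₀, i₀, h₀⟩ := q.exists_isTarget (hN 0)
  refine (gen_le hΛ (fun k => (hμ k).le) (fun q => if q ∈ A then 1 else 0) h₀ (a := 0) ?_
    (fun k' i' => if k' = k ∧ i' = i then -1 else 0) fun k' i' _ => ?_).trans_lt ?_
  · rw [if_pos hq]
    split_ifs <;> norm_num
  · rw [if_pos hq]
    by_cases h' : k' = k ∧ i' = i
    · obtain ⟨rfl, rfl⟩ := h'
      simp [hA]
    · rw [if_neg h']
      split_ifs <;> norm_num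
  · rw [mul_zero, zero_add, Finset.sum_eq_single k (fun k' _ hk => by simp [hk]) (by simp),
      tsum_eq_single i (fun i' hi => by simp [hi])]
    have h1 := (q.dep_pos_iff k i).2 h
    simp only [and_self, if_true]
    nlinarith [mul_pos (hμ k) h1]

/-- An element of `A` with the fewest jobs admits no departure, hence has no jobs. -/
theorem empty_mem_of_closed {A : Set (State N)} (hA : A.Nonempty)
    (h : ∀ q ∈ A, ∀ k i, q.occ k (i + 2) < q.occ k (i + 1) → q.remove k i ∈ A) :
    State.empty N ∈ A := by
  obtain ⟨q, hq, hmin⟩ := WellFounded.has_min (measure fun q : State N => ∑ k, q.tail k 1).wf A hA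
  have h1 : ∀ k i, q.occ k (i + 1) ≤ q.occ k (i + 2) := by
    intro k i
    by_contra hlt
    have hlt := not_le.1 hlt
    refine hmin _ (h q hq k i hlt) ?_
    change ∑ j, (q.remove k i).tail j 1 < ∑ j, q.tail j 1
    refine Finset.sum_lt_sum (fun j _ => ?_) ⟨k, Finset.mem_univ k, ?_⟩
    · rw [← q.tail_remove hlt j 1]; omega
    · rw [← q.tail_remove hlt k 1]; simp
  have h2 : ∀ k i, q.occ k 1 ≤ q.occ k (i + 1) := by
    intro k i
    induction i with
    | zero => exact le_rfl
    | succ i ih => exact ih.trans (h1 k i)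
  obtain ⟨L, hL⟩ := q.finite
  have h3 : q = State.empty N := by
    ext k i
    rcases Nat.eq_zero_or_pos i with rfl | hi
    · rw [q.occ_zero]; rfl
    · have h4 := h2 k L
      rw [hL k (L + 1) (by omega)] at h4
      have h5 := q.anti k hi
      have h6 : (State.empty N).occ k i = 0 := if_neg (by omega)
      rw [h6]
      simp only [Nat.succ_eq_add_one, zero_add] at h5
      omega
  exact h3 ▸ hq

/-- Apply both balance equations to the indicator of `A = {π' < π}`. Its generator is nonpositive on
`A` and nonnegative off `A`, so the difference is a sum of nonnegative terms equal to zero. Each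
term vanishes, so no departure leaves `A`, and `A` contains the empty state. -/
theorem empty_lt_of_ne (hΛ : 0 ≤ Λ) (hμ : ∀ k, 0 < μ k) (hN : ∀ k, 0 < N k)
    {π π' : PMF (State N)} (h : IsStationary Λ μ π) (h' : IsStationary Λ μ π')
    (hne : ∃ q, π' q < π q) : π' (State.empty N) < π (State.empty N) := by
  classical
  set A : Set (State N) := {q | π' q < π q} with hA
  set f : State N → ℝ := fun q => if q ∈ A then 1 else 0 with hf
  have hfb : ∀ q, |f q| ≤ 1 := fun q => by
    by_cases hq : q ∈ A <;> simp [hf, hq]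
  have hf0 : ∀ q, 0 ≤ f q := fun q => by
    by_cases hq : q ∈ A <;> simp [hf, hq]
  have hf1 : ∀ q, 0 ≤ ((fun _ : State N => (1 : ℝ)) + (-1 : ℝ) • f) q := fun q => by
    by_cases hq : q ∈ A <;> simp [hf, hq]
  let F : State N →ᵇ ℝ := BoundedContinuousFunction.ofNormedAddCommGroupDiscrete f 1 hfb
  have hgb : ∃ B, ∀ q, |gen Λ μ f q| ≤ B := ⟨_, fun q => abs_gen_le Λ μ f 1 hfb q⟩
  have e : ∀ p : PMF (State N), IsStationary Λ μ p →
      HasSum (fun q => (p q).toReal * gen Λ μ f q) 0 := by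
    intro p hp
    have h1 := (isStationary_iff p).1 hp F
    rw [meanCLM_apply] at h1
    have h2 : ∀ q, generator Λ μ N F q = gen Λ μ f q := fun q => generator_apply Λ μ F q
    simp_rw [h2] at h1
    rw [PMF.integral_eq_tsum p _ (integrable_of_bdd p hgb)] at h1
    simp only [smul_eq_mul] at h1
    rw [← h1]
    refine Summable.hasSum ?_
    obtain ⟨B, hB⟩ := hgb
    refine Summable.of_norm_bounded ((ENNReal.summable_toReal p.tsum_coe_ne_top).mul_right B)
      fun q => ?_
    rw [Real.norm_eq_abs, abs_mul, abs_of_nonneg ENNReal.toReal_nonneg]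
    exact mul_le_mul_of_nonneg_left (hB q) ENNReal.toReal_nonneg
  have hs := (e π' h').sub (e π h)
  rw [sub_zero] at hs
  have hAn : ∀ q ∈ A, gen Λ μ f q ≤ 0 := by
    intro q hq
    have h1 := neg_le_gen hΛ (fun k => (hμ k).le) (hN 0) hf1 q
    rw [gen_add, gen_const, gen_smul] at h1
    simp only [Pi.add_apply, Pi.smul_apply, Pi.zero_apply, smul_eq_mul, hf, if_pos hq] at h1
    simp only [hf]
    linarith
  have hAp : ∀ q ∉ A, 0 ≤ gen Λ μ f q := by
    intro q hq
    have h1 := neg_le_gen hΛ (fun k => (hμ k).le) (hN 0) hf0 q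
    have h2 : f q = 0 := if_neg hq
    rw [h2, mul_zero, neg_zero] at h1
    exact h1
  have hterm := (hasSum_zero_iff_of_nonneg (f := fun q => (π' q).toReal * gen Λ μ f q -
      (π q).toReal * gen Λ μ f q) (fun q => by
    change 0 ≤ (π' q).toReal * gen Λ μ f q - (π q).toReal * gen Λ μ f q
    rw [← sub_mul]
    by_cases hq : q ∈ A
    · refine mul_nonneg_of_nonpos_of_nonpos ?_ (hAn q hq)
      exact sub_nonpos.2 (ENNReal.toReal_mono (π.apply_ne_top q) (le_of_lt hq))
    · refine mul_nonneg ?_ (hAp q hq)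
      exact sub_nonneg.2 (ENNReal.toReal_mono (π'.apply_ne_top q) (not_lt.1 hq)))).1 hs
  refine empty_mem_of_closed (A := A) hne fun q hq k i hlt => ?_
  by_contra hr
  have h1 := gen_indicator_neg hΛ hμ hN hq hlt hr
  have h2 := congrFun hterm q
  simp only [Pi.zero_apply] at h2
  rw [← sub_mul] at h2
  have h3 : (π' q).toReal < (π q).toReal := ENNReal.toReal_strict_mono (π.apply_ne_top q) hq
  rcases mul_eq_zero.1 h2 with h4 | h4
  · linarith
  · exact h1.ne h4

/-- If each law exceeded the other somewhere, each would be strictly larger at the empty state. So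
one dominates the other, and equal total mass forces equality. -/
theorem IsStationary.unique (hΛ : 0 ≤ Λ) (hμ : ∀ k, 0 < μ k) (hN : ∀ k, 0 < N k)
    {π π' : PMF (State N)} (h : IsStationary Λ μ π) (h' : IsStationary Λ μ π') : π' = π := by
  have key : ∀ {p p' : PMF (State N)}, (∀ q, p' q ≤ p q) → p' = p := by
    intro p p' hle
    ext q
    refine le_antisymm (hle q) (not_lt.1 fun hlt => ?_)
    have := ENNReal.tsum_lt_tsum (by rw [p'.tsum_coe]; exact ENNReal.one_ne_top) hle hlt
    rw [p.tsum_coe, p'.tsum_coe] at this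
    exact lt_irrefl _ this
  by_cases h1 : ∃ q, π' q < π q
  · by_cases h2 : ∃ q, π q < π' q
    · exact absurd (empty_lt_of_ne hΛ hμ hN h h' h1)
        (empty_lt_of_ne hΛ hμ hN h' h h2).le.not_gt
    · push Not at h2
      exact key h2
  · push Not at h1
    exact (key h1).symm

end SAJSQ

/-! ### Combinatorics of waiting jobs, flow balance and idle servers. -/

namespace SAJSQ

variable {m : ℕ} {N : Fin (m + 1) → ℕ}

namespace State

/-- Number of servers with at least two jobs. -/
def busy₂ (q : State N) : ℕ := ∑ k, q.occ k 2

theorem tail_eq_zero {q : State N} {k : Fin (m + 1)} {r : ℕ} (h : q.occ k r = 0) :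
    q.tail k r = 0 := by
  have h1 : ∀ i, q.occ k (i + r) = 0 := fun i =>
    Nat.le_zero.1 ((q.anti k (Nat.le_add_left r i)).trans h.le)
  unfold tail
  simp [h1]

theorem tail_le_mul_add (q : State N) (k : Fin (m + 1)) (r u : ℕ) :
    q.tail k r ≤ u * q.occ k r + q.tail k (r + u) := by
  induction u with
  | zero => simp
  | succ u ih =>
    have h1 := q.tail_eq k (r + u)
    have h2 : q.occ k (r + u) ≤ q.occ k r := q.anti k (Nat.le_add_right r u)
    rw [add_mul, one_mul, ← add_assoc r u 1]
    omega

/-- With all queues of length at most `u + 1`, each server with two or more jobs holds at most `u`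
waiting jobs. -/
theorem excess_le_mul {q : State N} {u : ℕ} (h : ∀ k, q.occ k (u + 2) = 0) :
    q.excess ≤ q.busy₂ * u := by
  unfold excess busy₂
  rw [Finset.sum_mul]
  refine Finset.sum_le_sum fun k _ => ?_
  have h1 := q.tail_le_mul_add k 2 u
  rw [add_comm 2 u, tail_eq_zero (h k), add_zero] at h1
  rwa [mul_comm]

theorem busy₂_le (q : State N) : q.busy₂ ≤ ∑ k, N k :=
  Finset.sum_le_sum fun k _ => q.occ_le k 2

theorem mul_le_tail {q : State N} {k : Fin (m + 1)} {r a : ℕ} (u : ℕ)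
    (h : ∀ l, l < r + u → a ≤ q.occ k l) : u * a ≤ q.tail k r := by
  induction u generalizing r with
  | zero => simp
  | succ u ih =>
    have h1 := ih (r := r + 1) fun l hl => h l (by omega)
    have h2 := h r (by omega)
    rw [q.tail_eq k r, add_mul, one_mul]
    omega

theorem IsTarget.mul_le_excess {q : State N} {k : Fin (m + 1)} {i u : ℕ}
    (h : q.IsTarget k (i + 1)) (hu : u + 1 ≤ i) : u * ∑ k, N k ≤ q.excess := by
  unfold excess
  rw [Finset.mul_sum]
  refine Finset.sum_le_sum fun j _ => mul_le_tail u fun l hl => ?_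
  exact (h.occ_eq j (by omega)).ge

/-- A slower pool receives a second job, or any pool a third, only when every fastest server already
has two jobs; each of these contributes a waiting job. -/
theorem IsTarget.fastest_le_excess {q : State N} {k : Fin (m + 1)} {i : ℕ}
    (h : q.IsTarget k (i + 1)) (hi : (1 ≤ i ∧ 0 < k) ∨ 2 ≤ i) : N 0 ≤ q.excess := by
  have h1 : N 0 ≤ q.occ 0 2 := by
    rcases hi with ⟨hi, hk⟩ | hi
    · have h2 := h.2 0 (i + 1) (by omega) (Or.inr ⟨rfl, hk⟩)
      rw [← h2]
      exact q.anti 0 (by omega)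
    · exact (h.occ_eq 0 (by omega)).ge
  refine h1.trans ((q.occ_le_tail 0 2).trans ?_)
  exact Finset.single_le_sum (f := fun k => q.tail k 2) (fun _ _ => Nat.zero_le _)
    (Finset.mem_univ 0)

/-- The place where the speed-aware tie-breaking matters: for `s` closed under passing to faster
pools, an idle server in `s` forces the arrival to an idle server in `s`. -/
theorem IsTarget.of_idle_pos {q : State N} {k : Fin (m + 1)} {i : ℕ}
    (h : q.IsTarget k (i + 1)) {s : Finset (Fin (m + 1))} (hs : ∀ a ∈ s, ∀ b, b ≤ a → b ∈ s)
    (hq : 0 < q.idle s) : k ∈ s ∧ i = 0 := by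
  obtain ⟨l, hl, h0⟩ : ∃ l ∈ s, 0 < N l - q.occ l 1 := by
    by_contra hc
    push Not at hc
    exact hq.ne' (Finset.sum_eq_zero fun l hl => Nat.le_zero.1 (hc l hl))
  have hi : i = 0 := by
    by_contra hi
    have := h.occ_eq l (l := 1) (by omega)
    omega
  subst hi
  refine ⟨?_, rfl⟩
  by_contra hk
  have hlt : l < k := not_le.1 fun hkl => hk (hs l hl k hkl)
  have := h.2 l 1 le_rfl (Or.inr ⟨rfl, hlt⟩)
  omega

theorem tsum_dep (q : State N) (k : Fin (m + 1)) : ∑' i, q.dep k i = q.occ k 1 := by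
  have h2 := q.tsum_dep_ge k 0
  simpa using h2

theorem tsum_dep_first (q : State N) (k : Fin (m + 1)) (p : Prop) [Decidable p] (a : ℝ) :
    ∑' i, q.dep k i * (if p ∧ i = 0 then a else 0) =
      if p then ((q.occ k 1 : ℝ) - q.occ k 2) * a else 0 := by
  rw [tsum_eq_single 0 (fun i hi => by simp [hi])]
  by_cases hp : p <;> simp [hp, dep]

end State

variable {Λ c₀ c₁ : ℝ} {μ : Fin (m + 1) → ℝ} {π : PMF (State N)}

theorem DriftBound.mean_le (h : DriftBound Λ μ π) {f g₁ g₂ : State N → ℝ}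
    (hf : ∀ q, 0 ≤ f q) (h₁ : ∃ B, ∀ q, |g₁ q| ≤ B) (h₂ : ∃ B, ∀ q, |g₂ q| ≤ B)
    (hfg : ∀ q, gen Λ μ f q ≤ g₂ q - g₁ q) :
    ∫ q, g₁ q ∂π.toMeasure ≤ ∫ q, g₂ q ∂π.toMeasure := by
  have h3 := h f (fun q => g₁ q - g₂ q) hf ?_ fun q => by rw [neg_sub]; exact hfg q
  · rw [integral_sub (integrable_of_bdd π h₁) (integrable_of_bdd π h₂)] at h3
    linarith
  · obtain ⟨B, hB⟩ := h₁
    obtain ⟨B', hB'⟩ := h₂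
    exact ⟨B + B', fun q => (abs_sub _ _).trans (add_le_add (hB q) (hB' q))⟩

theorem mean_mono (π : PMF (State N)) {g₁ g₂ : State N → ℝ}
    (h₁ : ∃ B, ∀ q, |g₁ q| ≤ B) (h₂ : ∃ B, ∀ q, |g₂ q| ≤ B) (h : ∀ q, g₁ q ≤ g₂ q) :
    ∫ q, g₁ q ∂π.toMeasure ≤ ∫ q, g₂ q ∂π.toMeasure :=
  integral_mono (integrable_of_bdd π h₁) (integrable_of_bdd π h₂) h

theorem bdd_ite (A : State N → Prop) [DecidablePred A] :
    ∃ B, ∀ q, |(if A q then (1 : ℝ) else 0)| ≤ B :=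
  ⟨1, fun q => by by_cases h : A q <;> simp [h]⟩

theorem bdd_mul {g₁ g₂ : State N → ℝ} (h₁ : ∃ B, ∀ q, |g₁ q| ≤ B) (h₂ : ∃ B, ∀ q, |g₂ q| ≤ B) :
    ∃ B, ∀ q, |g₁ q * g₂ q| ≤ B := by
  obtain ⟨B, hB⟩ := h₁
  obtain ⟨B', hB'⟩ := h₂
  refine ⟨B * B', fun q => ?_⟩
  rw [abs_mul]
  exact mul_le_mul (hB q) (hB' q) (abs_nonneg _) ((abs_nonneg _).trans (hB q))

theorem bdd_add {g₁ g₂ : State N → ℝ} (h₁ : ∃ B, ∀ q, |g₁ q| ≤ B) (h₂ : ∃ B, ∀ q, |g₂ q| ≤ B) :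
    ∃ B, ∀ q, |g₁ q + g₂ q| ≤ B := by
  obtain ⟨B, hB⟩ := h₁
  obtain ⟨B', hB'⟩ := h₂
  exact ⟨B + B', fun q => (abs_add_le _ _).trans (add_le_add (hB q) (hB' q))⟩

theorem bdd_const (a : ℝ) : ∃ B, ∀ q : State N, |(fun _ => a) q| ≤ B := ⟨|a|, fun _ => le_rfl⟩

theorem bdd_const_mul (a : ℝ) {g : State N → ℝ} (h : ∃ B, ∀ q, |g q| ≤ B) :
    ∃ B, ∀ q, |a * g q| ≤ B := bdd_mul (bdd_const a) h

theorem bdd_nat {g : State N → ℕ} {B : ℕ} (h : ∀ q, g q ≤ B) : ∃ B, ∀ q, |(g q : ℝ)| ≤ B :=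
  ⟨B, fun q => by rw [Nat.abs_cast]; exact_mod_cast h q⟩

theorem bdd_idle (s : Finset (Fin (m + 1))) : ∃ B, ∀ q : State N, |(q.idle s : ℝ)| ≤ B :=
  bdd_nat fun q => q.idle_le s

theorem bdd_busy₂ : ∃ B, ∀ q : State N, |(q.busy₂ : ℝ)| ≤ B := bdd_nat fun q => q.busy₂_le

theorem bdd_occ (k : Fin (m + 1)) (i : ℕ) : ∃ B, ∀ q : State N, |(q.occ k i : ℝ)| ≤ B :=
  bdd_nat fun q => q.occ_le k i

/-- The probability, in stationarity, of at least `z` waiting jobs. -/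
noncomputable def excessProb (π : PMF (State N)) (z : ℕ) : ℝ :=
  ∫ q, (if z ≤ q.excess then (1 : ℝ) else 0) ∂π.toMeasure

theorem excessProb_nonneg (π : PMF (State N)) (z : ℕ) : 0 ≤ excessProb π z :=
  integral_nonneg fun q => by by_cases h : z ≤ q.excess <;> simp [h]

theorem excessProb_antitone (π : PMF (State N)) : Antitone (excessProb π) := fun z z' h =>
  mean_mono π (bdd_ite _) (bdd_ite _) fun q => by
    by_cases h1 : z' ≤ q.excess
    · simp [h1, h.trans h1]
    · simp only [h1, if_false]
      split_ifs <;> norm_num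

theorem excessProb_zero (π : PMF (State N)) : excessProb π 0 = 1 := by
  simp [excessProb]

theorem excessProb_le_one (π : PMF (State N)) (z : ℕ) : excessProb π z ≤ 1 :=
  (excessProb_antitone π (Nat.zero_le z)).trans (excessProb_zero π).le

/-- Flow balance for the positions `≥ r + 1` of pool `j`. -/
theorem DriftBound.mean_occ_le (h : DriftBound Λ μ π) (hΛ : 0 ≤ Λ) (hμ : ∀ k, 0 ≤ μ k)
    {k₀ : Fin (m + 1)} (hN : 0 < N k₀) (j : Fin (m + 1)) (r z : ℕ)
    (hz : ∀ (q : State N) i, q.IsTarget j (i + 1) → r ≤ i → z ≤ q.excess) :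
    μ j * ∫ q, (q.occ j (r + 1) : ℝ) ∂π.toMeasure ≤ Λ * excessProb π z := by
  rw [excessProb, ← integral_const_mul, ← integral_const_mul]
  -- The test function counts the jobs at these positions. Departures lower it at rate `μ j` times
  -- the occupancy at level `r + 1`, and an arrival raises it only if at least `z` jobs are waiting.
  refine h.mean_le (f := fun q => (q.tail j (r + 1) : ℝ)) (fun q => Nat.cast_nonneg _)
    (bdd_const_mul _ (bdd_occ j (r + 1))) (bdd_const_mul _ (bdd_ite _)) fun q => ?_
  obtain ⟨k, i, ht⟩ := q.exists_isTarget hN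
  refine (gen_le hΛ hμ (fun q : State N => (q.tail j (r + 1) : ℝ)) ht
    (a := if z ≤ q.excess then 1 else 0) ?_
    (fun k i => if j = k then (if r ≤ i then -1 else 0) else 0) fun k i hlt => ?_).trans ?_
  · simp only [q.tail_add ht.occ_lt]
    by_cases hc : j = k ∧ r + 1 ≤ i + 1
    · obtain ⟨rfl, hc⟩ := hc
      simp [hz q i ht (by omega), show r ≤ i by omega]
    · simp only [hc, if_false, add_zero, sub_self]
      split_ifs <;> norm_num
  · simp only [← q.tail_remove hlt j (r + 1)]
    by_cases hc : j = k ∧ r ≤ i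
    · simp [hc.1, hc.2]
    · by_cases hj : j = k
      · have : ¬ r ≤ i := fun hr => hc ⟨hj, hr⟩
        simp [this]
      · simp [hj]
  · rw [sub_eq_add_neg]
    refine add_le_add le_rfl (le_of_eq ?_)
    rw [Finset.sum_eq_single j (fun k _ hk => by simp [Ne.symm hk]) (by simp)]
    simp only [if_true]
    rw [← mul_neg, ← q.tsum_dep_ge j r, ← tsum_neg]
    congr 1
    refine tsum_congr fun i => ?_
    by_cases hi : r ≤ i <;> simp [hi]

/-- A group of fast pools of total capacity less than the arrival rate has few idle servers. -/
theorem DriftBound.mean_idle_le (h : DriftBound Λ μ π) (hΛ : 0 ≤ Λ) (hμ : ∀ k, 0 ≤ μ k)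
    {k₀ : Fin (m + 1)} (hN : 0 < N k₀) {s : Finset (Fin (m + 1))}
    (hs : ∀ a ∈ s, ∀ b, b ≤ a → b ∈ s) :
    2 * (Λ - ∑ k ∈ s, μ k * N k) * ∫ q, (q.idle s : ℝ) ∂π.toMeasure ≤
      Λ + ∑ k ∈ s, μ k * N k := by
  set A := ∑ k ∈ s, μ k * (N k : ℝ) with hA
  have hc : ∫ _q : State N, (Λ + A) ∂π.toMeasure = Λ + A := by simp
  rw [← integral_const_mul, ← hc]
  refine h.mean_le (f := fun q => (q.idle s : ℝ) ^ 2) (fun q => sq_nonneg _)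
    (bdd_const_mul _ (bdd_idle s)) (bdd_const _) fun q => ?_
  obtain ⟨k, i, ht⟩ := q.exists_isTarget hN
  refine (gen_le hΛ hμ (fun q : State N => (q.idle s : ℝ) ^ 2) ht
    (a := 1 - 2 * (q.idle s : ℝ)) ?_
    (fun k i => if k ∈ s ∧ i = 0 then 2 * (q.idle s : ℝ) + 1 else 0) fun k i hlt => ?_).trans ?_
  · have h1 := q.idle_add s ht.occ_lt
    -- With no idle server in `s` the square stays `0`, and the claimed increment bound is `1`;
    -- otherwise the arrival fills an idle server of `s`.
    rcases Nat.eq_zero_or_pos (q.idle s) with h0 | h0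
    · have h2 : (q.add k i).idle s = 0 := by omega
      simp [h0, h2]
    · rw [if_pos (ht.of_idle_pos hs h0)] at h1
      simp only [← h1]
      push_cast
      nlinarith
  · simp only [q.idle_remove s hlt]
    by_cases hk : k ∈ s ∧ i = 0
    · simp only [hk, and_self, if_true]
      push_cast
      nlinarith
    · simp [hk]
  · have h3 : ∑ k, μ k * ∑' i, q.dep k i *
        (if k ∈ s ∧ i = 0 then 2 * (q.idle s : ℝ) + 1 else 0) ≤ A * (2 * (q.idle s : ℝ) + 1) := by
      simp_rw [q.tsum_dep_first]
      rw [hA, Finset.sum_mul, ← Finset.sum_subset (Finset.subset_univ s)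
        (fun k _ hk => by simp [hk])]
      refine Finset.sum_le_sum fun k hk => ?_
      rw [if_pos hk, mul_assoc]
      refine mul_le_mul_of_nonneg_left ?_ (hμ k)
      refine mul_le_mul_of_nonneg_right ?_ (by positivity)
      have h4 : (q.occ k 1 : ℝ) ≤ N k := Nat.cast_le.2 (q.occ_le k 1)
      have h5 : (0 : ℝ) ≤ q.occ k 2 := Nat.cast_nonneg _
      linarith
    refine (add_le_add le_rfl h3).trans (le_of_eq ?_)
    ring

end SAJSQ

/-! ### Drift of idle and waiting counts, and the tail recursion. -/

namespace SAJSQ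

variable {m : ℕ} {N : Fin (m + 1) → ℕ} {Λ c₀ c₁ : ℝ} {μ : Fin (m + 1) → ℝ} {π : PMF (State N)}

theorem sum_departure_rate_le (hμ : ∀ k, c₀ ≤ μ k) (q : State N) :
    ∑ k, μ k * ((q.occ k 1 : ℝ) - q.occ k 2) ≤
      ∑ k, μ k * N k - c₀ * q.idle Finset.univ - c₀ * q.busy₂ := by
  rw [State.cast_idle, State.busy₂]
  push_cast
  rw [Finset.mul_sum, Finset.mul_sum, ← Finset.sum_sub_distrib, ← Finset.sum_sub_distrib]
  refine Finset.sum_le_sum fun k _ => ?_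
  have h1 : (0 : ℝ) ≤ (N k : ℝ) - q.occ k 1 := sub_nonneg.2 (Nat.cast_le.2 (q.occ_le k 1))
  have h2 : (0 : ℝ) ≤ q.occ k 2 := Nat.cast_nonneg _
  nlinarith [mul_le_mul_of_nonneg_right (hμ k) h1, mul_le_mul_of_nonneg_right (hμ k) h2]

/-- Second moment of the number of idle servers, restricted to many waiting jobs. -/
theorem DriftBound.mean_idle_sq_le (h : DriftBound Λ μ π) (hΛ : 0 ≤ Λ) (hc₀ : 0 < c₀)
    (hμ : ∀ k, c₀ ≤ μ k) {k₀ : Fin (m + 1)} (hN : 0 < N k₀) (z : ℕ) :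
    ∫ q, (if z ≤ q.excess then (1 : ℝ) else 0) *
        (c₀ * (q.idle Finset.univ : ℝ) ^ 2 + 2 * c₀ * (q.idle Finset.univ * q.busy₂))
        ∂π.toMeasure ≤
      (Λ + ∑ k, μ k * N k + (∑ k, μ k * N k - Λ) ^ 2 / c₀) * excessProb π z := by
  have hμ0 : ∀ k, 0 ≤ μ k := fun k => hc₀.le.trans (hμ k)
  set C := ∑ k, μ k * (N k : ℝ) with hC
  rw [excessProb, ← integral_const_mul]
  refine h.mean_le (f := fun q => (if z ≤ q.excess then (1 : ℝ) else 0) *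
      (q.idle Finset.univ : ℝ) ^ 2) (fun q => by split_ifs <;> positivity)
    (bdd_mul (bdd_ite _) (bdd_add (bdd_const_mul _ ?_) (bdd_const_mul _
      (bdd_mul (bdd_idle _) bdd_busy₂)))) (bdd_const_mul _ (bdd_ite _)) fun q => ?_
  · simp_rw [pow_two]
    exact bdd_mul (bdd_idle _) (bdd_idle _)
  obtain ⟨k, i, ht⟩ := q.exists_isTarget hN
  set ind : ℝ := if z ≤ q.excess then (1 : ℝ) else 0 with hind
  have hind0 : 0 ≤ ind := by rw [hind]; split_ifs <;> norm_num
  set I : ℝ := (q.idle Finset.univ : ℝ) with hI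
  have hI0 : 0 ≤ I := Nat.cast_nonneg _
  refine (gen_le hΛ hμ0 (fun q : State N => (if z ≤ q.excess then (1 : ℝ) else 0) *
      (q.idle Finset.univ : ℝ) ^ 2) ht
    (a := ind * (1 - 2 * I)) ?_
    (fun k i => if True ∧ i = 0 then ind * (2 * I + 1) else 0) fun k i hlt => ?_).trans ?_
  · have h1 := q.idle_add Finset.univ ht.occ_lt
    -- The indicator does not interfere: an arrival changes the number of waiting jobs only when no
    -- server is idle, where the square vanishes before and after.
    rcases Nat.eq_zero_or_pos (q.idle Finset.univ) with h0 | h0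
    · have h2 : (q.add k i).idle Finset.univ = 0 := by omega
      simp only [hI, h0, h2]
      simpa using hind0
    · obtain ⟨-, rfl⟩ := ht.of_idle_pos (fun _ _ b _ => Finset.mem_univ b) h0
      have h2 := q.excess_add ht.occ_lt
      simp only [Finset.mem_univ, and_self, if_true] at h1
      simp only [(by decide : ¬ 1 ≤ 0), if_false, add_zero] at h2
      simp only [h2, ← hind]
      have h3 : I = ((q.add k 0).idle Finset.univ : ℝ) + 1 := by rw [hI, ← h1]; push_cast; rfl
      have h4 : (q.idle Finset.univ : ℝ) = I := rfl
      rw [h4, h3]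
      nlinarith
  · have h1 := q.idle_remove Finset.univ hlt
    have h2 := q.excess_remove hlt
    by_cases hi : i = 0
    · subst hi
      simp only [Finset.mem_univ, and_self, if_true] at h1
      simp only [(by decide : ¬ 1 ≤ 0), if_false, add_zero] at h2
      simp only [h1, h2, ← hind, and_self, if_true]
      push_cast
      have h4 : (q.idle Finset.univ : ℝ) = I := rfl
      rw [h4]
      nlinarith
    -- A departure from a longer queue leaves the idle count alone and can only switch the indicator
    -- off.
    · simp only [hi, and_false, if_false, add_zero] at h1 ⊢
      rw [if_pos (by omega)] at h2
      rw [h1, sub_nonpos]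
      refine mul_le_mul_of_nonneg_right ?_ (by positivity)
      by_cases h3 : z ≤ (q.remove k i).excess
      · rw [if_pos h3, if_pos (by omega)]
      · rw [if_neg h3]; exact hind0
  · simp_rw [q.tsum_dep_first, if_true, ← mul_assoc]
    rw [← Finset.sum_mul, ← Finset.sum_mul]
    set D := ∑ k, μ k * ((q.occ k 1 : ℝ) - q.occ k 2) with hD
    have h1 := sum_departure_rate_le hμ q
    rw [← hD, ← hC, ← hI] at h1
    have hb : (0 : ℝ) ≤ q.busy₂ := Nat.cast_nonneg _
    have h2 : D ≤ C := by
      have := mul_nonneg hc₀.le hI0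
      have := mul_nonneg hc₀.le hb
      linarith
    -- The drift supplies `-2 c₀ I²`; half of it is spent on absorbing the linear term in `C - Λ`.
    have h3 : 2 * I * (C - Λ) ≤ c₀ * I ^ 2 + (C - Λ) ^ 2 / c₀ := by
      have h4 : 0 ≤ (c₀ * I - (C - Λ)) ^ 2 / c₀ := by positivity
      have h5 : (c₀ * I - (C - Λ)) ^ 2 / c₀ = c₀ * I ^ 2 - 2 * I * (C - Λ) + (C - Λ) ^ 2 / c₀ := by
        field_simp
        ring
      linarith
    have h4 : 2 * I * D ≤ 2 * I * (C - c₀ * I - c₀ * q.busy₂) :=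
      mul_le_mul_of_nonneg_left h1 (by positivity)
    have h5 : Λ * (1 - 2 * I) + D * (2 * I + 1) ≤
        (Λ + C + (C - Λ) ^ 2 / c₀) - (c₀ * I ^ 2 + 2 * c₀ * (I * q.busy₂)) := by
      nlinarith
    have h6 := mul_le_mul_of_nonneg_left h5 hind0
    calc _ = ind * (Λ * (1 - 2 * I) + D * (2 * I + 1)) := by ring
      _ ≤ _ := h6
      _ = _ := by ring

/-- Drift of a ramp function of the number of waiting jobs minus the number of idle servers. -/
theorem DriftBound.mean_ramp_le (h : DriftBound Λ μ π) (hΛ : 0 ≤ Λ) (hμ : ∀ k, 0 ≤ μ k)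
    (hc₁ : 0 ≤ c₁)
    (hμ₁ : ∀ k, μ k ≤ c₁) {k₀ : Fin (m + 1)} (hN : 0 < N k₀)
    (hb : Λ ≤ ∑ k, μ k * N k) (z h' : ℕ) (hh : 0 < h') :
    (∑ k, μ k * N k - Λ) *
        ∫ q, (if q.idle Finset.univ + z + h' + 1 ≤ q.excess then (1 : ℝ) else 0) ∂π.toMeasure ≤
      ∫ q, (c₁ * ((q.idle Finset.univ : ℝ) * (if z ≤ q.excess then (1 : ℝ) else 0)) +
        Λ / h' * (if z ≤ q.excess then (1 : ℝ) else 0)) ∂π.toMeasure := by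
  set C := ∑ k, μ k * (N k : ℝ) with hC
  set φ : ℕ → ℝ := fun i => min 1 ((i : ℝ) / h') with hφ
  have hh' : (0 : ℝ) < h' := Nat.cast_pos.2 hh
  have hφ0 : ∀ i, 0 ≤ φ i := fun i => le_min zero_le_one (by positivity)
  have hφ1 : ∀ i, φ i ≤ 1 := fun i => min_le_left _ _
  have hφs : ∀ i, φ i - φ (i - 1) ≤ 1 / h' := by
    intro i
    rcases Nat.eq_zero_or_pos i with rfl | hi
    · simp
    · obtain ⟨j, rfl⟩ : ∃ j, i = j + 1 := ⟨i - 1, by omega⟩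
      have h0 : (0 : ℝ) < 1 / h' := by positivity
      have h1 : φ (j + 1) ≤ φ j + 1 / h' := by
        simp only [hφ]
        rw [min_add]
        refine min_le_min (by linarith) (le_of_eq ?_)
        push_cast
        rw [add_div]
      rw [Nat.add_sub_cancel]
      linarith
  -- A discrete primitive of the ramp, so increments of `F` are values of `φ`; the slope `1 / h'`
  -- controls the second-order term `φ y - φ (y - 1)`.
  set F : ℕ → ℝ := fun y => ∑ i ∈ Finset.range y, φ i with hF
  have hF0 : ∀ y, 0 ≤ F y := fun y => Finset.sum_nonneg fun i _ => hφ0 i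
  have hFm : Monotone F := monotone_nat_of_le_succ fun y => by
    simp only [hF, Finset.sum_range_succ]
    linarith [hφ0 y]
  have hFs : ∀ y, F (y + 1) = F y + φ y := fun y => by simp only [hF, Finset.sum_range_succ]
  have hFp : ∀ y, F (y - 1) - F y = -φ (y - 1) := by
    intro y
    rcases Nat.eq_zero_or_pos y with rfl | hy
    · simp [hφ]
    · obtain ⟨j, rfl⟩ : ∃ j, y = j + 1 := ⟨y - 1, by omega⟩
      rw [hFs, Nat.add_sub_cancel]
      ring
  rw [← integral_const_mul]
  refine h.mean_le (f := fun q => F (q.excess - (q.idle Finset.univ + z))) (fun q => hF0 _)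
    (bdd_const_mul _ (bdd_ite _)) (bdd_add (bdd_const_mul _ (bdd_mul (bdd_idle _) (bdd_ite _)))
      (bdd_const_mul _ (bdd_ite _))) fun q => ?_
  obtain ⟨k, i, ht⟩ := q.exists_isTarget hN
  set y := q.excess - (q.idle Finset.univ + z) with hy
  have hle := gen_le hΛ hμ (fun q : State N => F (q.excess - (q.idle Finset.univ + z))) ht
    (a := φ y) (by
      have h1 := q.idle_add Finset.univ ht.occ_lt
      have h2 := q.excess_add ht.occ_lt
      -- An arrival either fills an idle server or becomes a waiting job, so it raises `excess -
      -- idle` by one; truncated subtraction turns the equality into `≤`.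
      have h3 : (q.add k i).excess - ((q.add k i).idle Finset.univ + z) ≤ y + 1 := by
        by_cases hi : i = 0
        · simp only [hi, Finset.mem_univ, and_self, if_true, (by decide : ¬ 1 ≤ 0), if_false] at h1 h2 ⊢
          omega
        · simp only [hi, and_false, if_false] at h1
          rw [if_pos (by omega)] at h2
          omega
      have h4 := hFm h3
      rw [hFs] at h4
      linarith)
    (fun _ _ => -φ (y - 1)) (fun k i hlt => by
      have h1 := q.idle_remove Finset.univ hlt
      have h2 := q.excess_remove hlt
      have h3 : (q.remove k i).excess - ((q.remove k i).idle Finset.univ + z) ≤ y - 1 := by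
        by_cases hi : i = 0
        · simp only [hi, Finset.mem_univ, and_self, if_true, (by decide : ¬ 1 ≤ 0), if_false] at h1 h2 ⊢
          omega
        · simp only [hi, and_false, if_false] at h1
          rw [if_pos (by omega)] at h2
          omega
      have h4 := hFm h3
      rw [← hFp]
      linarith)
  refine hle.trans ?_
  simp_rw [tsum_mul_right, q.tsum_dep, ← mul_assoc]
  rw [← Finset.sum_mul]
  set I : ℝ := (q.idle Finset.univ : ℝ) with hI
  have hI0 : 0 ≤ I := Nat.cast_nonneg _
  have h1 : C - c₁ * I ≤ ∑ k, μ k * (q.occ k 1 : ℝ) := by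
    rw [hI, State.cast_idle, Finset.mul_sum, hC, ← Finset.sum_sub_distrib]
    refine Finset.sum_le_sum fun k _ => ?_
    have h1 : (0 : ℝ) ≤ (N k : ℝ) - q.occ k 1 := sub_nonneg.2 (Nat.cast_le.2 (q.occ_le k 1))
    nlinarith [mul_le_mul_of_nonneg_right (hμ₁ k) h1]
  have h2 := mul_le_mul_of_nonneg_right h1 (hφ0 (y - 1))
  have h3 := mul_le_mul_of_nonneg_left (hφs y) hΛ
  by_cases hz : z ≤ q.excess
  · rw [if_pos hz]
    have h4 : (C - Λ) * (if q.idle Finset.univ + z + h' + 1 ≤ q.excess then (1 : ℝ) else 0) ≤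
        (C - Λ) * φ (y - 1) := by
      refine mul_le_mul_of_nonneg_left ?_ (sub_nonneg.2 hb)
      split_ifs with h5
      · have h6 : h' ≤ y - 1 := by omega
        simp only [hφ]
        rw [min_eq_left]
        rw [le_div_iff₀ hh', one_mul]
        exact_mod_cast h6
      · exact hφ0 _
    have h5 : c₁ * I * φ (y - 1) ≤ c₁ * I := mul_le_of_le_one_right (by positivity) (hφ1 _)
    have h6 : Λ * (1 / h') = Λ / h' := by ring
    nlinarith
  · have hy0 : y = 0 := by omega
    have h5 : ¬ q.idle Finset.univ + z + h' + 1 ≤ q.excess := by omega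
    rw [if_neg hz, if_neg h5, hy0]
    simp [hφ]

/-- The recursive inequality for the tail of the number of waiting jobs. -/
theorem DriftBound.excessProb_add_le (h : DriftBound Λ μ π) (hΛ : 0 ≤ Λ) (hc₀ : 0 < c₀)
    (hμ : ∀ k, c₀ ≤ μ k) (hμ₁ : ∀ k, μ k ≤ c₁) (hN : 0 < N 0)
    (hb : Λ ≤ ∑ k, μ k * N k) (z u t h' s : ℕ) (hh : 0 < h') (ht : 0 < t) (htu : t * u < z)
    (hs0 : 0 < s)
    (hs : 2 * (Λ + ∑ k, μ k * N k + (∑ k, μ k * N k - Λ) ^ 2 / c₀) ≤ c₀ * (s : ℝ) ^ 2) :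
    (∑ k, μ k * N k - Λ) * excessProb π (z + h' + 1 + s) ≤
      (c₁ * (Λ + ∑ k, μ k * N k + (∑ k, μ k * N k - Λ) ^ 2 / c₀) / (c₀ * t) + 2 * Λ / h') *
          excessProb π z +
        2 * c₁ * (∑ k, N k : ℕ) * ((m + 1) * (Λ / c₀) * excessProb π (u * ∑ k, N k)) := by
  set C := ∑ k, μ k * (N k : ℝ) with hC
  set K := Λ + C + (C - Λ) ^ 2 / c₀ with hK
  set n := ∑ k, N k with hn
  have hμ0 : ∀ k, 0 ≤ μ k := fun k => hc₀.le.trans (hμ k)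
  have hc₁ : 0 ≤ c₁ := (hμ0 0).trans (hμ₁ 0)
  have ht' : (0 : ℝ) < t := Nat.cast_pos.2 ht
  have hs' : (0 : ℝ) < s := Nat.cast_pos.2 hs0
  have bI2 : ∃ B, ∀ q : State N, |(q.idle Finset.univ : ℝ) ^ 2| ≤ B := by
    simp_rw [pow_two]
    exact bdd_mul (bdd_idle _) (bdd_idle _)
  have bH : ∀ z : ℕ, ∃ B, ∀ q : State N, |(if z ≤ q.excess then (1 : ℝ) else 0) *
        (c₀ * (q.idle Finset.univ : ℝ) ^ 2 + 2 * c₀ * (q.idle Finset.univ * q.busy₂))| ≤ B :=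
    fun z => bdd_mul (bdd_ite _) (bdd_add (bdd_const_mul _ bI2) (bdd_const_mul _
      (bdd_mul (bdd_idle _) bdd_busy₂)))
  have hH := fun z => h.mean_idle_sq_le hΛ hc₀ hμ hN z
  -- long queues
  have bS : ∃ B, ∀ q : State N, |∑ k, (q.occ k (u + 2) : ℝ)| ≤ B := by
    refine ⟨n, fun q => ?_⟩
    rw [abs_of_nonneg (Finset.sum_nonneg fun k _ => Nat.cast_nonneg _), hn]
    push_cast
    exact Finset.sum_le_sum fun k _ => Nat.cast_le.2 (q.occ_le k _)
  have hS : ∫ q, ∑ k, (q.occ k (u + 2) : ℝ) ∂π.toMeasure ≤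
      (m + 1) * (Λ / c₀) * excessProb π (u * n) := by
    rw [integral_finsetSum _ fun k _ => integrable_of_bdd π (bdd_occ k _)]
    have h1 : ∀ k : Fin (m + 1), ∫ q, (q.occ k (u + 2) : ℝ) ∂π.toMeasure ≤
        Λ / c₀ * excessProb π (u * n) := by
      intro k
      have h2 := h.mean_occ_le hΛ hμ0 hN k (u + 1) (u * n) fun q i hq hi => hq.mul_le_excess hi
      have h3 : 0 ≤ ∫ q, (q.occ k (u + 2) : ℝ) ∂π.toMeasure :=
        integral_nonneg fun q => Nat.cast_nonneg _
      have h4 := mul_le_mul_of_nonneg_right (hμ k) h3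
      rw [div_mul_eq_mul_div, le_div_iff₀ hc₀]
      linarith
    refine (Finset.sum_le_sum fun k _ => h1 k).trans (le_of_eq ?_)
    simp [mul_assoc]
  -- idle servers
  have hI : ∫ q, (q.idle Finset.univ : ℝ) * (if z ≤ q.excess then (1 : ℝ) else 0) ∂π.toMeasure ≤
      K / (2 * c₀ * t) * excessProb π z + n * ((m + 1) * (Λ / c₀) * excessProb π (u * n)) := by
    have h1 : ∫ q, (q.idle Finset.univ : ℝ) * (if z ≤ q.excess then (1 : ℝ) else 0) ∂π.toMeasure ≤
        ∫ q, ((2 * c₀ * t)⁻¹ * ((if z ≤ q.excess then (1 : ℝ) else 0) *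
          (c₀ * (q.idle Finset.univ : ℝ) ^ 2 + 2 * c₀ * (q.idle Finset.univ * q.busy₂))) +
          n * ∑ k, (q.occ k (u + 2) : ℝ)) ∂π.toMeasure := by
      refine mean_mono π (bdd_mul (bdd_idle _) (bdd_ite _)) (bdd_add (bdd_const_mul _ (bH z))
        (bdd_const_mul _ bS)) fun q => ?_
      have hI0 : (0 : ℝ) ≤ q.idle Finset.univ := Nat.cast_nonneg _
      have hB0 : (0 : ℝ) ≤ q.busy₂ := Nat.cast_nonneg _
      have hS0 : (0 : ℝ) ≤ ∑ k, (q.occ k (u + 2) : ℝ) :=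
        Finset.sum_nonneg fun k _ => Nat.cast_nonneg _
      by_cases hz : z ≤ q.excess
      · rw [if_pos hz, mul_one, one_mul]
        -- With at least `t` servers having two jobs, the product term controls `I`. Otherwise `t *
        -- u < z` forces a queue of length at least `u + 2`, and the trivial bound `I ≤ n` is
        -- charged to the long-queue term.
        by_cases hB : t ≤ q.busy₂
        · have h2 : (t : ℝ) ≤ q.busy₂ := Nat.cast_le.2 hB
          have h3 : (2 * c₀ * t) * (q.idle Finset.univ : ℝ) ≤
              c₀ * (q.idle Finset.univ : ℝ) ^ 2 + 2 * c₀ * (q.idle Finset.univ * q.busy₂) := by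
            have := mul_le_mul_of_nonneg_left h2 (mul_nonneg (mul_nonneg zero_le_two hc₀.le) hI0)
            have : 0 ≤ c₀ * (q.idle Finset.univ : ℝ) ^ 2 := by positivity
            nlinarith
          have h4 : (q.idle Finset.univ : ℝ) ≤ (2 * c₀ * t)⁻¹ *
              (c₀ * (q.idle Finset.univ : ℝ) ^ 2 + 2 * c₀ * (q.idle Finset.univ * q.busy₂)) := by
            rw [le_inv_mul_iff₀ (by positivity)]
            exact h3
          have : 0 ≤ (n : ℝ) * ∑ k, (q.occ k (u + 2) : ℝ) := by positivity
          linarith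
        · have h2 : ∃ k, q.occ k (u + 2) ≠ 0 := by
            by_contra hc
            push Not at hc
            have h3 := State.excess_le_mul hc
            have h4 : q.busy₂ * u ≤ t * u := Nat.mul_le_mul_right u (by omega)
            omega
          obtain ⟨k, hk⟩ := h2
          have h3 : (1 : ℝ) ≤ q.occ k (u + 2) := by exact_mod_cast Nat.one_le_iff_ne_zero.2 hk
          have h4 : (1 : ℝ) ≤ ∑ k, (q.occ k (u + 2) : ℝ) := h3.trans
            (Finset.single_le_sum (f := fun k => (q.occ k (u + 2) : ℝ))
              (fun k _ => Nat.cast_nonneg _) (Finset.mem_univ k))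
          have h5 : (q.idle Finset.univ : ℝ) ≤ n := Nat.cast_le.2 (q.idle_le _)
          have h6 : (n : ℝ) * 1 ≤ n * ∑ k, (q.occ k (u + 2) : ℝ) :=
            mul_le_mul_of_nonneg_left h4 (Nat.cast_nonneg _)
          have h7 : 0 ≤ (2 * c₀ * t)⁻¹ *
              (c₀ * (q.idle Finset.univ : ℝ) ^ 2 + 2 * c₀ * (q.idle Finset.univ * q.busy₂)) := by
            positivity
          linarith
      · rw [if_neg hz]
        simp only [mul_zero, zero_mul, zero_add]
        positivity
    refine h1.trans ?_
    rw [integral_add (integrable_of_bdd π (bdd_const_mul _ (bH z)))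
      (integrable_of_bdd π (bdd_const_mul _ bS)), integral_const_mul, integral_const_mul]
    refine add_le_add ?_ (mul_le_mul_of_nonneg_left hS (Nat.cast_nonneg _))
    have h2 := mul_le_mul_of_nonneg_left (hH z) (inv_pos.2 (show 0 < 2 * c₀ * t by positivity)).le
    refine h2.trans (le_of_eq ?_)
    rw [div_eq_mul_inv]
    ring
  -- comparison of the tails of the waiting jobs
  have hG : excessProb π (z + h' + 1 + s) ≤ 2 * ∫ q,
      (if q.idle Finset.univ + z + h' + 1 ≤ q.excess then (1 : ℝ) else 0) ∂π.toMeasure := by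
    set z' := z + h' + 1 + s with hz'
    have h1 : excessProb π z' ≤ ∫ q,
        ((if q.idle Finset.univ + z + h' + 1 ≤ q.excess then (1 : ℝ) else 0) +
        (c₀ * s ^ 2)⁻¹ * ((if z' ≤ q.excess then (1 : ℝ) else 0) *
        (c₀ * (q.idle Finset.univ : ℝ) ^ 2 + 2 * c₀ * (q.idle Finset.univ * q.busy₂))))
        ∂π.toMeasure := by
      refine mean_mono π (bdd_ite _) (bdd_add (bdd_ite _) (bdd_const_mul _ (bH z'))) fun q => ?_
      have hnn : 0 ≤ (c₀ * (s : ℝ) ^ 2)⁻¹ *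
        (c₀ * (q.idle Finset.univ : ℝ) ^ 2 + 2 * c₀ * (q.idle Finset.univ * q.busy₂)) := by
        positivity
      by_cases hz : z' ≤ q.excess
      · simp only [if_pos hz, one_mul]
        -- When this fails, at least `s` servers are idle. Chebyshev with the second moment bound
        -- and the choice of `s` makes this at most half of the left side, hence the factor `2`.
        by_cases h2 : q.idle Finset.univ + z + h' + 1 ≤ q.excess
        · rw [if_pos h2]
          linarith
        · have h3 : (s : ℝ) ≤ q.idle Finset.univ := by
            have : s ≤ q.idle Finset.univ := by omega
            exact_mod_cast this
          rw [if_neg h2, zero_add, le_inv_mul_iff₀ (by positivity), mul_one]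
          have h4 : (s : ℝ) ^ 2 ≤ (q.idle Finset.univ : ℝ) ^ 2 := by gcongr
          have h5 := mul_le_mul_of_nonneg_left h4 hc₀.le
          have : 0 ≤ 2 * c₀ * ((q.idle Finset.univ : ℝ) * q.busy₂) := by positivity
          linarith
      · simp only [if_neg hz, zero_mul, mul_zero, add_zero]
        split_ifs <;> norm_num
    rw [integral_add (integrable_of_bdd π (bdd_ite _))
      (integrable_of_bdd π (bdd_const_mul _ (bH z'))), integral_const_mul] at h1
    have h2 := mul_le_mul_of_nonneg_left (hH z')
      (inv_pos.2 (show 0 < c₀ * (s : ℝ) ^ 2 by positivity)).le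
    have h3 : (c₀ * (s : ℝ) ^ 2)⁻¹ * (K * excessProb π z') ≤ 1 / 2 * excessProb π z' := by
      rw [← mul_assoc]
      refine mul_le_mul_of_nonneg_right ?_ (excessProb_nonneg π z')
      rw [inv_mul_le_iff₀ (by positivity)]
      linarith
    linarith
  have hX := h.mean_ramp_le hΛ hμ0 hc₁ hμ₁ hN hb z h' hh
  rw [integral_add (integrable_of_bdd π (bdd_const_mul _ (bdd_mul (bdd_idle _) (bdd_ite _))))
    (integrable_of_bdd π (bdd_const_mul _ (bdd_ite _))), integral_const_mul,
    integral_const_mul] at hX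
  have h1 := mul_le_mul_of_nonneg_left hG (sub_nonneg.2 hb)
  have h2 := mul_le_mul_of_nonneg_left hI hc₁
  have h3 : c₁ * K / (c₀ * t) = 2 * (c₁ * (K / (2 * c₀ * t))) := by
    field_simp
  have h4 : 2 * Λ / (h' : ℝ) = 2 * (Λ / h') := by ring
  have h5 : ∫ q, (if z ≤ q.excess then (1 : ℝ) else 0) ∂π.toMeasure = excessProb π z := rfl
  rw [h5] at hX
  rw [h3, h4]
  linarith

/-- An a priori bound for the tail of the number of waiting jobs. -/
theorem DriftBound.pow_mul_excessProb_le (h : DriftBound Λ μ π) (hΛ : 0 ≤ Λ) (hc₀ : 0 < c₀)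
    (hμ : ∀ k, c₀ ≤ μ k) (hN : ∀ k, 0 < N k) {r : ℝ} (hr : 1 < r)
    (hrΛ : Λ * r ≤ ∑ k, μ k * N k) (u : ℕ) :
    (r - 1) * (r⁻¹ - Λ / ∑ k, μ k * N k) * c₀ * r ^ u *
      excessProb π (u * ∑ k, N k + 1) ≤ Λ := by
  have hr0 : 0 < r := by linarith
  have hcap : 0 < ∑ k, μ k * (N k : ℝ) := Finset.sum_pos
    (fun k _ => mul_pos (hc₀.trans_le (hμ k)) (Nat.cast_pos.2 (hN k))) Finset.univ_nonempty
  set κ := (r - 1) * (r⁻¹ - Λ / ∑ k, μ k * N k) * c₀ with hκ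
  have hκ0 : 0 ≤ κ := by
    refine mul_nonneg (mul_nonneg (by linarith) (sub_nonneg.2 ?_)) hc₀.le
    rw [inv_eq_one_div, div_le_div_iff₀ hcap hr0]
    linarith
  have hc : ∫ _q : State N, Λ ∂π.toMeasure = Λ := by simp
  rw [excessProb, ← integral_const_mul]
  refine le_trans ?_ hc.le
  refine h.mean_le (f := fun q => ∑ k, q.expWeight r k)
    (fun q => Finset.sum_nonneg fun k _ => q.expWeight_nonneg hr0.le k)
    (bdd_const_mul _ (bdd_ite _)) (bdd_const _) fun q => ?_
  have h1 := gen_expWeight_le hΛ hc₀ hμ hN hr hrΛ q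
  rw [← hκ] at h1
  have h0 : ∀ k, 0 ≤ q.expWeight r k := fun k => q.expWeight_nonneg hr0.le k
  -- More than `u` waiting jobs per server on average force a queue of length at least `u + 2`,
  -- whose top position alone has weight at least `r ^ u`.
  have h2 : r ^ u * (if u * ∑ k, N k + 1 ≤ q.excess then (1 : ℝ) else 0) ≤
      ∑ k, q.expWeight r k := by
    split_ifs with hq
    · have h3 : ∃ k, q.occ k (u + 2) ≠ 0 := by
        by_contra hc
        push Not at hc
        have h3 := State.excess_le_mul hc
        have h4 : q.busy₂ * u ≤ u * ∑ k, N k := by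
          rw [mul_comm]
          exact Nat.mul_le_mul_left u q.busy₂_le
        omega
      obtain ⟨k, hk⟩ := h3
      have h3 : (1 : ℝ) ≤ q.occ k (u + 2) := by exact_mod_cast Nat.one_le_iff_ne_zero.2 hk
      have h4 := q.le_expWeight hr0.le k (u + 1)
      have h5 : r ^ (u + 1) * 1 ≤ r ^ (u + 1) * (q.occ k (u + 2) : ℝ) :=
        mul_le_mul_of_nonneg_left h3 (by positivity)
      have h6 : r ^ u ≤ r ^ (u + 1) := pow_le_pow_right₀ hr.le (Nat.le_succ u)
      have h7 : q.expWeight r k ≤ ∑ k, q.expWeight r k := Finset.single_le_sum (f := fun k => q.expWeight r k) (fun k _ => h0 k)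
        (Finset.mem_univ k)
      have h8 : u + 1 + 1 = u + 2 := rfl
      rw [h8] at h4
      linarith
    · rw [mul_zero]
      exact Finset.sum_nonneg fun k _ => h0 k
  have h3 := mul_le_mul_of_nonneg_left h2 hκ0
  rw [← mul_assoc] at h3
  linarith

end SAJSQ

/-! ### Bootstrapping the tail recursion. -/

namespace SAJSQ

open Asymptotics

/-- The hypothesis says that `f n` grows at least like a root of `n`, so a geometric factor in `f n`
beats every power of `n`. -/
theorem superpolynomialDecay_pow_comp {a : ℝ} (ha0 : 0 ≤ a) (ha1 : a < 1) {f : ℕ → ℕ} {M p : ℕ}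
    (hf : ∀ n, n ≤ M * (f n + 1) ^ p) :
    SuperpolynomialDecay atTop (fun n : ℕ => (n : ℝ)) fun n => a ^ f n := by
  have hft : Tendsto f atTop atTop := by
    refine tendsto_atTop.2 fun b => ?_
    filter_upwards [eventually_gt_atTop (M * b ^ p)] with n hn
    by_contra hlt
    have h1 : (f n + 1) ^ p ≤ b ^ p := Nat.pow_le_pow_left (by omega) p
    exact absurd (hn.trans_le ((hf n).trans (Nat.mul_le_mul_left M h1))) (lt_irrefl _)
  intro k
  have h1 : Tendsto (fun n => (M : ℝ) ^ k * 2 ^ (p * k) *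
      ((f n : ℝ) ^ (p * k) * a ^ f n)) atTop (𝓝 0) := by
    have := ((tendsto_pow_const_mul_const_pow_of_lt_one (p * k) ha0 ha1).comp hft).const_mul
      ((M : ℝ) ^ k * 2 ^ (p * k))
    rwa [mul_zero] at this
  refine squeeze_zero' (Eventually.of_forall fun n => by positivity) ?_ h1
  filter_upwards [hft.eventually_ge_atTop 1] with n hn
  have h2 : (n : ℝ) ≤ M * (2 * f n) ^ p := by
    have h3 : n ≤ M * (2 * f n) ^ p :=
      (hf n).trans (Nat.mul_le_mul_left M (Nat.pow_le_pow_left (by omega) p))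
    exact_mod_cast h3
  calc (n : ℝ) ^ k * a ^ f n ≤ (M * (2 * (f n : ℝ)) ^ p) ^ k * a ^ f n := by gcongr
    _ = _ := by rw [mul_pow, mul_pow, mul_pow, ← pow_mul, ← pow_mul]; ring

theorem iterate_le {G : ℕ → ℝ} {z d : ℕ} {η : ℝ} (h1 : G z ≤ 1)
    (h : ∀ y, z ≤ y → G (y + d) ≤ 1 / 2 * G y + η) (hη : 0 ≤ η) (J : ℕ) :
    G (z + J * d) ≤ (1 / 2) ^ J + 2 * η := by
  induction J with
  | zero => simp only [zero_mul, add_zero, pow_zero]; linarith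
  | succ J ih =>
    have h2 := h (z + J * d) (Nat.le_add_right _ _)
    rw [add_assoc, ← Nat.succ_mul] at h2
    rw [pow_succ]
    linarith

/-- A self-improving recursion for tails. -/
theorem exists_tail_bound {G : ℕ → ℕ → ℝ} {D : ℕ} {C : ℝ} (hD : 0 < D) (hC : 0 ≤ C)
    (hG0 : ∀ n z, 0 ≤ G n z) (hG1 : ∀ n z, G n z ≤ 1) (hanti : ∀ n, Antitone (G n))
    (hrec : ∀ᶠ n : ℕ in atTop, ∀ z u, D * (n.sqrt + 1) * u < z →
      G n (z + D * (n.sqrt + 1)) ≤ 1 / 2 * G n z + C * (n : ℝ) ^ 2 * G n (u * n))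
    (hcrude : SuperpolynomialDecay atTop (fun n : ℕ => (n : ℝ)) fun n => G n (n * n + 1)) :
    ∃ (E : ℕ) (e : ℕ → ℝ), SuperpolynomialDecay atTop (fun n : ℕ => (n : ℝ)) e ∧
      ∀ᶠ n : ℕ in atTop, ∀ J, G n (E * (n.sqrt + 1) + J * (D * (n.sqrt + 1))) ≤
        (1 / 2) ^ J + e n := by
  set half : ℕ → ℝ := fun n => (1 / 2 : ℝ) ^ (n.sqrt + 1) with hhalf
  have hhalfd : SuperpolynomialDecay atTop (fun n : ℕ => (n : ℝ)) half :=
    superpolynomialDecay_pow_comp (f := fun n => n.sqrt + 1) (M := 1) (p := 2) (by norm_num)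
      (by norm_num) fun n => by
        have := Nat.lt_succ_sqrt n
        simp only [Nat.succ_eq_add_one] at this
        nlinarith
  have hstep : ∀ f : ℕ → ℝ, SuperpolynomialDecay atTop (fun n : ℕ => (n : ℝ)) f →
      SuperpolynomialDecay atTop (fun n : ℕ => (n : ℝ)) fun n => 2 * (C * (n : ℝ) ^ 2 * f n) := by
    intro f hf
    refine ((hf.param_pow_mul 2).const_mul (2 * C)).congr fun n => ?_
    simp only [Pi.mul_apply, Pi.pow_apply]
    ring
  set e₁ : ℕ → ℝ := fun n => half n + 2 * (C * (n : ℝ) ^ 2 * G n (n * n + 1)) with he₁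
  set e₂ : ℕ → ℝ := fun n => half n + 2 * (C * (n : ℝ) ^ 2 * e₁ n) with he₂
  have hd₁ : SuperpolynomialDecay atTop (fun n : ℕ => (n : ℝ)) e₁ := hhalfd.add (hstep _ hcrude)
  have hd₂ : SuperpolynomialDecay atTop (fun n : ℕ => (n : ℝ)) e₂ := hhalfd.add (hstep _ hd₁)
  -- The last stage starts at `36 * D ^ 3 * σ + 1`, which is at most `37 * D ^ 3 * σ`.
  refine ⟨37 * D ^ 3, fun n => 2 * (C * (n : ℝ) ^ 2 * e₂ n), hstep _ hd₂, ?_⟩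
  filter_upwards [hrec, eventually_ge_atTop 1] with n hn hn1 J
  have hs1 : n.sqrt * n.sqrt ≤ n := Nat.sqrt_le n
  have hs0 : 1 ≤ n.sqrt := Nat.le_sqrt.2 (by omega)
  have hsn : n.sqrt ≤ n := Nat.sqrt_le_self n
  set σ := n.sqrt + 1 with hσ
  have hσ2 : σ * σ ≤ 4 * n := by nlinarith
  have hσn : σ ≤ 2 * n := by omega
  have hσ0 : 1 ≤ σ := by omega
  have hD1 : 1 ≤ D := hD
  have hDσ : 1 ≤ D * σ := Nat.mul_pos hD hσ0
  -- A tail bound at level `u n` yields geometric decay from a level just above `D σ u`, up to a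
  -- polynomial multiple of that bound.
  have stage : ∀ (u z : ℕ) (ε : ℝ), G n (u * n) ≤ ε → 0 ≤ ε → D * σ * u < z → ∀ J,
      G n (z + J * (D * σ)) ≤ (1 / 2) ^ J + 2 * (C * (n : ℝ) ^ 2 * ε) := by
    intro u z ε hε hε0 hz J
    refine iterate_le (hG1 n z) (fun y hy => (hn y u (hz.trans_le hy)).trans ?_) (by positivity) J
    have := mul_le_mul_of_nonneg_left hε (show 0 ≤ C * (n : ℝ) ^ 2 by positivity)
    linarith
  have hC2 : ∀ x : ℝ, 0 ≤ x → 0 ≤ 2 * (C * (n : ℝ) ^ 2 * x) := fun x hx => by positivity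
  have hh0 : 0 ≤ half n := by positivity
  have he₁0 : 0 ≤ e₁ n := add_nonneg hh0 (hC2 _ (hG0 _ _))
  have he₂0 : 0 ≤ e₂ n := add_nonneg hh0 (hC2 _ he₁0)
  -- Three stages bring the starting level from order `n²` to `n^(3/2)`, to `n`, to `√n`. The
  -- constants `7` and `36` make `u n` exceed the level reached before, via `σ ≤ 2 n` and `σ² ≤ 4
  -- n`.
  have s₁ := stage (n + 1) (D * σ * (n + 1) + 1) (G n (n * n + 1))
    (hanti n (by nlinarith)) (hG0 _ _) (Nat.lt_succ_self _) σ
  have s₂ := stage (7 * D * σ) (D * σ * (7 * D * σ) + 1) (e₁ n)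
    ((hanti n (by
      have h1 : σ * (D * σ) ≤ 2 * n * (D * σ) := Nat.mul_le_mul_right _ hσn
      have h2 : D * σ * 1 ≤ D * σ * n := Nat.mul_le_mul_left _ hn1
      have h3 : 1 * 1 ≤ D * σ * n := Nat.mul_le_mul hDσ hn1
      nlinarith)).trans s₁) he₁0 (Nat.lt_succ_self _) σ
  have s₃ := stage (36 * D ^ 2) (D * σ * (36 * D ^ 2) + 1) (e₂ n)
    ((hanti n (by
      have h1 : D ^ 2 * (σ * σ) ≤ D ^ 2 * (4 * n) := Nat.mul_le_mul_left _ hσ2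
      have h2 : D * (σ * σ) ≤ D ^ 2 * (σ * σ) :=
        Nat.mul_le_mul_right _ (by nlinarith)
      have h3 : 1 * 1 ≤ D ^ 2 * (σ * σ) :=
        Nat.mul_le_mul (by nlinarith) (by nlinarith)
      nlinarith)).trans s₂) he₂0 (Nat.lt_succ_self _) J
  refine (hanti n ?_).trans s₃
  have h1 : 1 ≤ D ^ 3 * σ := Nat.mul_pos (pow_pos hD 3) hσ0
  have h2 : D * σ * (36 * D ^ 2) = 36 * (D ^ 3 * σ) := by ring
  rw [h2, mul_assoc 37]
  omega

end SAJSQ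

/-! ### The Halfin–Whitt regime and its constants. -/

namespace SAJSQ

open Asymptotics

variable {m : ℕ}

/-- Non-asymptotic form of the Halfin-Whitt scaling for the system with `n` servers. -/
structure Regime (μ : Fin (m + 1) → ℝ) (β c₀ c₁ δ : ℝ) (N : Fin (m + 1) → ℕ) (n : ℕ) (Λ : ℝ) :
    Prop where
  one_le : 1 ≤ n
  sum_eq : ∑ k, N k = n
  pools_pos : ∀ k, 0 < N k
  rate_pos : 0 < Λ
  rate_le : Λ ≤ n
  le_service : ∀ k, c₀ ≤ μ k
  service_le : ∀ k, μ k ≤ c₁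
  cap_le : ∑ k, μ k * N k ≤ 2 * n
  le_gap : β / 2 * √(n : ℝ) ≤ ∑ k, μ k * N k - Λ
  gap_le : ∑ k, μ k * N k - Λ ≤ 2 * β * √(n : ℝ)
  fast_le : ∀ j, j < Fin.last m → δ * n ≤ Λ - ∑ k ∈ Finset.Iic j, μ k * N k
  le_fastest : δ * n ≤ N 0

theorem eventually_regime {μ γ : Fin (m + 1) → ℝ} {β : ℝ} {lam : ℕ → ℝ}
    {N : ℕ → Fin (m + 1) → ℕ}
    (hμ_pos : ∀ j, 0 < μ j) (hμ_anti : StrictAnti μ)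
    (hγ_pos : ∀ j, 0 < γ j) (hcap : ∑ j, μ j * γ j = 1)
    (hβ : 0 < β) (hlam_pos : ∀ n, 0 < lam n) (hlam_lt : ∀ n, lam n < 1)
    (hN : ∀ n, ∑ j, N n j = n)
    (hA1 : Tendsto (fun n : ℕ => √(n : ℝ) * (1 - lam n)) atTop (𝓝 β))
    (hA2 : ∀ j, Tendsto (fun n : ℕ => √(n : ℝ) * |(N n j : ℝ) / (n : ℝ) - γ j|) atTop (𝓝 0)) :
    ∃ δ, 0 < δ ∧ ∀ᶠ n : ℕ in atTop,
      Regime μ β (μ (Fin.last m)) (μ 0) δ (N n) n (n * lam n) := by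
  have hM : 0 < μ (Fin.last m) * γ (Fin.last m) := mul_pos (hμ_pos _) (hγ_pos _)
  -- The slowest pool has capacity at least half its limit `μ γ n`, and the gap `C - Λ` eventually
  -- takes at most a quarter, leaving a quarter as margin for the fast pools.
  refine ⟨min (μ (Fin.last m) * γ (Fin.last m) / 4) (γ 0 / 2),
    lt_min (by linarith) (by linarith [hγ_pos 0]), ?_⟩
  have hA2' : ∀ j, Tendsto (fun n : ℕ => √(n : ℝ) * ((N n j : ℝ) / (n : ℝ) - γ j)) atTop (𝓝 0) := by
    intro j
    rw [tendsto_zero_iff_abs_tendsto_zero]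
    refine (hA2 j).congr fun n => ?_
    simp only [Function.comp_apply]
    rw [abs_mul, abs_of_nonneg (Real.sqrt_nonneg _)]
  have hsum : Tendsto (fun n : ℕ => √(n : ℝ) * (1 - lam n) +
      ∑ j, μ j * (√(n : ℝ) * ((N n j : ℝ) / (n : ℝ) - γ j))) atTop (𝓝 β) := by
    have := hA1.add (tendsto_finsetSum Finset.univ fun j _ => (hA2' j).const_mul (μ j))
    simpa using this
  have hsq : Tendsto (fun n : ℕ => √(n : ℝ)) atTop atTop :=
    Real.tendsto_sqrt_atTop.comp tendsto_natCast_atTop_atTop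
  have hγev : ∀ᶠ n : ℕ in atTop, ∀ j, √(n : ℝ) * |(N n j : ℝ) / (n : ℝ) - γ j| < γ j / 2 :=
    eventually_all.2 fun j => (hA2 j).eventually_lt_const (by linarith [hγ_pos j])
  filter_upwards [eventually_ge_atTop 1, hγev, hsum.eventually_lt_const (show β < 2 * β by linarith),
    hsum.eventually_const_lt (show β / 2 < β by linarith),
    hsq.eventually_ge_atTop (2 * β),
    hsq.eventually_ge_atTop (8 * β / (μ (Fin.last m) * γ (Fin.last m)))]
    with n hn hNγ hup hlo hs1 hs2
  have hn0 : (0 : ℝ) < n := by exact_mod_cast hn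
  have hsn : √(n : ℝ) * √(n : ℝ) = n := Real.mul_self_sqrt hn0.le
  have hs0 : 1 ≤ √(n : ℝ) := Real.one_le_sqrt.2 (by exact_mod_cast hn)
  have hNlow : ∀ j, γ j / 2 * n ≤ N n j := by
    intro j
    have h1 : |(N n j : ℝ) / n - γ j| < γ j / 2 := by
      refine lt_of_le_of_lt ?_ (hNγ j)
      exact le_mul_of_one_le_left (abs_nonneg _) hs0
    have h2 : γ j / 2 ≤ (N n j : ℝ) / n := by linarith [(abs_lt.1 h1).1]
    rwa [le_div_iff₀ hn0] at h2
  -- By the normalization `hcap`, the gap divided by `√n` is exactly the quantity shown above to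
  -- converge to `β`.
  have hgap : ∑ k, μ k * (N n k : ℝ) - n * lam n = √(n : ℝ) * (√(n : ℝ) * (1 - lam n) +
      ∑ j, μ j * (√(n : ℝ) * ((N n j : ℝ) / (n : ℝ) - γ j))) := by
    rw [mul_add, ← mul_assoc, hsn, Finset.mul_sum]
    have h1 : ∀ j, √(n : ℝ) * (μ j * (√(n : ℝ) * ((N n j : ℝ) / (n : ℝ) - γ j))) =
        μ j * N n j - n * (μ j * γ j) := by
      intro j
      have h2 : √(n : ℝ) * (μ j * (√(n : ℝ) * ((N n j : ℝ) / (n : ℝ) - γ j))) =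
        μ j * ((√(n : ℝ) * √(n : ℝ)) * ((N n j : ℝ) / (n : ℝ) - γ j)) := by ring
      rw [h2, hsn, mul_sub, mul_div_cancel₀ _ hn0.ne']
      ring
    simp_rw [h1]
    rw [Finset.sum_sub_distrib, ← Finset.mul_sum, hcap]
    ring
  have hup' : ∑ k, μ k * (N n k : ℝ) - n * lam n ≤ 2 * β * √(n : ℝ) := by
    rw [hgap, mul_comm]
    exact mul_le_mul_of_nonneg_right hup.le (Real.sqrt_nonneg _)
  have hΛle : n * lam n ≤ n := mul_le_of_le_one_right hn0.le (hlam_lt n).le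
  refine ⟨hn, hN n, fun k => ?_, mul_pos hn0 (hlam_pos n), hΛle,
    fun k => hμ_anti.antitone (Fin.le_last k), fun k => hμ_anti.antitone (Fin.zero_le k),
    ?_, ?_, hup', fun j hj => ?_, ?_⟩
  · have h1 : 0 < γ k / 2 * n := mul_pos (by linarith [hγ_pos k]) hn0
    exact_mod_cast h1.trans_le (hNlow k)
  · have : 2 * β * √(n : ℝ) ≤ n := by
      calc 2 * β * √(n : ℝ) ≤ √(n : ℝ) * √(n : ℝ) :=
            mul_le_mul_of_nonneg_right hs1 (Real.sqrt_nonneg _)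
        _ = n := hsn
    linarith
  · rw [hgap, mul_comm]
    exact mul_le_mul_of_nonneg_left hlo.le (Real.sqrt_nonneg _)
  · have h1 : ∑ k ∈ Finset.Iic j, μ k * (N n k : ℝ) + μ (Fin.last m) * N n (Fin.last m) ≤
        ∑ k, μ k * (N n k : ℝ) := by
      have h2 : Fin.last m ∉ Finset.Iic j := fun h => absurd (Finset.mem_Iic.1 h) (not_le.2 hj)
      rw [add_comm, ← Finset.sum_insert (f := fun k => μ k * (N n k : ℝ)) h2]
      exact Finset.sum_le_sum_of_subset_of_nonneg (Finset.subset_univ _)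
        fun k _ _ => mul_nonneg (hμ_pos k).le (Nat.cast_nonneg _)
    have h3 := mul_le_mul_of_nonneg_left (hNlow (Fin.last m)) (hμ_pos (Fin.last m)).le
    have h4 : 2 * β * √(n : ℝ) ≤ μ (Fin.last m) * γ (Fin.last m) / 4 * n := by
      rw [div_le_iff₀ hM] at hs2
      have := mul_le_mul_of_nonneg_right hs2 (Real.sqrt_nonneg (n : ℝ))
      have h5 : √(n : ℝ) * (μ (Fin.last m) * γ (Fin.last m)) * √(n : ℝ) =
        μ (Fin.last m) * γ (Fin.last m) * (√(n : ℝ) * √(n : ℝ)) := by ring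
      rw [h5, hsn] at this
      linarith
    have h5 := mul_le_mul_of_nonneg_right
      (min_le_left (μ (Fin.last m) * γ (Fin.last m) / 4) (γ 0 / 2)) hn0.le
    linarith
  · refine (mul_le_mul_of_nonneg_right (min_le_right _ _) hn0.le).trans (hNlow 0)

section Tail

variable {β c₀ c₁ δ : ℝ} {μ : Fin (m + 1) → ℝ}

theorem Regime.const_le {N : Fin (m + 1) → ℕ} {n : ℕ} {Λ : ℝ} (hc₀ : 0 < c₀) (hβ : 0 < β)
    (hR : Regime μ β c₀ c₁ δ N n Λ) :
    Λ + ∑ k, μ k * N k + (∑ k, μ k * N k - Λ) ^ 2 / c₀ ≤ (3 + 4 * β ^ 2 / c₀) * n := by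
  have hsn : √(n : ℝ) ^ 2 = n := Real.sq_sqrt (Nat.cast_nonneg n)
  have h0 : 0 ≤ ∑ k, μ k * N k - Λ := le_trans (by positivity) hR.le_gap
  have h1 : (∑ k, μ k * N k - Λ) ^ 2 ≤ (2 * β * √(n : ℝ)) ^ 2 := by
    gcongr
    exact hR.gap_le
  have h2 : (∑ k, μ k * N k - Λ) ^ 2 / c₀ ≤ (2 * β * √(n : ℝ)) ^ 2 / c₀ := by gcongr
  have h3 : (2 * β * √(n : ℝ)) ^ 2 / c₀ = 4 * β ^ 2 / c₀ * n := by
    rw [mul_pow, hsn]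
    ring
  have := hR.rate_le
  have := hR.cap_le
  linarith

theorem sqrt_le_natSqrt_succ (n : ℕ) : √(n : ℝ) ≤ ((n.sqrt + 1 : ℕ) : ℝ) := by
  push_cast
  exact Real.real_sqrt_le_nat_sqrt_succ

theorem natSqrt_succ_le {n : ℕ} (hn : 1 ≤ n) : ((n.sqrt + 1 : ℕ) : ℝ) ≤ 2 * √(n : ℝ) := by
  push_cast
  have h1 : (n.sqrt : ℝ) ≤ √(n : ℝ) := Real.nat_sqrt_le_real_sqrt
  have h2 : 1 ≤ √(n : ℝ) := Real.one_le_sqrt.2 (by exact_mod_cast hn)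
  linarith

theorem exists_recursion (hβ : 0 < β) (hc₀ : 0 < c₀) (hc₁ : 0 < c₁) :
    ∃ (D : ℕ) (C : ℝ), 0 < D ∧ 0 ≤ C ∧ ∀ (N : Fin (m + 1) → ℕ) (n : ℕ) (Λ : ℝ)
      (π : PMF (State N)), Regime μ β c₀ c₁ δ N n Λ → DriftBound Λ μ π →
      ∀ z u, D * (n.sqrt + 1) * u < z → excessProb π (z + D * (n.sqrt + 1)) ≤
        1 / 2 * excessProb π z + C * (n : ℝ) ^ 2 * excessProb π (u * n) := by
  set K := 3 + 4 * β ^ 2 / c₀ with hK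
  have hK0 : 0 < K := by positivity
  -- With `t = h' = s = A σ`, the second entry meets the requirement on `s` and the third brings the
  -- coefficient of the recursion below half the gap. The step `3 A σ` covers `h' + 1 + s`.
  obtain ⟨A, hA⟩ := exists_nat_ge (max 1 (max (2 * K / c₀) (4 * (c₁ * K / c₀ + 2) / β)))
  have hA1 : (1 : ℝ) ≤ A := (le_max_left _ _).trans hA
  have hA2 : 2 * K / c₀ ≤ A := ((le_max_left _ _).trans (le_max_right _ _)).trans hA
  have hA3 : 4 * (c₁ * K / c₀ + 2) / β ≤ A := ((le_max_right _ _).trans (le_max_right _ _)).trans hA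
  have hA0 : 0 < A := by exact_mod_cast (show (0 : ℝ) < A by linarith)
  refine ⟨3 * A, 4 * c₁ * (m + 1) / (c₀ * β), by omega, by positivity, ?_⟩
  intro N n Λ π hR hπ z u hzu
  set σ := n.sqrt + 1 with hσ
  have hσ0 : 0 < σ := Nat.succ_pos _
  have hσA : 0 < A * σ := Nat.mul_pos hA0 hσ0
  have hn0 : (0 : ℝ) < n := by exact_mod_cast hR.one_le
  have hsn : √(n : ℝ) * √(n : ℝ) = n := Real.mul_self_sqrt hn0.le
  have hsσ : √(n : ℝ) ≤ (σ : ℝ) := sqrt_le_natSqrt_succ n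
  have hs1 : 1 ≤ √(n : ℝ) := Real.one_le_sqrt.2 (by exact_mod_cast hR.one_le)
  have hσ' : (0 : ℝ) < σ := Nat.cast_pos.2 hσ0
  have hA' : (0 : ℝ) < A := by linarith
  have hKn := hR.const_le hc₀ hβ
  rw [← hK] at hKn
  set b := ∑ k, μ k * (N k : ℝ) - Λ with hb
  have hblo := hR.le_gap
  have hb1 : β / 2 ≤ b := le_trans (le_mul_of_one_le_right (by positivity) hs1) hblo
  have hb0 : 0 < b := lt_of_lt_of_le (by positivity) hb1
  have hnσ : (n : ℝ) ≤ √(n : ℝ) * σ := by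
    calc (n : ℝ) = √(n : ℝ) * √(n : ℝ) := hsn.symm
      _ ≤ _ := mul_le_mul_of_nonneg_left hsσ (Real.sqrt_nonneg _)
  have hσ2 : (n : ℝ) ≤ (σ : ℝ) ^ 2 := by nlinarith
  have key := hπ.excessProb_add_le hR.rate_pos.le hc₀ hR.le_service hR.service_le
    (hR.pools_pos 0) (by linarith) z u (A * σ) (A * σ) (A * σ) hσA hσA
    (by
      refine lt_of_le_of_lt ?_ hzu
      exact Nat.mul_le_mul_right u (by nlinarith)) hσA (by
      push_cast
      have h1 : 2 * K ≤ c₀ * A := by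
        rw [div_le_iff₀ hc₀] at hA2
        linarith
      have h2 : (A : ℝ) ≤ A ^ 2 := by nlinarith
      calc 2 * (Λ + ∑ k, μ k * (N k : ℝ) + (∑ k, μ k * (N k : ℝ) - Λ) ^ 2 / c₀)
          ≤ 2 * (K * n) := by linarith
        _ = 2 * K * n := by ring
        _ ≤ c₀ * A ^ 2 * (σ : ℝ) ^ 2 := by
          refine mul_le_mul (h1.trans (mul_le_mul_of_nonneg_left h2 hc₀.le)) hσ2 hn0.le
            (by positivity)
        _ = _ := by ring)
  rw [hR.sum_eq, ← hb] at key
  have hmono : excessProb π (z + 3 * A * σ) ≤ excessProb π (z + A * σ + 1 + A * σ) :=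
    excessProb_antitone π (by
      have : 3 * A * σ = A * σ + A * σ + A * σ := by ring
      omega)
  have hG0 := excessProb_nonneg π z
  have hGu := excessProb_nonneg π (u * n)
  have hcoef : c₁ * (Λ + ∑ k, μ k * (N k : ℝ) + b ^ 2 / c₀) / (c₀ * (A * σ : ℕ)) +
      2 * Λ / (A * σ : ℕ) ≤ b / 2 := by
    push_cast
    have h1 : c₁ * (Λ + ∑ k, μ k * (N k : ℝ) + b ^ 2 / c₀) / (c₀ * (A * σ)) ≤
        c₁ * (K * n) / (c₀ * (A * σ)) := by gcongr
    have h2 : 2 * Λ / ((A : ℝ) * σ) ≤ 2 * n / (A * σ) := by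
      have := hR.rate_le
      gcongr
    have h3 : c₁ * (K * n) / (c₀ * (A * σ)) + 2 * n / (A * σ) =
        (c₁ * K / c₀ + 2) / A * (n / σ) := by
      field_simp
    have h4 : (n : ℝ) / σ ≤ √(n : ℝ) := by rwa [div_le_iff₀ hσ']
    have h5 : (c₁ * K / c₀ + 2) / A ≤ β / 4 := by
      rw [div_le_iff₀ hβ] at hA3
      rw [div_le_iff₀ hA']
      linarith
    have h6 : (c₁ * K / c₀ + 2) / A * (n / σ) ≤ β / 4 * √(n : ℝ) :=
      mul_le_mul h5 h4 (by positivity) (by positivity)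
    linarith
  have h1 := mul_le_mul_of_nonneg_right hcoef hG0
  have h2 : 2 * c₁ * (n : ℝ) * ((m + 1) * (Λ / c₀) * excessProb π (u * n)) ≤
      b * (4 * c₁ * (m + 1) / (c₀ * β) * (n : ℝ) ^ 2 * excessProb π (u * n)) := by
    have h3 : Λ / c₀ ≤ n / c₀ := by
      have := hR.rate_le
      gcongr
    calc 2 * c₁ * (n : ℝ) * ((m + 1) * (Λ / c₀) * excessProb π (u * n))
        ≤ 2 * c₁ * (n : ℝ) * ((m + 1) * (n / c₀) * excessProb π (u * n)) := by gcongr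
      _ = β / 2 * (4 * c₁ * (m + 1) / (c₀ * β) * (n : ℝ) ^ 2 * excessProb π (u * n)) := by
        field_simp
        ring
      _ ≤ _ := mul_le_mul_of_nonneg_right hb1 (by positivity)
  refine hmono.trans (le_of_mul_le_mul_left ?_ hb0)
  have h3 : b * (1 / 2 * excessProb π z + 4 * c₁ * (m + 1) / (c₀ * β) * (n : ℝ) ^ 2 *
      excessProb π (u * n)) = b / 2 * excessProb π z +
      b * (4 * c₁ * (m + 1) / (c₀ * β) * (n : ℝ) ^ 2 * excessProb π (u * n)) := by ring
  rw [h3]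
  exact key.trans (add_le_add h1 h2)

/-- The exponential Lyapunov bound with `r - 1` equal to half the relative gap, hence at least of
order `1 / √n`. The prefactor costs a power of `n`, while `r ^ n` is exponentially large in `√n`. -/
theorem excessProb_sq_le (hβ : 0 < β) (hc₀ : 0 < c₀) {N : Fin (m + 1) → ℕ} {n : ℕ} {Λ : ℝ}
    {π : PMF (State N)} (hR : Regime μ β c₀ c₁ δ N n Λ) (hπ : DriftBound Λ μ π) :
    excessProb π (n * n + 1) ≤
      64 / (β ^ 2 * c₀) * ((n : ℝ) ^ 2 * ((1 + β / 16)⁻¹) ^ n.sqrt) := by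
  have hn0 : (0 : ℝ) < n := by exact_mod_cast hR.one_le
  have hsn : √(n : ℝ) * √(n : ℝ) = n := Real.mul_self_sqrt hn0.le
  have hs0 : 0 < √(n : ℝ) := Real.sqrt_pos.2 hn0
  set C := ∑ k, μ k * (N k : ℝ) with hC
  have hgap := hR.le_gap
  have hgap0 : 0 < β / 2 * √(n : ℝ) := by positivity
  have hCpos : 0 < C := by linarith [hR.rate_pos]
  set ε := (C - Λ) / C with hε
  have hε1 : Λ / C = 1 - ε := by
    rw [hε]
    field_simp
    ring
  have hεlo : β / (4 * √(n : ℝ)) ≤ ε := by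
    rw [hε, div_le_div_iff₀ (by positivity) hCpos]
    have h1 : β * C ≤ β * (2 * n) := mul_le_mul_of_nonneg_left hR.cap_le hβ.le
    have h2 : β / 2 * √(n : ℝ) * (4 * √(n : ℝ)) ≤ (C - Λ) * (4 * √(n : ℝ)) :=
      mul_le_mul_of_nonneg_right hgap (by positivity)
    have h3 : β / 2 * √(n : ℝ) * (4 * √(n : ℝ)) = 2 * β * (√(n : ℝ) * √(n : ℝ)) := by ring
    rw [h3, hsn] at h2
    linarith
  have hε0 : 0 < ε := lt_of_lt_of_le (by positivity) hεlo
  have hΛC : Λ = C * (1 - ε) := by rw [← hε1]; field_simp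
  set r := 1 + ε / 2 with hr
  have hr1 : 1 < r := by linarith
  have hrΛ : Λ * r ≤ C := by
    rw [hΛC, hr, mul_assoc]
    refine mul_le_of_le_one_right hCpos.le ?_
    nlinarith
  have key := hπ.pow_mul_excessProb_le hR.rate_pos.le hc₀ hR.le_service hR.pools_pos hr1
    hrΛ n
  rw [hR.sum_eq, ← hC, hε1] at key
  have hinv : 1 - ε / 2 ≤ r⁻¹ := by
    rw [← one_div, le_div_iff₀ (by linarith), hr]
    nlinarith [sq_nonneg ε]
  have hκ : β ^ 2 * c₀ / (64 * n) ≤ (r - 1) * (r⁻¹ - (1 - ε)) * c₀ := by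
    have h1 : ε / 2 * (ε / 2) ≤ (r - 1) * (r⁻¹ - (1 - ε)) :=
      mul_le_mul (by linarith) (by linarith) (by linarith) (by linarith)
    have h2 : β / (4 * √(n : ℝ)) / 2 * (β / (4 * √(n : ℝ)) / 2) ≤ ε / 2 * (ε / 2) := by gcongr
    have h3 : β / (4 * √(n : ℝ)) / 2 * (β / (4 * √(n : ℝ)) / 2) =
        β ^ 2 / (64 * (√(n : ℝ) * √(n : ℝ))) := by
      field_simp
      norm_num
    rw [h3, hsn] at h2
    calc β ^ 2 * c₀ / (64 * n) = β ^ 2 / (64 * n) * c₀ := by ring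
      _ ≤ _ := mul_le_mul_of_nonneg_right (h2.trans h1) hc₀.le
  have hpow : (1 + β / 16) ^ n.sqrt ≤ r ^ n := by
    have h1 : 1 ≤ n.sqrt := Nat.le_sqrt.2 (by have := hR.one_le; omega)
    have h2 : √(n : ℝ) ≤ 2 * n.sqrt := by
      have h3 : √(n : ℝ) ≤ n.sqrt + 1 := Real.real_sqrt_le_nat_sqrt_succ
      have h4 : (1 : ℝ) ≤ n.sqrt := by exact_mod_cast h1
      linarith
    have h3 : 1 + β / 16 ≤ r ^ n.sqrt := by
      refine le_trans ?_ (one_add_mul_le_pow (by linarith : (-2 : ℝ) ≤ ε / 2) n.sqrt)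
      have h4 : √(n : ℝ) / 2 * (β / (4 * √(n : ℝ)) / 2) ≤ n.sqrt * (ε / 2) :=
        mul_le_mul (by linarith) (by linarith) (by positivity) (by positivity)
      have h5 : √(n : ℝ) / 2 * (β / (4 * √(n : ℝ)) / 2) = β / 16 := by
        field_simp
        norm_num
      linarith
    calc (1 + β / 16) ^ n.sqrt ≤ (r ^ n.sqrt) ^ n.sqrt := by gcongr
      _ = r ^ (n.sqrt * n.sqrt) := (pow_mul _ _ _).symm
      _ ≤ r ^ n := pow_le_pow_right₀ hr1.le (Nat.sqrt_le n)
  have hG0 := excessProb_nonneg π (n * n + 1)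
  have h1 : β ^ 2 * c₀ / (64 * n) * (1 + β / 16) ^ n.sqrt * excessProb π (n * n + 1) ≤ n := by
    refine le_trans ?_ (key.trans hR.rate_le)
    gcongr
    exact (by positivity : (0 : ℝ) ≤ β ^ 2 * c₀ / (64 * n)).trans hκ
  have h2 : 0 < β ^ 2 * c₀ / (64 * n) * (1 + β / 16) ^ n.sqrt := by positivity
  rw [mul_comm, ← le_div_iff₀ h2] at h1
  refine h1.trans (le_of_eq ?_)
  rw [inv_pow]
  field_simp

end Tail

end SAJSQ

/-! ### First moments of the occupancies. -/

namespace SAJSQ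

open Asymptotics

variable {m : ℕ} {β c₀ c₁ δ : ℝ} {μ : Fin (m + 1) → ℝ}

/-- A discrete layer-cake bound; the cap `a + T * d` keeps the sum finite, so the additive error in
the tail bound is summed only `T` times. -/
theorem min_le_sum_ite (y x a d T : ℕ) (hyx : y ≤ x) :
    min y (a + T * d) ≤ a + d * ∑ J ∈ Finset.range T, if a + J * d ≤ x then 1 else 0 := by
  induction T with
  | zero => simp
  | succ T ih =>
    rw [Finset.sum_range_succ, mul_add]
    by_cases h : a + T * d ≤ y
    · rw [if_pos (h.trans hyx), mul_one]
      rw [min_eq_right h] at ih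
      refine (min_le_right _ _).trans ?_
      rw [Nat.succ_mul]
      omega
    · refine (min_le_left _ _).trans ?_
      rw [min_eq_left (by omega)] at ih
      omega

theorem mean_occ_le_of_tail {N : Fin (m + 1) → ℕ} (π : PMF (State N)) {a d n : ℕ} {η : ℝ}
    (hd : 0 < d) (hn : ∑ k, N k = n)
    (h : ∀ J, excessProb π (a + J * d) ≤ (1 / 2) ^ J + η) (j : Fin (m + 1)) :
    ∫ q, (q.occ j 2 : ℝ) ∂π.toMeasure ≤ a + d * (2 + n * η) := by
  have hb : ∃ B, ∀ q : State N, |∑ J ∈ Finset.range n,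
      (if a + J * d ≤ q.excess then (1 : ℝ) else 0)| ≤ B := by
    refine ⟨∑ J ∈ Finset.range n, 1, fun q => (Finset.abs_sum_le_sum_abs _ _).trans
      (Finset.sum_le_sum fun J _ => ?_)⟩
    split_ifs <;> simp
  have h1 : ∫ q, (q.occ j 2 : ℝ) ∂π.toMeasure ≤ ∫ q, ((a : ℝ) + d * ∑ J ∈ Finset.range n,
      (if a + J * d ≤ q.excess then (1 : ℝ) else 0)) ∂π.toMeasure := by
    refine mean_mono π (bdd_occ j 2) (bdd_add (bdd_const _) (bdd_const_mul _ hb)) fun q => ?_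
    have h2 : q.occ j 2 ≤ q.excess := (q.occ_le_tail j 2).trans
      (Finset.single_le_sum (f := fun k => q.tail k 2) (fun _ _ => Nat.zero_le _)
        (Finset.mem_univ j))
    have h3 : q.occ j 2 ≤ a + n * d := by
      have h4 : N j ≤ n := by
        rw [← hn]
        exact Finset.single_le_sum (f := N) (fun _ _ => Nat.zero_le _) (Finset.mem_univ j)
      have h5 : n * 1 ≤ n * d := Nat.mul_le_mul_left n hd
      have := q.occ_le j 2
      omega
    have h4 := min_le_sum_ite (q.occ j 2) q.excess a d n h2
    rw [min_eq_left h3] at h4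
    exact_mod_cast h4
  refine h1.trans ?_
  rw [integral_add (integrable_of_bdd π (bdd_const _)) (integrable_of_bdd π (bdd_const_mul _ hb)),
    integral_const_mul, integral_finsetSum _ fun J _ => integrable_of_bdd π (bdd_ite _)]
  have h2 : ∫ _q : State N, (a : ℝ) ∂π.toMeasure = a := by simp
  rw [h2]
  refine add_le_add le_rfl (mul_le_mul_of_nonneg_left ?_ (Nat.cast_nonneg _))
  refine (Finset.sum_le_sum fun J _ => h J).trans ?_
  rw [Finset.sum_add_distrib]
  refine add_le_add ?_ (by simp)
  exact (summable_geometric_two.sum_le_tsum _ fun J _ => by positivity).trans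
    tsum_geometric_two.le

theorem exists_moment_bounds (hβ : 0 < β) (hc₀ : 0 < c₀) (hc₁ : 0 < c₁) (hδ : 0 < δ)
    {N : ℕ → Fin (m + 1) → ℕ} {Λ : ℕ → ℝ} (π : ∀ n, PMF (State (N n)))
    (hR : ∀ᶠ n in atTop, Regime μ β c₀ c₁ δ (N n) n (Λ n))
    (hπ : ∀ᶠ n in atTop, DriftBound (Λ n) μ (π n)) :
    ∃ C : ℝ, 0 < C ∧ ∀ᶠ n : ℕ in atTop,
      (∀ j, j < Fin.last m → ∫ q, ((N n j : ℝ) - q.occ j 1) ∂(π n).toMeasure ≤ C) ∧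
      ∫ q, ((N n (Fin.last m) : ℝ) - q.occ (Fin.last m) 1) ∂(π n).toMeasure ≤ C * √(n : ℝ) ∧
      ∫ q, (q.occ 0 2 : ℝ) ∂(π n).toMeasure ≤ C * √(n : ℝ) ∧
      ∀ j i, ((0 < j ∧ i = 2) ∨ 3 ≤ i) → ∫ q, (q.occ j i : ℝ) ∂(π n).toMeasure ≤ C := by
  obtain ⟨D, C, hD, hC, hrec⟩ := exists_recursion (m := m) (μ := μ) (δ := δ) hβ hc₀ hc₁
  have hcrude : SuperpolynomialDecay atTop (fun n : ℕ => (n : ℝ))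
      fun n => excessProb (π n) (n * n + 1) := by
    have h1 : SuperpolynomialDecay atTop (fun n : ℕ => (n : ℝ))
        fun n : ℕ => ((1 + β / 16)⁻¹) ^ n.sqrt :=
      superpolynomialDecay_pow_comp (M := 1) (p := 2) (by positivity)
        (inv_lt_one_of_one_lt₀ (by linarith)) fun n => by
          have := Nat.lt_succ_sqrt n
          simp only [Nat.succ_eq_add_one] at this
          nlinarith
    refine ((h1.param_pow_mul 2).const_mul (64 / (β ^ 2 * c₀))).trans_eventually_abs_le ?_
    filter_upwards [hR, hπ] with n hn hn'
    simp only [Function.comp_apply]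
    rw [abs_of_nonneg (excessProb_nonneg _ _)]
    exact (excessProb_sq_le hβ hc₀ hn hn').trans (le_abs_self _)
  obtain ⟨E, e, he, hE⟩ := exists_tail_bound (G := fun n z => excessProb (π n) z) hD hC
    (fun n z => excessProb_nonneg _ z) (fun n z => excessProb_le_one _ z)
    (fun n => excessProb_antitone _)
    (by
      filter_upwards [hR, hπ] with n hn hn'
      exact hrec (N n) n (Λ n) (π n) hn hn') hcrude
  -- Then `n.sqrt / M` steps of length `D σ` cover at most `δ n / 2`; together with the offset `E σ`
  -- they stay below `N n 0`.
  obtain ⟨M, hM⟩ := exists_nat_gt (4 * D / δ)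
  have hM0 : 0 < M := by
    have : (0 : ℝ) < M := lt_of_le_of_lt (by positivity) hM
    exact_mod_cast this
  have hhalf : SuperpolynomialDecay atTop (fun n : ℕ => (n : ℝ))
      fun n : ℕ => (1 / 2 : ℝ) ^ (n.sqrt / M) :=
    superpolynomialDecay_pow_comp (M := M ^ 2) (p := 2) (by norm_num) (by norm_num) fun n => by
      have h1 := Nat.lt_succ_sqrt n
      simp only [Nat.succ_eq_add_one] at h1
      have h2 : n.sqrt < M * (n.sqrt / M + 1) := Nat.lt_mul_div_succ _ hM0
      have h3 : (n.sqrt + 1) * (n.sqrt + 1) ≤ M * (n.sqrt / M + 1) * (M * (n.sqrt / M + 1)) :=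
        Nat.mul_le_mul h2 h2
      nlinarith
  have he1 := he 1
  have hhe1 := (hhalf.add he) 1
  simp only [pow_one, Pi.add_apply] at he1 hhe1
  have hsq : Tendsto (fun n : ℕ => √(n : ℝ)) atTop atTop :=
    Real.tendsto_sqrt_atTop.comp tendsto_natCast_atTop_atTop
  set K := 3 + 4 * β ^ 2 / c₀ with hK
  have hK0 : 0 < K := by positivity
  refine ⟨3 / (2 * δ) + (1 + K / c₀) + 2 * (E + 3 * D) + 1 / c₀, by positivity, ?_⟩
  filter_upwards [hR, hπ, hE, he1.eventually_le_const (show (0 : ℝ) < 1 by norm_num),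
    hhe1.eventually_le_const (show (0 : ℝ) < 1 by norm_num),
    hsq.eventually_ge_atTop (4 * E / δ)] with n hn hn' hEn hen hhen hsn
  have hn0 : (0 : ℝ) < n := by exact_mod_cast hn.one_le
  have hss : √(n : ℝ) * √(n : ℝ) = n := Real.mul_self_sqrt hn0.le
  have hs0 : 0 < √(n : ℝ) := Real.sqrt_pos.2 hn0
  have hs1 : 1 ≤ √(n : ℝ) := Real.one_le_sqrt.2 (by exact_mod_cast hn.one_le)
  have hμ0 : ∀ k, 0 ≤ μ k := fun k => hc₀.le.trans (hn.le_service k)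
  set σ := n.sqrt + 1 with hσ
  have hσ0 : 0 < σ := Nat.succ_pos _
  have hσ2 : (σ : ℝ) ≤ 2 * √(n : ℝ) := natSqrt_succ_le hn.one_le
  have hC1 : 0 < 3 / (2 * δ) := by positivity
  have hC2 : 0 < K / c₀ := by positivity
  have hC3 : (0 : ℝ) ≤ 2 * (E + 3 * D) := by positivity
  have hC4 : 0 < 1 / c₀ := by positivity
  have bI : ∀ j, ∃ B, ∀ q : State (N n), |(N n j : ℝ) - q.occ j 1| ≤ B := fun j =>
    ⟨N n j, fun q => by
      have h1 : (q.occ j 1 : ℝ) ≤ N n j := Nat.cast_le.2 (q.occ_le j 1)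
      have h2 : (0 : ℝ) ≤ q.occ j 1 := Nat.cast_nonneg _
      rw [abs_of_nonneg (by linarith)]
      linarith⟩
  have hidle : ∀ (s : Finset (Fin (m + 1))) j, j ∈ s → ∀ q : State (N n),
      (N n j : ℝ) - q.occ j 1 ≤ q.idle s := by
    intro s j hj q
    rw [q.cast_idle]
    exact Finset.single_le_sum (f := fun k => (N n k : ℝ) - q.occ k 1)
      (fun k _ => sub_nonneg.2 (Nat.cast_le.2 (q.occ_le k 1))) hj
  refine ⟨fun j hj => ?_, ?_, ?_, fun j i hji => ?_⟩
  · have h1 := hn'.mean_idle_le hn.rate_pos.le hμ0 (hn.pools_pos 0) (s := Finset.Iic j)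
      fun a ha b hb => Finset.mem_Iic.2 (hb.trans (Finset.mem_Iic.1 ha))
    have h2 := hn.fast_le j hj
    have h3 : ∑ k ∈ Finset.Iic j, μ k * (N n k : ℝ) ≤ 2 * n :=
      (Finset.sum_le_sum_of_subset_of_nonneg (Finset.subset_univ _)
        fun k _ _ => mul_nonneg (hμ0 k) (Nat.cast_nonneg _)).trans hn.cap_le
    have h4 : 0 ≤ ∫ q, (q.idle (Finset.Iic j) : ℝ) ∂(π n).toMeasure :=
      integral_nonneg fun q => Nat.cast_nonneg _
    have h5 := mul_le_mul_of_nonneg_right h2 h4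
    have h6 : ∫ q, (q.idle (Finset.Iic j) : ℝ) ∂(π n).toMeasure ≤ 3 / (2 * δ) := by
      rw [le_div_iff₀ (by positivity)]
      have h7 : (n : ℝ) * ((∫ q, (q.idle (Finset.Iic j) : ℝ) ∂(π n).toMeasure) * (2 * δ)) ≤
          n * 3 := by
        have := hn.rate_le
        nlinarith
      exact le_of_mul_le_mul_left h7 hn0
    have h7 := mean_mono (π n) (bI j) (bdd_idle (Finset.Iic j))
      (hidle (Finset.Iic j) j (Finset.mem_Iic.2 le_rfl))
    linarith
  · have h1 := hn'.mean_idle_sq_le hn.rate_pos.le hc₀ hn.le_service (hn.pools_pos 0) 0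
    rw [excessProb_zero, mul_one] at h1
    have h2 := h1.trans (hn.const_le hc₀ hβ)
    rw [← hK] at h2
    have bH : ∃ B, ∀ q : State (N n), |(if 0 ≤ q.excess then (1 : ℝ) else 0) *
        (c₀ * (q.idle Finset.univ : ℝ) ^ 2 + 2 * c₀ * (q.idle Finset.univ * q.busy₂))| ≤ B := by
      refine bdd_mul (bdd_ite _) (bdd_add (bdd_const_mul _ ?_) (bdd_const_mul _
        (bdd_mul (bdd_idle _) bdd_busy₂)))
      simp_rw [pow_two]
      exact bdd_mul (bdd_idle _) (bdd_idle _)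
    -- Uses `I ≤ √n + I² / √n` to pass from the second moment, of order `n`, to the first.
    have h3 : ∫ q, ((N n (Fin.last m) : ℝ) - q.occ (Fin.last m) 1) ∂(π n).toMeasure ≤
        ∫ q, (√(n : ℝ) + (c₀ * √(n : ℝ))⁻¹ * ((if 0 ≤ q.excess then (1 : ℝ) else 0) *
        (c₀ * (q.idle Finset.univ : ℝ) ^ 2 + 2 * c₀ * (q.idle Finset.univ * q.busy₂))))
        ∂(π n).toMeasure := by
      refine mean_mono (π n) (bI _) (bdd_add (bdd_const _) (bdd_const_mul _ bH)) fun q => ?_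
      refine (hidle Finset.univ _ (Finset.mem_univ _) q).trans ?_
      rw [if_pos (Nat.zero_le _), one_mul]
      have hI0 : (0 : ℝ) ≤ q.idle Finset.univ := Nat.cast_nonneg _
      have hB0 : (0 : ℝ) ≤ q.busy₂ := Nat.cast_nonneg _
      rw [← sub_le_iff_le_add', le_inv_mul_iff₀ (by positivity)]
      have h4 : (0 : ℝ) ≤ 2 * c₀ * (q.idle Finset.univ * q.busy₂) := by positivity
      have h5 : √(n : ℝ) * ((q.idle Finset.univ : ℝ) - √(n : ℝ)) ≤ (q.idle Finset.univ : ℝ) ^ 2 := by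
        nlinarith [sq_nonneg ((q.idle Finset.univ : ℝ) - √(n : ℝ))]
      have h6 := mul_le_mul_of_nonneg_left h5 hc₀.le
      linarith
    rw [integral_add (integrable_of_bdd _ (bdd_const _)) (integrable_of_bdd _ (bdd_const_mul _ bH)),
      integral_const_mul] at h3
    have h4 : ∫ _q : State (N n), √(n : ℝ) ∂(π n).toMeasure = √(n : ℝ) := by simp
    rw [h4] at h3
    have h5 := mul_le_mul_of_nonneg_left h2 (inv_pos.2 (show 0 < c₀ * √(n : ℝ) by positivity)).le
    have h6 : (c₀ * √(n : ℝ))⁻¹ * (K * n) = K / c₀ * √(n : ℝ) := by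
      rw [inv_mul_eq_iff_eq_mul₀ (by positivity)]
      have h7 : c₀ * √(n : ℝ) * (K / c₀ * √(n : ℝ)) = K * (√(n : ℝ) * √(n : ℝ)) := by
        field_simp
      rw [h7, hss]
    have h7 : (1 + K / c₀) * √(n : ℝ) ≤
        (3 / (2 * δ) + (1 + K / c₀) + 2 * (E + 3 * D) + 1 / c₀) * √(n : ℝ) :=
      mul_le_mul_of_nonneg_right (by linarith) hs0.le
    linarith
  · have h1 := mean_occ_le_of_tail (π n) (Nat.mul_pos hD hσ0) hn.sum_eq hEn 0
    push_cast at h1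
    have h2 : (E * (σ : ℝ) + D * σ * (2 + n * e n)) ≤ 2 * (E + 3 * D) * √(n : ℝ) := by
      have h3 : (D * σ : ℝ) * (2 + n * e n) ≤ D * σ * 3 :=
        mul_le_mul_of_nonneg_left (by linarith) (by positivity)
      have h4 : ((E : ℝ) + 3 * D) * σ ≤ (E + 3 * D) * (2 * √(n : ℝ)) :=
        mul_le_mul_of_nonneg_left hσ2 (by positivity)
      linarith
    have h3 : 2 * (E + 3 * D) * √(n : ℝ) ≤
        (3 / (2 * δ) + (1 + K / c₀) + 2 * (E + 3 * D) + 1 / c₀) * √(n : ℝ) :=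
      mul_le_mul_of_nonneg_right (by linarith) hs0.le
    linarith
  · have hG : (n : ℝ) * excessProb (π n) (N n 0) ≤ 1 := by
      refine le_trans (mul_le_mul_of_nonneg_left ?_ hn0.le) hhen
      refine (excessProb_antitone (π n) ?_).trans (hEn (n.sqrt / M))
      have h1 := hn.le_fastest
      have h2 : ((n.sqrt / M : ℕ) : ℝ) ≤ √(n : ℝ) / M := by
        refine Nat.cast_div_le.trans ?_
        gcongr
        exact Real.nat_sqrt_le_real_sqrt
      have hM' : (0 : ℝ) < M := Nat.cast_pos.2 hM0
      have h3 : (E : ℝ) * σ ≤ δ / 2 * n := by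
        rw [div_le_iff₀ hδ] at hsn
        have h4 : (E : ℝ) * σ ≤ E * (2 * √(n : ℝ)) :=
          mul_le_mul_of_nonneg_left hσ2 (by positivity)
        have h5 := mul_le_mul_of_nonneg_right hsn hs0.le
        have h6 : √(n : ℝ) * δ * √(n : ℝ) = δ * (√(n : ℝ) * √(n : ℝ)) := by ring
        rw [h6, hss] at h5
        linarith
      have h4 : ((n.sqrt / M : ℕ) : ℝ) * (D * σ) ≤ δ / 2 * n := by
        have h5 : ((n.sqrt / M : ℕ) : ℝ) * (D * σ) ≤ √(n : ℝ) / M * (D * (2 * √(n : ℝ))) := by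
          gcongr
        have h6 : √(n : ℝ) / M * (D * (2 * √(n : ℝ))) = 2 * D / M * n := by
          have h8 : √(n : ℝ) / M * (D * (2 * √(n : ℝ))) =
              2 * D / M * (√(n : ℝ) * √(n : ℝ)) := by ring
          rw [h8, hss]
        have h7 : 2 * D / (M : ℝ) ≤ δ / 2 := by
          rw [div_lt_iff₀ hδ] at hM
          rw [div_le_iff₀ hM']
          linarith
        rw [h6] at h5
        exact h5.trans (mul_le_mul_of_nonneg_right h7 hn0.le)
      have h5 : (E : ℝ) * σ + ((n.sqrt / M : ℕ) : ℝ) * (D * σ) ≤ N n 0 := by linarith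
      exact_mod_cast h5
    -- By flow balance the mean is at most `Λ / c₀` times the probability of `N n 0` waiting jobs,
    -- and `n` times that probability is at most one.
    have key : ∀ r, (∀ (q : State (N n)) i, q.IsTarget j (i + 1) → r ≤ i → N n 0 ≤ q.excess) →
        ∫ q, (q.occ j (r + 1) : ℝ) ∂(π n).toMeasure ≤ 1 / c₀ := by
      intro r hr
      have h1 := hn'.mean_occ_le hn.rate_pos.le hμ0 (hn.pools_pos 0) j r (N n 0) hr
      have h2 : 0 ≤ ∫ q, (q.occ j (r + 1) : ℝ) ∂(π n).toMeasure :=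
        integral_nonneg fun q => Nat.cast_nonneg _
      have h3 := mul_le_mul_of_nonneg_right (hn.le_service j) h2
      have h4 := mul_le_mul_of_nonneg_right hn.rate_le (excessProb_nonneg (π n) (N n 0))
      rw [le_div_iff₀ hc₀]
      linarith
    rcases hji with ⟨hj, rfl⟩ | hi
    · have := key 1 fun q i ht hi => ht.fastest_le_excess (Or.inl ⟨hi, hj⟩)
      linarith
    · have h1 := key 2 fun q i ht hi => ht.fastest_le_excess (Or.inr hi)
      have h2 := mean_mono (π n) (bdd_occ j i) (bdd_occ j (2 + 1)) fun q =>
        Nat.cast_le.2 (q.anti j hi)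
      linarith

end SAJSQ

/-! ### Compact boxes in `ℓ¹` and tightness. -/

namespace SAJSQ

/-- The box is compact in the product topology by Tychonoff. Summability of `c` dominates the series
for the distance, so the inclusion into `ℓ¹` is continuous on it. -/
theorem isCompact_setOf_abs_le {ι : Type*} {c : ι → ℝ} (hc : Summable c) :
    IsCompact {f : lp (fun _ : ι => ℝ) 1 | ∀ p, |f p| ≤ c p} := by
  have hsum : ∀ x : ι → ℝ, (∀ p, |x p| ≤ c p) → Summable fun p => |x p| := fun x hx =>
    Summable.of_nonneg_of_le (fun p => abs_nonneg _) hx hc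
  have hmem : ∀ x : ι → ℝ, (∀ p, |x p| ≤ c p) → Memℓp (E := fun _ : ι => ℝ) x 1 := by
    intro x hx
    refine memℓp_gen ?_
    simpa using hsum x hx
  set T : Set (ι → ℝ) := Set.pi Set.univ fun p => Set.Icc (-c p) (c p) with hT
  have hTc : IsCompact T := isCompact_univ_pi fun p => isCompact_Icc
  have hTm : ∀ x : T, ∀ p, |x.1 p| ≤ c p := fun x p => abs_le.2 (x.2 p (Set.mem_univ p))
  let F : T → lp (fun _ : ι => ℝ) 1 := fun x => ⟨x.1, hmem x.1 (hTm x)⟩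
  have hnorm : ∀ x y : T, ‖F y - F x‖ = ∑' p, |y.1 p - x.1 p| := by
    intro x y
    rw [lp.norm_eq_tsum_rpow (by simp)]
    simp [F]
    rfl
  have hF : Continuous F := by
    rw [continuous_iff_continuousAt]
    intro x
    rw [ContinuousAt, tendsto_iff_norm_sub_tendsto_zero]
    simp_rw [hnorm]
    have h1 : Continuous fun y : T => ∑' p, |y.1 p - x.1 p| := by
      refine continuous_tsum (u := fun p => 2 * c p) (fun p => ?_) (hc.mul_left 2) fun p y => ?_
      · exact (((continuous_apply p).comp continuous_subtype_val).sub continuous_const).abs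
      · rw [Real.norm_eq_abs, abs_abs]
        refine (abs_sub _ _).trans ?_
        linarith [hTm x p, hTm y p]
    have h2 := h1.tendsto x
    simpa using h2
  have : CompactSpace T := isCompact_iff_compactSpace.1 hTc
  have h := isCompact_range hF
  convert h using 1
  ext f
  constructor
  · intro hf
    exact ⟨⟨f, fun p _ => abs_le.1 (hf p)⟩, rfl⟩
  · rintro ⟨x, rfl⟩ p
    exact hTm x p

variable {m : ℕ} {N : Fin (m + 1) → ℕ}

theorem abs_scaled_one (n : ℕ) (q : State N) (j : Fin (m + 1)) :
    |scaled n q j 1| = (√(n : ℝ))⁻¹ * ((N j : ℝ) - q.occ j 1) := by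
  have h1 : (q.occ j 1 : ℝ) ≤ N j := Nat.cast_le.2 (q.occ_le j 1)
  rw [scaled, if_pos rfl, abs_div, abs_of_nonneg (Real.sqrt_nonneg _), abs_sub_comm,
    abs_of_nonneg (by linarith), div_eq_inv_mul]

theorem abs_scaled_of_two_le (n : ℕ) (q : State N) (j : Fin (m + 1)) {i : ℕ} (hi : 2 ≤ i) :
    |scaled n q j i| = (√(n : ℝ))⁻¹ * q.occ j i := by
  rw [scaled, if_neg (by omega), abs_div, abs_of_nonneg (Real.sqrt_nonneg _),
    Nat.abs_cast, div_eq_inv_mul]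

/-- Occupancies decrease in the level, so two levels control all coordinates uniformly, and the
weights `ρ ^ (-i)` make the resulting box summable. -/
theorem abs_scaled_le_sum (n : ℕ) (q : State N) (j : Fin (m + 1)) (i : ℕ) :
    |scaled n q j (i + 1)| ≤ ∑ k, (|scaled n q k 1| + |scaled n q k 2|) := by
  have h1 : |scaled n q j (i + 1)| ≤ |scaled n q j 1| + |scaled n q j 2| := by
    rcases Nat.eq_zero_or_pos i with rfl | hi
    · exact le_add_of_nonneg_right (abs_nonneg _)
    · refine le_trans ?_ (le_add_of_nonneg_left (abs_nonneg _))
      rw [abs_scaled_of_two_le n q j (by omega), abs_scaled_of_two_le n q j le_rfl]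
      refine mul_le_mul_of_nonneg_left (Nat.cast_le.2 (q.anti j (by omega))) (by positivity)
  exact h1.trans (Finset.single_le_sum (f := fun k => |scaled n q k 1| + |scaled n q k 2|)
    (fun k _ => by positivity) (Finset.mem_univ j))

theorem bdd_abs_scaled_one (n : ℕ) (j : Fin (m + 1)) :
    ∃ B, ∀ q : State N, |(|scaled n q j 1|)| ≤ B := by
  refine ⟨(√(n : ℝ))⁻¹ * N j, fun q => ?_⟩
  rw [abs_abs, abs_scaled_one]
  have h2 : (0 : ℝ) ≤ q.occ j 1 := Nat.cast_nonneg _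
  exact mul_le_mul_of_nonneg_left (by linarith) (by positivity)

theorem bdd_abs_scaled_two (n : ℕ) (j : Fin (m + 1)) :
    ∃ B, ∀ q : State N, |(|scaled n q j 2|)| ≤ B := by
  refine ⟨(√(n : ℝ))⁻¹ * N j, fun q => ?_⟩
  rw [abs_abs, abs_scaled_of_two_le n q j le_rfl]
  exact mul_le_mul_of_nonneg_left (Nat.cast_le.2 (q.occ_le j 2)) (by positivity)

theorem summable_weights {ρ : ℝ} (hρ : 1 < ρ) (B : ℝ) :
    Summable fun p : Fin (m + 1) × ℕ => B * (ρ ^ (p.2 + 1))⁻¹ := by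
  refine Summable.mul_left B ?_
  have h0 : 0 < ρ := by linarith
  have h1 : Summable fun i : ℕ => (ρ ^ (i + 1))⁻¹ := by
    have := (summable_geometric_of_lt_one (inv_pos.2 h0).le (inv_lt_one_of_one_lt₀ hρ)).mul_left ρ⁻¹
    refine this.congr fun i => ?_
    rw [pow_succ', mul_inv, inv_pow]
  rw [summable_prod_of_nonneg fun p => by positivity]
  exact ⟨fun _ => h1, (hasSum_fintype _).summable⟩

theorem isTightMeasureSet_scaledSeq {N : ℕ → Fin (m + 1) → ℕ} {π : ∀ n, PMF (State (N n))}
    {n₀ : ℕ} {A : ℝ} (hA : 0 < A)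
    (h : ∀ n, n₀ ≤ n → ∫ q, ∑ k, (|scaled n q k 1| + |scaled n q k 2|) ∂(π n).toMeasure ≤ A)
    {ρ : ℝ} (hρ : 1 < ρ) :
    IsTightMeasureSet {ν | ∃ n, n₀ ≤ n ∧ ν = (π n).toMeasure.map (scaledSeq ρ n)} := by
  rw [isTightMeasureSet_iff_exists_isCompact_measure_compl_le]
  intro ε hε
  -- Replacing `ε` by `min ε 1` excludes the value `⊤`, so that Markov's inequality can be used over
  -- the reals.
  have hε1 : 0 < min ε 1 := lt_min hε one_pos
  have hεt : min ε 1 ≠ ⊤ := ((min_le_right _ _).trans_lt ENNReal.one_lt_top).ne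
  have hε' : 0 < (min ε 1).toReal := ENNReal.toReal_pos hε1.ne' hεt
  set B := A / (min ε 1).toReal with hB
  have hB0 : 0 < B := div_pos hA hε'
  have hK := isCompact_setOf_abs_le (summable_weights (m := m) hρ B)
  refine ⟨_, hK, ?_⟩
  rintro ν ⟨n, hn, rfl⟩
  rw [Measure.map_apply Measurable.of_discrete hK.measurableSet.compl]
  set H : State (N n) → ℝ := fun q => ∑ k, (|scaled n q k 1| + |scaled n q k 2|) with hH
  have hH0 : ∀ q, 0 ≤ H q := fun q => Finset.sum_nonneg fun k _ => by positivity
  have hHi : Integrable H (π n).toMeasure :=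
    integrable_finsetSum _ fun k _ => integrable_of_bdd _
      (bdd_add (bdd_abs_scaled_one n k) (bdd_abs_scaled_two n k))
  have hsub : scaledSeq ρ n ⁻¹' {f : lp (fun _ : Fin (m + 1) × ℕ => ℝ) 1 |
      ∀ p, |f p| ≤ B * (ρ ^ (p.2 + 1))⁻¹}ᶜ ⊆ {q : State (N n) | B ≤ H q} := by
    intro q hq
    by_contra hlt
    refine hq fun p => ?_
    have h1 : |scaled n q p.1 (p.2 + 1)| ≤ B :=
      (abs_scaled_le_sum n q p.1 p.2).trans (not_le.1 hlt).le
    have h2 : (0 : ℝ) ≤ (ρ ^ (p.2 + 1))⁻¹ := inv_nonneg.2 (pow_nonneg (by linarith) _)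
    change |(ρ ^ (p.2 + 1))⁻¹ * scaled n q p.1 (p.2 + 1)| ≤ _
    rw [abs_mul, abs_of_nonneg h2, mul_comm]
    exact mul_le_mul_of_nonneg_right h1 h2
  refine (measure_mono hsub).trans ?_
  have h1 := mul_meas_ge_le_integral_of_nonneg (ae_of_all _ hH0) hHi B
  have h2 : (π n).toMeasure.real {q | B ≤ H q} ≤ (min ε 1).toReal := by
    have h3 := h1.trans (h n hn)
    have h4 : A = B * (min ε 1).toReal := by rw [hB]; field_simp
    rw [h4] at h3
    exact le_of_mul_le_mul_left h3 hB0
  refine le_trans ?_ (min_le_left ε 1)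
  rwa [Measure.real, ENNReal.toReal_le_toReal (measure_ne_top _ _) hεt] at h2

end SAJSQ

/-! ### Assembly of the theorem. -/

theorem mainTheorem3 (m : ℕ) (μ γ : Fin (m + 1) → ℝ) (β : ℝ) (lam : ℕ → ℝ)
    (N : ℕ → Fin (m + 1) → ℕ)
    (hμ_pos : ∀ j, 0 < μ j) (hμ_anti : StrictAnti μ)
    (hγ_pos : ∀ j, 0 < γ j) (hcap : ∑ j, μ j * γ j = 1)
    (hβ : 0 < β) (hlam_pos : ∀ n, 0 < lam n) (hlam_lt : ∀ n, lam n < 1)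
    (hN : ∀ n, ∑ j, N n j = n)
    (hA1 : Tendsto (fun n : ℕ => √(n : ℝ) * (1 - lam n)) atTop (𝓝 β))
    (hA2 : ∀ j, Tendsto (fun n : ℕ => √(n : ℝ) * |(N n j : ℝ) / (n : ℝ) - γ j|) atTop (𝓝 0)) :
    ∃ (n₀ : ℕ) (π : ∀ n, PMF (SAJSQ.State (N n))),
      (∀ n, n₀ ≤ n → SAJSQ.IsStationary (n * lam n) μ (π n) ∧
        ∀ π' : PMF (SAJSQ.State (N n)), SAJSQ.IsStationary (n * lam n) μ π' → π' = π n) ∧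
      (∃ C₁ C₂ C₃ : ℝ, 0 < C₁ ∧ 0 < C₂ ∧ 0 < C₃ ∧ ∀ᶠ n : ℕ in atTop,
        (∀ j, j < Fin.last m →
          ∫ q, |SAJSQ.scaled n q j 1| ∂(π n).toMeasure < C₁ * (n : ℝ) ^ (-(1 / 2) : ℝ)) ∧
        ∫ q, |SAJSQ.scaled n q (Fin.last m) 1| ∂(π n).toMeasure ≤ C₂ ∧
        ∫ q, |SAJSQ.scaled n q 0 2| ∂(π n).toMeasure ≤ C₃) ∧
      (∀ a : ℝ, 1 / 2 < a → a < 1 → ∃ C₄ : ℝ, 0 < C₄ ∧ ∀ᶠ n : ℕ in atTop,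
        ∀ j i, ((0 < j ∧ i = 2) ∨ 3 ≤ i) →
          ∫ q, |SAJSQ.scaled n q j i| ∂(π n).toMeasure ≤ C₄ * (n : ℝ) ^ (-(a - 1 / 2))) ∧
      (∀ ρ : ℝ, 1 < ρ → IsTightMeasureSet
        {ν | ∃ n, n₀ ≤ n ∧ ν = (π n).toMeasure.map (SAJSQ.scaledSeq ρ n)}) := by
  classical
  obtain ⟨δ, hδ, hR⟩ := SAJSQ.eventually_regime hμ_pos hμ_anti hγ_pos hcap hβ hlam_pos hlam_lt
    hN hA1 hA2
  have hex : ∀ n, ∃ π : PMF (SAJSQ.State (N n)),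
      SAJSQ.Regime μ β (μ (Fin.last m)) (μ 0) δ (N n) n (n * lam n) →
        SAJSQ.DriftBound (n * lam n) μ π := by
    intro n
    by_cases h : SAJSQ.Regime μ β (μ (Fin.last m)) (μ 0) δ (N n) n (n * lam n)
    · have hlt : n * lam n < ∑ k, μ k * (N n k : ℝ) := by
        have h1 : (1 : ℝ) ≤ n := by exact_mod_cast h.one_le
        have h2 : 0 < √(n : ℝ) := Real.sqrt_pos.2 (by linarith)
        have h3 : 0 < β / 2 * √(n : ℝ) := by positivity
        linarith [h.le_gap]
      obtain ⟨π, hπ⟩ := SAJSQ.exists_driftBound h.rate_pos hμ_pos h.pools_pos hlt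
      exact ⟨π, fun _ => hπ⟩
    · exact ⟨PMF.pure (SAJSQ.State.empty (N n)), fun h' => absurd h' h⟩
  choose π hπ using hex
  have hπ' : ∀ᶠ n : ℕ in atTop, SAJSQ.DriftBound (n * lam n) μ (π n) := hR.mono fun n hn => hπ n hn
  obtain ⟨C, hC, hmom⟩ := SAJSQ.exists_moment_bounds hβ (hμ_pos _) (hμ_pos 0) hδ π hR hπ'
  obtain ⟨n₀, hn₀⟩ := eventually_atTop.1 (hR.and hmom)
  have hs : ∀ n, n₀ ≤ n → 1 ≤ √(n : ℝ) := fun n hn =>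
    Real.one_le_sqrt.2 (by exact_mod_cast (hn₀ n hn).1.one_le)
  have hs' : ∀ n, n₀ ≤ n → (√(n : ℝ))⁻¹ * (C * √(n : ℝ)) = C := fun n hn => by
    have := hs n hn
    have : √(n : ℝ) ≠ 0 := by positivity
    field_simp
  have hsC : ∀ n, n₀ ≤ n → (√(n : ℝ))⁻¹ * C ≤ C := fun n hn =>
    mul_le_of_le_one_left hC.le (inv_le_one_of_one_le₀ (hs n hn))
  have hfast : ∀ n, n₀ ≤ n → ∀ j, j < Fin.last m →
      ∫ q, |SAJSQ.scaled n q j 1| ∂(π n).toMeasure ≤ (√(n : ℝ))⁻¹ * C := by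
    intro n hn j hj
    simp_rw [SAJSQ.abs_scaled_one]
    rw [integral_const_mul]
    exact mul_le_mul_of_nonneg_left ((hn₀ n hn).2.1 j hj) (by positivity)
  have hslow : ∀ n, n₀ ≤ n →
      ∫ q, |SAJSQ.scaled n q (Fin.last m) 1| ∂(π n).toMeasure ≤ C := by
    intro n hn
    simp_rw [SAJSQ.abs_scaled_one]
    rw [integral_const_mul]
    exact (mul_le_mul_of_nonneg_left (hn₀ n hn).2.2.1 (by positivity)).trans (hs' n hn).le
  have htwo : ∀ n, n₀ ≤ n → ∫ q, |SAJSQ.scaled n q 0 2| ∂(π n).toMeasure ≤ C := by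
    intro n hn
    simp_rw [SAJSQ.abs_scaled_of_two_le n _ 0 le_rfl]
    rw [integral_const_mul]
    exact (mul_le_mul_of_nonneg_left (hn₀ n hn).2.2.2.1 (by positivity)).trans (hs' n hn).le
  have hhigh : ∀ n, n₀ ≤ n → ∀ j i, ((0 < j ∧ i = 2) ∨ 3 ≤ i) →
      ∫ q, |SAJSQ.scaled n q j i| ∂(π n).toMeasure ≤ (√(n : ℝ))⁻¹ * C := by
    intro n hn j i hji
    have hi : 2 ≤ i := by omega
    simp_rw [SAJSQ.abs_scaled_of_two_le n _ j hi]
    rw [integral_const_mul]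
    exact mul_le_mul_of_nonneg_left ((hn₀ n hn).2.2.2.2 j i hji) (by positivity)
  have hrpow : ∀ n : ℕ, (n : ℝ) ^ (-(1 / 2) : ℝ) = (√(n : ℝ))⁻¹ := fun n => by
    rw [Real.rpow_neg (Nat.cast_nonneg n), Real.sqrt_eq_rpow]
  -- `C + 1` makes the first bound strict.
  refine ⟨n₀, π, fun n hn => ?_, ⟨C + 1, C, C, by linarith, hC, hC, ?_⟩, fun a _ ha => ⟨C, hC, ?_⟩,
    fun ρ hρ => ?_⟩
  · have h := (hn₀ n hn).1
    have hst := (hπ n h).isStationary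
    exact ⟨hst, fun π' hπ' => hst.unique h.rate_pos.le hμ_pos h.pools_pos hπ'⟩
  · filter_upwards [eventually_ge_atTop n₀] with n hn
    refine ⟨fun j hj => (hfast n hn j hj).trans_lt ?_, hslow n hn, htwo n hn⟩
    rw [hrpow, mul_comm]
    have := hs n hn
    exact mul_lt_mul_of_pos_right (by linarith) (by positivity)
  · filter_upwards [eventually_ge_atTop n₀] with n hn j i hji
    refine (hhigh n hn j i hji).trans ?_
    rw [mul_comm, ← hrpow]
    refine mul_le_mul_of_nonneg_left ?_ hC.le
    have h1 : (1 : ℝ) ≤ n := by exact_mod_cast (hn₀ n hn).1.one_le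
    -- The bound obtained is of order `n ^ (-1/2)`, which is stronger than required because `a < 1`.
    exact Real.rpow_le_rpow_of_exponent_le h1 (by linarith)
  · refine SAJSQ.isTightMeasureSet_scaledSeq (A := (m + 1) * (C + C)) (by positivity)
      (fun n hn => ?_) hρ
    rw [integral_finsetSum _ fun k _ => SAJSQ.integrable_of_bdd _
      (SAJSQ.bdd_add (SAJSQ.bdd_abs_scaled_one n k) (SAJSQ.bdd_abs_scaled_two n k))]
    have h1 : ∀ k : Fin (m + 1), ∫ q, (|SAJSQ.scaled n q k 1| + |SAJSQ.scaled n q k 2|)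
        ∂(π n).toMeasure ≤ C + C := by
      intro k
      rw [integral_add (SAJSQ.integrable_of_bdd _ (SAJSQ.bdd_abs_scaled_one n k))
        (SAJSQ.integrable_of_bdd _ (SAJSQ.bdd_abs_scaled_two n k))]
      refine add_le_add ?_ ?_
      · rcases (Fin.le_last k).lt_or_eq with hk | rfl
        · exact (hfast n hn k hk).trans (hsC n hn)
        · exact hslow n hn
      · rcases (Fin.zero_le k).lt_or_eq with hk | rfl
        · exact (hhigh n hn k 2 (Or.inl ⟨hk, rfl⟩)).trans (hsC n hn)
        · exact htwo n hn
    refine (Finset.sum_le_sum fun k _ => h1 k).trans (le_of_eq ?_)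
    simp
    ring
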